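/- Let $(X_s)_{s\ge 0}$ be a real-valued stochastic process on a probability space, let $t\ge 0$ and $\tau>0$, and put $Y_\varepsilon:=X^{(\varepsilon t)}_{\varepsilon\tau}:=X_{\varepsilon t+\varepsilon\tau}-X_{\varepsilon t}$ for $\varepsilon>0$. Let $$\Lambda_\varepsilon(u):=\varepsilon\log\mathbb E\big[e^{uY_\varepsilon/\varepsilon}\big],\qquad \mathcal D_\varepsilon:=\{u\in\mathbb R:\ \mathbb E[e^{uY_\varepsilon/\varepsilon}]<\infty\},\qquad \mathcal D_0:=\lim_{\varepsilon\downarrow0}\mathcal D_\varepsilon,$$ where it is assumed that the limit exists, i.e. $\bigcup_{\varepsilon>0}\bigcap_{0<s\le\varepsilon}\mathcal D_s=\bigcap_{\varepsilon>0}\bigcup_{0<s\le\varepsilon}\mathcal D_s$; let $\mathcal D_0^o$ be the interior of $\mathcal D_0$. For complex $z$ with $\Re z\in\mathcal D_\varepsilon$ write $\Re\Lambda_\varepsilon(z)=\varepsilon\log\big|\mathbb E[e^{zY_\varepsilon/\varepsilon}]\big|\in[-\infty,\infty)$. Assume that there are functions $\Lambda_0,\Lambda_1,\Lambda_2$ such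 that: (i) for each $u\in\mathcal D_0^o$, $\Lambda_\varepsilon(u)=\Lambda_0(u)+\Lambda_1(u)\varepsilon+\Lambda_2(u)\varepsilon^2+O(\varepsilon^3)$ as $\varepsilon\downarrow0$; (ii) there is $\varepsilon_0>0$ such that $(\varepsilon,u)\mapsto\Lambda_\varepsilon(u)$ is finite and of class $C^\infty$ on $(0,\varepsilon_0)\times\mathcal D_0^o$; (iii) $0\in\mathcal D_0^o$; (iv) $\Lambda_0$ is strictly convex and essentially smooth on $\mathcal D_0^o$, that is, differentiable on $\mathcal D_0^o$ with $|\Lambda_0'(u_n)|\to\infty$ whenever $u_n\in\mathcal D_0^o$ converges to a boundary point of $\mathcal D_0^o$; (v) $\Lambda_0$ has an analytic continuation, again denoted $\Lambda_0$, from $\mathcal D_0^o\setminus\{0\}$ to $\{z\in\mathbb C:\Re z\in\mathcal D_0^o\setminus\{0\}\}$, and for every $p_r\in\mathcal D_0^o\setminus\{0\}$: (a) $\Re\Lambda_\varepsilon(p_r+ip_i)=\Re\Lambda_0(p_r+ip_i)+O(\varepsilon)$ as $\varepsilon\downarrow 0$, uniformly for $p_i$ in bounded subsets of $\mathbb R$;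 (b) $L(p_i):=\Re\Lambda_0(p_r+ip_i)$, $p_i\in\mathbb R$, has its unique maximum at $p_i=0$ and is bounded away from $L(0)$ as $|p_i|\to\infty$; (c) there are $\varepsilon_1,p_i^*>0$ and $M$ such that $\Re\Lambda_\varepsilon(p_r+ip_i)-\Re\Lambda_0(p_r+ip_i)\le M\varepsilon$ for all $|p_i|\ge p_i^*$ and $0<\varepsilon\le\varepsilon_1$. For $k\in\mathbb R$ let $\Lambda^*(k):=\sup_{u\in\mathcal D_0^o}\{uk-\Lambda_0(u)\}$, and call $u\in\mathcal D_0^o$ with $\Lambda_0'(u)=k$ a saddlepoint for $k$. Then: * If $\mathcal D_0$ is bounded above, every $k>\Lambda_0'(0)$ has a saddlepoint; if $\mathcal D_0$ is bounded below, every $k<\Lambda_0'(0)$ has one. * Let $k\neq\Lambda_0'(0)$ have a saddlepoint $u^*=u^*(k)$. It is unique and nonzero, $\Lambda_0$ and $\Lambda_1$ are $C^\infty$ near $u^*$, and $\Lambda_0''(u^*)>0$. With $\Lambda_i:=\Lambda_i(u^*)$, $\Lambda_{i,l}:=\Lambda_i^{(l)}(u^*)$ and $$\Upsilon(0,k):=\Lambda_2-\frac{5\Lambda_{0,3}^2}{24\Lambda_{0,2}^3}+\frac{4\Lambda_{1,1}\Lambda_{0,3}+\Lambda_{0,4}}{8\Lambda_{0,2}^2}-\frac{\Lambda_{1,1}^2+\Lambda_{1,2}}{2\Lambda_{0,2}}-\frac{\Lambda_{0,3}}{u^*\Lambda_{0,2}^2}-\frac{3-2u^*\Lambda_{1,1}}{(u^*)^2\Lambda_{0,2}},$$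 one has, as $\varepsilon\downarrow0$ (the expectations being finite for all small $\varepsilon$), $$\frac{e^{-\Lambda^*(k)/\varepsilon+k+\Lambda_1}\,\varepsilon^{3/2}}{(u^*)^2\sqrt{2\pi\Lambda_{0,2}}}\left(1+\Big(\Upsilon(0,k)+\frac1{u^*}\Big)\varepsilon+O(\varepsilon^2)\right)=\begin{cases}\mathbb E\big(e^{Y_\varepsilon}-e^k\big)^+,&k>\Lambda_0'(0),\\[2pt]\mathbb E\big(e^k-e^{Y_\varepsilon}\big)^+,&k<\Lambda_0'(0).\end{cases}$$ -/

import Mathlib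

open MeasureTheory ProbabilityTheory Filter Topology Set Asymptotics

namespace FwdStart

variable {Ω : Type*} [MeasurableSpace Ω]

/-- The forward increment `X_τ^{(t)} = X_{t+τ} - X_t`. -/
def fwd (X : ℝ → Ω → ℝ) (t τ : ℝ) : Ω → ℝ := fun w => X (t + τ) w - X t w

/-- The diagonal small-maturity family `Y_ε = X_{ετ}^{(εt)}`. -/
def diagFwd (X : ℝ → Ω → ℝ) (t τ : ℝ) : ℝ → Ω → ℝ := fun ε => fwd X (ε * t) (ε * τ)

/-- Renormalised log moment generating function `Λ_ε(u) = ε log E[exp(u Y_ε / ε)]`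
(meaningful for `u ∈ lmgfDomain μ Y ε`). -/
noncomputable def lmgf (μ : Measure Ω) (Y : ℝ → Ω → ℝ) (ε u : ℝ) : ℝ :=
  ε * cgf (Y ε) μ (u / ε)

/-- Effective domain `D_ε`: those real `u` for which `E[exp(u Y_ε / ε)]` is finite. -/
def lmgfDomain (μ : Measure Ω) (Y : ℝ → Ω → ℝ) (ε : ℝ) : Set ℝ :=
  {u | u / ε ∈ integrableExpSet (Y ε) μ}

/-- `liminf_{ε ↓ 0} D_ε`. -/
def liminfDomain (D : ℝ → Set ℝ) : Set ℝ := ⋃ ε ∈ Ioi (0 : ℝ), ⋂ s ∈ Ioc (0 : ℝ) ε, D s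

/-- `limsup_{ε ↓ 0} D_ε`. -/
def limsupDomain (D : ℝ → Set ℝ) : Set ℝ := ⋂ ε ∈ Ioi (0 : ℝ), ⋃ s ∈ Ioc (0 : ℝ) ε, D s

/-- The limiting domain `D_0` (to be used when the liminf and limsup coincide). -/
def limDomain (μ : Measure Ω) (Y : ℝ → Ω → ℝ) : Set ℝ := liminfDomain (lmgfDomain μ Y)

/-- `Re Λ_ε(z) = ε log |E[exp(z Y_ε / ε)]|` for complex `z`. The real part does not depend on
the branch of the logarithm. It is used only where the expectation is nonzero. -/
noncomputable def lmgfRe (μ : Measure Ω) (Y : ℝ → Ω → ℝ) (ε : ℝ) (z : ℂ) : ℝ :=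
  ε * Real.log ‖complexMGF (Y ε) μ (z / ε)‖

/-- Essential smoothness of `h` on the open set `S`: `S` is nonempty, `h` is differentiable on `S`,
and `|h'|` tends to infinity at every boundary point of `S`. -/
structure EssentiallySmoothOn (h : ℝ → ℝ) (S : Set ℝ) : Prop where
  nonempty : S.Nonempty
  differentiable : DifferentiableOn ℝ h S
  steep : ∀ x ∈ frontier S, Tendsto (fun u => |deriv h u|) (𝓝[S] x) atTop

/-- The point `p_r + i p_i`. -/
def cpt (pr pi : ℝ) : ℂ := ⟨pr, pi⟩

/-- Tail error control on the open set `S` for the limit `Λ₀`, whose values at complex arguments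
are those of its analytic continuation `F` (unique, since it is prescribed on the real points). -/
def TailControl (μ : Measure Ω) (Y : ℝ → Ω → ℝ) (Λ₀ : ℝ → ℝ) (S : Set ℝ) : Prop :=
  ∃ F : ℂ → ℂ, DifferentiableOn ℂ F {z : ℂ | z.re ∈ S ∧ z.re ≠ 0} ∧
    (∀ u ∈ S, u ≠ 0 → F (u : ℂ) = (Λ₀ u : ℂ)) ∧
    ∀ pr ∈ S, pr ≠ 0 →
      -- (a) first-order convergence of the real parts, uniformly for `p_i` in bounded sets
      (∀ B > 0, ∃ C > 0, ∃ ε₁ > 0, ∀ ε ∈ Ioo 0 ε₁, ∀ pi : ℝ, |pi| ≤ B →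
        complexMGF (Y ε) μ (cpt pr pi / ε) ≠ 0 ∧
        |lmgfRe μ Y ε (cpt pr pi) - (F (cpt pr pi)).re| ≤ C * ε) ∧
      -- (b) unique maximum at zero, and bounded away from it at infinity
      (∀ pi : ℝ, pi ≠ 0 → (F (cpt pr pi)).re < (F (cpt pr 0)).re) ∧
      (∃ δ > 0, ∃ B > 0, ∀ pi : ℝ, B ≤ |pi| →
        (F (cpt pr pi)).re ≤ (F (cpt pr 0)).re - δ) ∧
      -- (c) uniform upper bound in the tails (nothing is required where `Re Λ_ε = -∞`)
      (∃ ε₁ > 0, ∃ pstar > 0, ∃ M : ℝ, ∀ ε ∈ Ioc 0 ε₁, ∀ pi : ℝ, pstar ≤ |pi| →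
        complexMGF (Y ε) μ (cpt pr pi / ε) ≠ 0 →
        lmgfRe μ Y ε (cpt pr pi) - (F (cpt pr pi)).re ≤ M * ε)

/-- The standing assumptions on the family `(Y_ε)_{ε>0}`, with expansion coefficients
`Λ₀, Λ₁, Λ₂` (determined on the interior of `D_0` by the expansion). -/
structure StandingAssumptions (μ : Measure Ω) (Y : ℝ → Ω → ℝ) (Λ₀ Λ₁ Λ₂ : ℝ → ℝ) : Prop where
  /-- The limit of the sets `D_ε` exists. -/
  domain_lim : liminfDomain (lmgfDomain μ Y) = limsupDomain (lmgfDomain μ Y)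
  /-- Expansion property. -/
  expansion : ∀ u ∈ interior (limDomain μ Y),
    (fun ε => lmgf μ Y ε u - (Λ₀ u + Λ₁ u * ε + Λ₂ u * ε ^ 2)) =O[𝓝[>] 0] fun ε => ε ^ 3
  /-- Differentiability (in particular finiteness) of `(ε, u) ↦ Λ_ε(u)`. -/
  smooth : ∃ ε₀ > 0, (∀ ε ∈ Ioo 0 ε₀, interior (limDomain μ Y) ⊆ lmgfDomain μ Y ε) ∧
    ContDiffOn ℝ (⊤ : ℕ∞) (fun x : ℝ × ℝ => lmgf μ Y x.1 x.2)
      (Ioo 0 ε₀ ×ˢ interior (limDomain μ Y))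
  /-- Non-degenerate interior. -/
  zero_mem : (0 : ℝ) ∈ interior (limDomain μ Y)
  /-- Strict convexity and essential smoothness of the limit. -/
  strictConvex : StrictConvexOn ℝ (interior (limDomain μ Y)) Λ₀
  essSmooth : EssentiallySmoothOn Λ₀ (interior (limDomain μ Y))
  /-- Tail error control. -/
  tail : TailControl μ Y Λ₀ (interior (limDomain μ Y))

/-- `u` is the saddlepoint `u*(k)`: `u ∈ S` and `Λ₀'(u) = k`. -/
def IsSaddlepoint (Λ₀ : ℝ → ℝ) (S : Set ℝ) (k u : ℝ) : Prop := u ∈ S ∧ deriv Λ₀ u = k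

/-- Fenchel-Legendre transform of `Λ₀` over `S`. -/
noncomputable def legendre (Λ₀ : ℝ → ℝ) (S : Set ℝ) (k : ℝ) : ℝ :=
  sSup ((fun u => u * k - Λ₀ u) '' S)

/-- `Υ(b, k)`, written as a function of `b` and `u = u*(k)`. -/
noncomputable def Upsilon (Λ₀ Λ₁ Λ₂ : ℝ → ℝ) (b u : ℝ) : ℝ :=
  Λ₂ u - 5 * iteratedDeriv 3 Λ₀ u ^ 2 / (24 * iteratedDeriv 2 Λ₀ u ^ 3)
    + (4 * deriv Λ₁ u * iteratedDeriv 3 Λ₀ u + iteratedDeriv 4 Λ₀ u)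
        / (8 * iteratedDeriv 2 Λ₀ u ^ 2)
    - (deriv Λ₁ u ^ 2 + iteratedDeriv 2 Λ₁ u) / (2 * iteratedDeriv 2 Λ₀ u)
    - iteratedDeriv 3 Λ₀ u / (2 * u * iteratedDeriv 2 Λ₀ u ^ 2)
    - iteratedDeriv 3 Λ₀ u / (2 * (u - b) * iteratedDeriv 2 Λ₀ u ^ 2)
    - (deriv Λ₁ u * (b - 2 * u) + 3) / (u * (u - b) * iteratedDeriv 2 Λ₀ u)
    - b ^ 2 / (u ^ 2 * (u - b) ^ 2 * iteratedDeriv 2 Λ₀ u)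

/-- Leading term `exp(-Λ*(k)/ε + k + Λ₁(u)) ε^{3/2} / (u² √(2π Λ₀''(u)))`, with `u = u*(k)`. -/
noncomputable def leading (Λ₀ Λ₁ : ℝ → ℝ) (S : Set ℝ) (k u ε : ℝ) : ℝ :=
  Real.exp (-legendre Λ₀ S k / ε + k + Λ₁ u) * ε ^ (3 / 2 : ℝ)
    / (u ^ 2 * Real.sqrt (2 * Real.pi * iteratedDeriv 2 Λ₀ u))

/-- Call payoff `(e^y - e^k)^+`. -/
noncomputable def callPayoff (k y : ℝ) : ℝ := max (Real.exp y - Real.exp k) 0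

/-- Put payoff `(e^k - e^y)^+`. -/
noncomputable def putPayoff (k y : ℝ) : ℝ := max (Real.exp k - Real.exp y) 0

/-- The price `E[g(Y_ε)]` is well defined for small `ε` and equals
`leading(ε) (1 + (Υ(0,k) + 1/u*(k)) ε + O(ε²))` as `ε ↓ 0`. -/
def PriceExpansion (μ : Measure Ω) (Y : ℝ → Ω → ℝ) (Λ₀ Λ₁ Λ₂ : ℝ → ℝ) (S : Set ℝ)
    (k u : ℝ) (g : ℝ → ℝ) : Prop :=
  (∀ᶠ ε in 𝓝[>] (0 : ℝ), Integrable (fun w => g (Y ε w)) μ) ∧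
  ∃ R : ℝ → ℝ, R =O[𝓝[>] 0] (fun ε => ε ^ 2) ∧
    ∀ᶠ ε in 𝓝[>] (0 : ℝ), ∫ w, g (Y ε w) ∂μ =
      leading Λ₀ Λ₁ S k u ε * (1 + (Upsilon Λ₀ Λ₁ Λ₂ 0 u + 1 / u) * ε + R ε)

end FwdStart

/-! The price is an inverse Fourier integral of the moment generating function along the vertical
line through the saddlepoint `u`, to which Laplace's method is applied. Write `E[exp(z Y_ε/ε)] =
exp(F z/ε) g_ε(z)`, with `F` the continuation of `Λ₀` and `g_ε` the function `mgfRatio`. The phase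
`F(u+iv) - F(u) - ikv` has a nondegenerate maximum of its real part at `v = 0`, and the amplitude is
`g_ε(z)/(z(z-ε))`.

The difficulty is the amplitude. Laplace's method needs its first two derivatives at `u`, but the
expansion of `Λ_ε` is assumed only pointwise at real points, with constants that may vary with the
point, and no regularity of `Λ₁` is given. Tail control bounds `g_ε` on each vertical line, again
with constants depending on the line. `exists_uniform_bound_on_strip` turns this into a uniform
bound on a strip: `Re F` is bounded above, so Borel-Carathéodory limits the growth of `F`, and
Phragmén-Lindelöf needs only the two boundary lines.

For the bounded holomorphic family `g_ε`, the combination `g_ε - 3g_{ε/2} + 2g_{ε/4}` cancels the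
unknown terms of order `1` and `ε`, so it is `O(ε²)` at each real point. On a set of large measure
the constant is uniform. `norm_le_rpow_of_small_on_set` then gives `O(ε^{3/2})` on a complex disc,
by interpolation at separated points of that set. Since `3/2 > 1`, summing over dyadic scales gives
`g_ε = G + O(ε)` with `G` holomorphic and equal to `exp Λ₁` on the reals
(`exists_holomorphic_limit`). Hence `Λ₁` is smooth, and Cauchy's estimates control the derivatives
of the amplitude; its value at `u` has the assumed second order expansion.

Positivity of `Λ₀''` does not follow from strict convexity alone. It comes from analyticity together
with the maximum of `Re F` on vertical lines (`iteratedDeriv_two_re_pos`). The damped transforms of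
the call and put payoffs are the same rational function, on opposite sides of its poles, so one
computation covers both signs of `u`. -/

/-! ### Interpolation and propagation of smallness from a real set. -/

/-- Dividing a bounded holomorphic function by a linear factor at one of its zeros. -/
theorem norm_dslope_le_of_bounded {h : ℂ → ℂ} {c t : ℂ} {r ρ M : ℝ} (hρr : ρ < r)
    (hd : DifferentiableOn ℂ h (Metric.ball c r)) (hM : ∀ z ∈ Metric.ball c r, ‖h z‖ ≤ M)
    (ht : ‖t - c‖ ≤ ρ) (h0 : h t = 0) {z : ℂ} (hz : z ∈ Metric.ball c r) :
    ‖dslope h t z‖ ≤ M / (r - ρ) := by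
  have htb : t ∈ Metric.ball c r := by rw [mem_ball_iff_norm]; linarith
  have hds : DifferentiableOn ℂ (dslope h t) (Metric.ball c r) :=
    (Complex.differentiableOn_dslope (Metric.isOpen_ball.mem_nhds htb)).2 hd
  rw [le_div_iff₀ (by linarith)]
  rw [mem_ball_iff_norm] at hz
  -- Maximum principle on the disc of radius `r' < r`: on its boundary the quotient is `h w/(w - t)`
  -- with `|w - t| ≥ r' - ρ`. Then `r'` tends to `r`.
  have key : ∀ᶠ r' in 𝓝[<] r, ‖dslope h t z‖ * (r' - ρ) ≤ M := by
    have h1 : Ioo (max ρ ‖z - c‖) r ∈ 𝓝[<] r := Ioo_mem_nhdsLT (max_lt hρr hz)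
    filter_upwards [h1] with r' hr'
    have hr1 : ρ < r' := (le_max_left _ _).trans_lt hr'.1
    have hr2 : ‖z - c‖ < r' := (le_max_right _ _).trans_lt hr'.1
    rw [← le_div_iff₀ (by linarith)]
    have hr0 : r' ≠ 0 := by linarith [norm_nonneg (z - c)]
    refine Complex.norm_le_of_forall_mem_frontier_norm_le (U := Metric.ball c r')
      Metric.isBounded_ball ?_ ?_ (subset_closure (by rwa [mem_ball_iff_norm]))
    · refine DifferentiableOn.diffContOnCl (hds.mono ?_)
      rw [closure_ball c hr0]
      exact Metric.closedBall_subset_ball hr'.2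
    · intro w hw
      rw [frontier_ball c hr0, mem_sphere_iff_norm] at hw
      have hwt : r' - ρ ≤ ‖w - t‖ := by
        have := norm_sub_norm_le (w - c) (t - c)
        simp only [sub_sub_sub_cancel_right] at this
        linarith
      have hne : w ≠ t := by
        rintro rfl
        simp at hwt
        linarith
      rw [dslope_of_ne _ hne, slope_def_field, h0, sub_zero, norm_div]
      gcongr
      · exact (norm_nonneg _).trans (hM w (by rw [mem_ball_iff_norm]; linarith [hr'.2]))
      · exact hM w (by rw [mem_ball_iff_norm]; linarith [hr'.2])
  have ht : Tendsto (fun r' => ‖dslope h t z‖ * (r' - ρ)) (𝓝[<] r)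
      (𝓝 (‖dslope h t z‖ * (r - ρ))) :=
    Continuous.tendsto (by fun_prop) r |>.mono_left nhdsWithin_le_nhds
  exact le_of_tendsto ht key

/-- Schwarz lemma with several zeros. -/
theorem norm_le_prod_of_zeros {ι : Type*} [DecidableEq ι] (s : Finset ι) {c : ℂ} {r ρ : ℝ}
    (hρr : ρ < r) (t : ι → ℂ) (ht : ∀ i ∈ s, ‖t i - c‖ ≤ ρ) (hinj : Set.InjOn t s) :
    ∀ {h : ℂ → ℂ} {M : ℝ}, DifferentiableOn ℂ h (Metric.ball c r) →
      (∀ z ∈ Metric.ball c r, ‖h z‖ ≤ M) → (∀ i ∈ s, h (t i) = 0) →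
      ∀ z ∈ Metric.ball c r, ‖h z‖ ≤ M * ∏ i ∈ s, (‖z - t i‖ / (r - ρ)) := by
  induction s using Finset.induction_on with
  | empty => intro h M _ hM _ z hz; simpa using hM z hz
  | insert a s ha ih =>
    intro h M hd hM h0 z hz
    have hta : ‖t a - c‖ ≤ ρ := ht a (by simp)
    have htb : t a ∈ Metric.ball c r := by rw [mem_ball_iff_norm]; linarith
    have hds : DifferentiableOn ℂ (dslope h (t a)) (Metric.ball c r) :=
      (Complex.differentiableOn_dslope (Metric.isOpen_ball.mem_nhds htb)).2 hd
    have ha0 : h (t a) = 0 := h0 a (by simp)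
    have h1 := ih (fun i hi => ht i (by simp [hi]))
      (hinj.mono (by simp)) hds
      (fun w hw => norm_dslope_le_of_bounded hρr hd hM hta ha0 hw)
      -- Distinctness of the zeros keeps the remaining ones after one has been divided out.
      (fun i hi => by
        have hne : t i ≠ t a := fun h => ha (by
          have := hinj (by simp [hi]) (by simp) h
          rwa [← this])
        rw [dslope_of_ne _ hne, slope_def_field, ha0, h0 i (by simp [hi])]
        simp) z hz
    have h2 : h z = (z - t a) * dslope h (t a) z := by
      have := sub_smul_dslope h (t a) z
      rw [ha0, sub_zero, smul_eq_mul] at this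
      exact this.symm
    rw [h2, norm_mul, Finset.prod_insert ha]
    calc ‖z - t a‖ * ‖dslope h (t a) z‖
        ≤ ‖z - t a‖ * (M / (r - ρ) * ∏ i ∈ s, (‖z - t i‖ / (r - ρ))) := by gcongr
      _ = _ := by ring

/-- A compact set of large measure contains many well separated points. -/
theorem exists_separated_points {d : ℝ} (hd : 0 < d) (n : ℕ) :
    ∀ {A : Set ℝ}, IsCompact A → ENNReal.ofReal (n * d) < volume A →
      ∃ t : ℕ → ℝ, ∀ i ≤ n, t i ∈ A ∧ ∀ j, i ≤ j → j ≤ n → ((j : ℝ) - i) * d ≤ t j - t i := by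
  induction n with
  | zero =>
    intro A _ hv
    obtain ⟨x, hx⟩ : A.Nonempty := by
      by_contra h
      rw [not_nonempty_iff_eq_empty] at h
      simp [h] at hv
    refine ⟨fun _ => x, fun i hi => ⟨hx, fun j hij hj => ?_⟩⟩
    obtain rfl : j = 0 := by omega
    obtain rfl : i = 0 := by omega
    simp
  | succ n ih =>
    intro A hA hv
    have hne : A.Nonempty := by
      by_contra h
      rw [not_nonempty_iff_eq_empty] at h
      simp [h] at hv
    -- Greedy choice: take the least point and discard `[x, x + d)`, which costs measure at most
    -- `d`.
    obtain ⟨x, hx, hmin⟩ := hA.exists_isLeast hne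
    have hA' : IsCompact (A ∩ Ici (x + d)) := hA.inter_right isClosed_Ici
    have hsub : A ⊆ (A ∩ Ici (x + d)) ∪ Ico x (x + d) := by
      intro y hy
      rcases le_or_gt (x + d) y with h | h
      · exact Or.inl ⟨hy, h⟩
      · exact Or.inr ⟨hmin hy, h⟩
    have hv' : ENNReal.ofReal (n * d) < volume (A ∩ Ici (x + d)) := by
      by_contra hcon
      push Not at hcon
      have h1 : volume A ≤ ENNReal.ofReal (n * d) + ENNReal.ofReal d := by
        calc volume A ≤ volume (A ∩ Ici (x + d)) + volume (Ico x (x + d)) :=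
              (measure_mono hsub).trans (measure_union_le _ _)
          _ ≤ _ := by
              rw [Real.volume_Ico]
              gcongr
              linarith
      rw [← ENNReal.ofReal_add (by positivity) hd.le] at h1
      refine absurd (hv.trans_le h1) ?_
      push_cast
      rw [add_mul, one_mul]
      exact lt_irrefl _
    obtain ⟨t, ht⟩ := ih hA' hv'
    refine ⟨fun i => if i = 0 then x else t (i - 1), fun i hi => ?_⟩
    rcases Nat.eq_zero_or_pos i with rfl | hi0
    · refine ⟨by simpa using hx, fun j _ hj => ?_⟩
      rcases Nat.eq_zero_or_pos j with rfl | hj0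
      · simp
      · obtain ⟨j, rfl⟩ : ∃ m, j = m + 1 := ⟨j - 1, by omega⟩
        have h0 := ht 0 (Nat.zero_le _)
        have h1 := h0.2 j (Nat.zero_le _) (by omega)
        have h2 : x + d ≤ t 0 := h0.1.2
        simp only [Nat.add_eq_zero_iff, one_ne_zero, and_false, if_false, if_true,
          Nat.add_sub_cancel]
        push_cast at h1 ⊢
        nlinarith
    · obtain ⟨i, rfl⟩ : ∃ m, i = m + 1 := ⟨i - 1, by omega⟩
      have h0 := ht i (by omega)
      refine ⟨by simpa using h0.1.1, fun j hij hj => ?_⟩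
      obtain ⟨j, rfl⟩ : ∃ m, j = m + 1 := ⟨j - 1, by omega⟩
      have h1 := h0.2 j (by omega) (by omega)
      simp only [Nat.add_eq_zero_iff, one_ne_zero, and_false, if_false, Nat.add_sub_cancel]
      push_cast
      linarith

/-- Up to the factor `d^n`, this is the smallest possible denominator of a Lagrange basis polynomial
at `d`-separated nodes. -/
theorem prod_erase_range_abs_sub (n j : ℕ) (hj : j ≤ n) :
    ∏ i ∈ (Finset.range (n + 1)).erase j, |(j : ℝ) - i| = (j.factorial * (n - j).factorial : ℕ) := by
  have hsplit : (Finset.range (n + 1)).erase j = Finset.range j ∪ Finset.Ico (j + 1) (n + 1) := by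
    ext i
    simp only [Finset.mem_erase, Finset.mem_range, Finset.mem_union, Finset.mem_Ico]
    omega
  have hdisj : Disjoint (Finset.range j) (Finset.Ico (j + 1) (n + 1)) := by
    rw [Finset.disjoint_left]
    intro i
    simp only [Finset.mem_range, Finset.mem_Ico]
    omega
  rw [hsplit, Finset.prod_union hdisj]
  push_cast
  congr 1
  · rw [← Finset.prod_range_add_one_eq_factorial, ← Finset.prod_range_reflect]
    push_cast
    refine Finset.prod_congr rfl fun i hi => ?_
    rw [Finset.mem_range] at hi
    have : ((j - 1 - i : ℕ) : ℝ) = j - 1 - i := by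
      rw [Nat.cast_sub (by omega), Nat.cast_sub (by omega)]
      simp
    rw [this]
    rw [abs_of_nonneg (by ring_nf; positivity)]
    ring
  · rw [← Finset.prod_range_add_one_eq_factorial, Finset.prod_Ico_eq_prod_range]
    push_cast
    refine Finset.prod_congr rfl fun i hi => ?_
    rw [abs_sub_comm, abs_of_nonneg (by ring_nf; positivity)]
    ring

/-- Size of the Lagrange interpolation polynomial at separated real nodes. -/
theorem norm_eval_interpolate_le {n : ℕ} {d D δ : ℝ} (hd : 0 < d) (t : ℕ → ℝ) (y : ℕ → ℂ)
    (hy : ∀ i ≤ n, ‖y i‖ ≤ δ)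
    (ht : ∀ i ≤ n, ∀ j, i ≤ j → j ≤ n → ((j : ℝ) - i) * d ≤ t j - t i)
    {z : ℂ} (hz : ∀ i ≤ n, ‖z - t i‖ ≤ D) :
    ‖(Lagrange.interpolate (Finset.range (n + 1)) (fun i => (t i : ℂ)) y).eval z‖
      ≤ δ * ((2 * D / d) ^ n / n.factorial) := by
  have hD : 0 ≤ D := (norm_nonneg _).trans (hz 0 (Nat.zero_le _))
  have hδ : 0 ≤ δ := (norm_nonneg _).trans (hy 0 (Nat.zero_le _))
  have hsep : ∀ i ≤ n, ∀ j ≤ n, |(j : ℝ) - i| * d ≤ |t j - t i| := by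
    intro i hi j hj
    rcases le_total i j with h | h
    · have h1 := ht i hi j h hj
      rw [abs_of_nonneg (by simpa using h)]
      exact h1.trans (le_abs_self _)
    · have h1 := ht j hj i h hi
      rw [abs_sub_comm, abs_of_nonneg (by simpa using h), abs_sub_comm]
      exact h1.trans (le_abs_self _)
  -- The `n` numerators contribute at most `D^n` and the denominators at least `d^n j!(n-j)!`. The
  -- resulting binomial coefficients sum to `2^n` below.
  have hbasis : ∀ j ∈ Finset.range (n + 1),
      ‖(Lagrange.basis (Finset.range (n + 1)) (fun i => (t i : ℂ)) j).eval z‖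
        ≤ (D / d) ^ n * (n.choose j / n.factorial) := by
    intro j hj
    have hjn : j ≤ n := by simpa [Nat.lt_succ_iff] using hj
    have hprod := prod_erase_range_abs_sub n j hjn
    rw [Lagrange.basis, Polynomial.eval_prod, norm_prod]
    have hle : ∀ i ∈ (Finset.range (n + 1)).erase j,
        ‖(Lagrange.basisDivisor (t j : ℂ) (t i : ℂ)).eval z‖ ≤ (D / d) * |(j : ℝ) - i|⁻¹ := by
      intro i hi
      rw [Finset.mem_erase, Finset.mem_range] at hi
      have hpos : 0 < |(j : ℝ) - i| := by
        rw [abs_pos, sub_ne_zero]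
        exact_mod_cast hi.1.symm
      simp only [Lagrange.basisDivisor, Polynomial.eval_mul, Polynomial.eval_C,
        Polynomial.eval_sub, Polynomial.eval_X, norm_mul, norm_inv]
      rw [← Complex.ofReal_sub, Complex.norm_real, Real.norm_eq_abs]
      calc |t j - t i|⁻¹ * ‖z - t i‖ ≤ (|(j : ℝ) - i| * d)⁻¹ * D := by
            gcongr
            · exact hsep i (by omega) j hjn
            · exact hz i (by omega)
        _ = _ := by rw [mul_inv]; ring
    refine (Finset.prod_le_prod (fun _ _ => norm_nonneg _) hle).trans (le_of_eq ?_)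
    rw [Finset.prod_mul_distrib, Finset.prod_const, Finset.card_erase_of_mem hj,
      Finset.card_range, Nat.add_sub_cancel, Finset.prod_inv_distrib, hprod,
      Nat.choose_eq_factorial_div_factorial hjn, Nat.cast_div
        (Nat.factorial_mul_factorial_dvd_factorial hjn) (by positivity)]
    have : (n.factorial : ℝ) ≠ 0 := by positivity
    field_simp
  rw [Lagrange.interpolate_apply, Polynomial.eval_finsetSum]
  calc ‖∑ j ∈ Finset.range (n + 1), Polynomial.eval z (Polynomial.C (y j) *
          Lagrange.basis (Finset.range (n + 1)) (fun i => (t i : ℂ)) j)‖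
      ≤ ∑ j ∈ Finset.range (n + 1), δ * ((D / d) ^ n * (n.choose j / n.factorial)) := by
        refine (norm_sum_le _ _).trans (Finset.sum_le_sum fun j hj => ?_)
        rw [Polynomial.eval_mul, Polynomial.eval_C, norm_mul]
        gcongr
        · exact hy j (by simpa [Nat.lt_succ_iff] using hj)
        · exact hbasis j hj
    _ = δ * ((2 * D / d) ^ n / n.factorial) := by
        rw [← Finset.mul_sum, ← Finset.mul_sum, ← Finset.sum_div, ← Nat.cast_sum,
          Nat.sum_range_choose]
        push_cast
        rw [mul_div_assoc, mul_pow]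
        ring

/-- Two-constants estimate: smallness on a real set of positive relative measure propagates to a
complex neighbourhood, up to a loss in the exponent. -/
theorem norm_le_rpow_of_small_on_set {f : ℂ → ℂ} {c ρ C δ : ℝ} (hρ : 0 < ρ) (hδ : 0 < δ)
    (hδ1 : δ ≤ 1) (hd : DifferentiableOn ℂ f (Metric.ball (c : ℂ) (21297 * ρ)))
    (hC : ∀ z ∈ Metric.ball (c : ℂ) (21297 * ρ), ‖f z‖ ≤ C)
    {A : Set ℝ} (hA : IsCompact A) (hAsub : A ⊆ Icc (c - ρ) (c + ρ))
    (hvol : ENNReal.ofReal ρ ≤ volume A) (hfA : ∀ x ∈ A, ‖f x‖ ≤ δ)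
    {z : ℂ} (hz : ‖z - c‖ ≤ ρ) : ‖f z‖ ≤ (6 + C) * δ ^ (3 / 4 : ℝ) := by
  have hC0 : 0 ≤ C := (norm_nonneg _).trans (hC c (by simp [hρ]))
  -- The degree balances two errors: `22^n ≤ δ^{-1/4}` bounds the growth of the interpolant, and
  -- `22^{-3(n+1)} ≤ δ^{3/4}` the gain from the `n + 1` zeros of `f - P`. Here `10648 = 22³`, and
  -- `21297 = 2 · 10648 + 1` makes each zero contribute a factor `2ρ/(21296ρ)`.
  set n : ℕ := ⌊Real.log (1 / δ) / (4 * Real.log 22)⌋₊ with hn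
  have hlog22 : 0 < Real.log 22 := Real.log_pos (by norm_num)
  have hlogδ : 0 ≤ Real.log (1 / δ) := Real.log_nonneg (by rw [le_div_iff₀ hδ]; linarith)
  have hn1 : (n : ℝ) * (4 * Real.log 22) ≤ Real.log (1 / δ) := by
    rw [← le_div_iff₀ (by positivity)]
    exact Nat.floor_le (by positivity)
  have hn2 : Real.log (1 / δ) ≤ ((n : ℝ) + 1) * (4 * Real.log 22) := by
    rw [← div_le_iff₀ (by positivity)]
    exact (Nat.lt_floor_add_one _).le
  have hlogδ' : Real.log (1 / δ) = - Real.log δ := by rw [one_div, Real.log_inv]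
  rw [hlogδ'] at hn1 hn2
  have hpow1 : δ * 22 ^ n ≤ δ ^ (3 / 4 : ℝ) := by
    rw [← Real.log_le_log_iff (by positivity) (by positivity), Real.log_mul (by positivity)
      (by positivity), Real.log_pow, Real.log_rpow hδ]
    linarith
  have hpow2 : ((1 : ℝ) / 10648) ^ (n + 1) ≤ δ ^ (3 / 4 : ℝ) := by
    rw [← Real.log_le_log_iff (by positivity) (by positivity), Real.log_pow, Real.log_rpow hδ,
      show (1 : ℝ) / 10648 = (22 ^ 3)⁻¹ by norm_num, Real.log_inv, Real.log_pow]
    push_cast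
    linarith
  -- Then `n d < ρ ≤ volume A`, so `A` contains `n + 1` nodes at mutual distance at least `d`.
  set d : ℝ := ρ / (n + 1) with hdd
  have hdpos : 0 < d := by positivity
  have hvol' : ENNReal.ofReal (n * d) < volume A := by
    refine lt_of_lt_of_le ?_ hvol
    rw [ENNReal.ofReal_lt_ofReal_iff hρ, hdd, mul_div_assoc', div_lt_iff₀ (by positivity)]
    nlinarith
  obtain ⟨t, ht⟩ := exists_separated_points hdpos n hA hvol'
  have htc : ∀ i ≤ n, ‖(t i : ℂ) - c‖ ≤ ρ := by
    intro i hi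
    have := hAsub (ht i hi).1
    rw [← Complex.ofReal_sub, Complex.norm_real, Real.norm_eq_abs, abs_le]
    constructor <;> linarith [this.1, this.2]
  set P : ℂ → ℂ := fun w =>
    (Lagrange.interpolate (Finset.range (n + 1)) (fun i => (t i : ℂ)) (fun i => f (t i))).eval w
    with hP
  -- The term of index `n` in the series of `e^{n+1}` bounds the left side, and `e ≤ 3`.
  have hfac : ((n : ℝ) + 1) ^ n / n.factorial ≤ 3 * (Real.exp 1) ^ n := by
    refine (Real.pow_div_factorial_le_exp ((n : ℝ) + 1) (by positivity) n).trans ?_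
    rw [Real.exp_add, mul_comm, ← Real.exp_nat_mul, mul_one]
    gcongr
    linarith [Real.exp_one_lt_d9]
  have hPle : ∀ {R : ℝ} {w : ℂ}, 0 < R → ‖w - c‖ ≤ R * ρ →
      ‖P w‖ ≤ 3 * δ * (2 * Real.exp 1 * (R + 1)) ^ n := by
    intro R w hR hw
    have h1 := norm_eval_interpolate_le (n := n) (d := d) (D := (R + 1) * ρ) (δ := δ) hdpos t
      (fun i => f (t i)) (fun i hi => hfA _ (ht i hi).1) (fun i hi => (ht i hi).2) (z := w)
      (fun i hi => by
        calc ‖w - t i‖ = ‖(w - c) - (t i - c)‖ := by ring_nf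
          _ ≤ ‖w - c‖ + ‖(t i : ℂ) - c‖ := norm_sub_le _ _
          _ ≤ (R + 1) * ρ := by linarith [htc i hi])
    refine h1.trans ?_
    have h2 : 2 * ((R + 1) * ρ) / d = 2 * (R + 1) * (n + 1) := by
      rw [hdd]; field_simp
    rw [h2, mul_pow, mul_div_assoc]
    calc δ * ((2 * (R + 1)) ^ n * (((n : ℝ) + 1) ^ n / n.factorial))
        ≤ δ * ((2 * (R + 1)) ^ n * (3 * (Real.exp 1) ^ n)) := by gcongr
      _ = _ := by rw [mul_right_comm 2 (Real.exp 1), mul_pow (2 * (R + 1))]; ring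
  have hinj : Set.InjOn (fun i => (t i : ℂ)) (Finset.range (n + 1) : Set ℕ) := by
    have aux : ∀ i ≤ n, ∀ j ≤ n, i < j → t i ≠ t j := by
      intro i hi j hj hij h
      have h1 := (ht i hi).2 j hij.le hj
      rw [h, sub_self] at h1
      have h2 : (0 : ℝ) < (j : ℝ) - i := by
        have : (i : ℝ) < j := by exact_mod_cast hij
        linarith
      nlinarith
    intro i hi j hj hij
    simp only [Finset.coe_range, Set.mem_Iio, Complex.ofReal_inj] at hi hj hij
    rcases lt_trichotomy i j with h | h | h
    · exact absurd hij (aux i (by omega) j (by omega) h)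
    · exact h
    · exact absurd hij.symm (aux j (by omega) i (by omega) h)
  have hexp := Real.exp_one_lt_d9
  set M : ℝ := C + 3 * δ * (2 * Real.exp 1 * (21297 + 1)) ^ n with hM
  have hz' : z ∈ Metric.ball (c : ℂ) (21297 * ρ) := by
    rw [mem_ball_iff_norm]; linarith
  -- The function `f - P` is bounded on the large disc and vanishes at all nodes, so the
  -- several-zeros Schwarz lemma applies.
  have hdiff := norm_le_prod_of_zeros (Finset.range (n + 1)) (c := (c : ℂ)) (r := 21297 * ρ)
    (ρ := ρ) (by linarith) (fun i => (t i : ℂ))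
    (fun i hi => htc i (by simpa [Nat.lt_succ_iff] using hi)) hinj (h := fun w => f w - P w)
    (M := M) (hd.sub (Polynomial.differentiable _).differentiableOn)
    (fun w hw => (norm_sub_le _ _).trans (add_le_add (hC w hw)
      (hPle (by norm_num) (mem_ball_iff_norm.1 hw).le)))
    (fun i hi => by
      rw [sub_eq_zero]
      exact (Lagrange.eval_interpolate_at_node (r := fun i => f (t i)) hinj hi).symm) z hz'
  have hprod : ∏ i ∈ Finset.range (n + 1), (‖z - t i‖ / (21297 * ρ - ρ))
      ≤ ((1 : ℝ) / 10648) ^ (n + 1) := by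
    refine (Finset.prod_le_prod (g := fun _ => (1 : ℝ) / 10648) (fun i _ => div_nonneg
      (norm_nonneg _) (by linarith)) fun i hi => ?_).trans
      (le_of_eq (by simp))
    have hi' : i ≤ n := by simpa [Nat.lt_succ_iff] using hi
    rw [div_le_div_iff₀ (by linarith) (by norm_num)]
    have : ‖z - t i‖ ≤ 2 * ρ := by
      calc ‖z - t i‖ = ‖(z - c) - (t i - c)‖ := by ring_nf
        _ ≤ ‖z - c‖ + ‖(t i : ℂ) - c‖ := norm_sub_le _ _
        _ ≤ 2 * ρ := by linarith [htc i hi']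
    linarith
  have hM0 : 0 ≤ M := by positivity
  have hδ34 : 0 ≤ δ ^ (3 / 4 : ℝ) := by positivity
  have hfP : ‖f z - P z‖ ≤ C * δ ^ (3 / 4 : ℝ) + 3 * δ ^ (3 / 4 : ℝ) := by
    refine hdiff.trans ?_
    calc M * ∏ i ∈ Finset.range (n + 1), (‖z - t i‖ / (21297 * ρ - ρ))
        ≤ M * ((1 : ℝ) / 10648) ^ (n + 1) := by gcongr
      -- On the large disc `P` grows like `(2e · 21298)^n`. The zeros bring the base down to about
      -- `4e`, which is below `22`.
      _ = C * ((1 : ℝ) / 10648) ^ (n + 1) + 3 * δ * ((2 * Real.exp 1 * (21297 + 1) / 10648) ^ n)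
          * (1 / 10648) := by
          rw [hM, div_pow, div_pow, one_pow]
          field_simp
          ring
      _ ≤ C * δ ^ (3 / 4 : ℝ) + 3 * δ * 22 ^ n * 1 := by
          gcongr
          · rw [div_le_iff₀ (by norm_num)]
            nlinarith
          · norm_num
      _ ≤ _ := by nlinarith
  have hPz : ‖P z‖ ≤ 3 * δ ^ (3 / 4 : ℝ) := by
    refine (hPle (R := 1) one_pos (by linarith)).trans ?_
    calc 3 * δ * (2 * Real.exp 1 * (1 + 1)) ^ n ≤ 3 * δ * 22 ^ n := by
          gcongr
          linarith
      _ ≤ _ := by nlinarith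
  calc ‖f z‖ = ‖(f z - P z) + P z‖ := by ring_nf
    _ ≤ ‖f z - P z‖ + ‖P z‖ := norm_add_le _ _
    _ ≤ _ := by linarith

/-! ### Holomorphic limits from pointwise expansions at real points. -/

/-- Identity theorem on a disc, from agreement at the real points near the centre. -/
theorem eqOn_ball_of_eq_real {f g : ℂ → ℂ} {u ρ : ℝ} (hρ : 0 < ρ)
    (hf : DifferentiableOn ℂ f (Metric.ball (u : ℂ) ρ))
    (hg : DifferentiableOn ℂ g (Metric.ball (u : ℂ) ρ))
    (h : ∀ᶠ x : ℝ in 𝓝 u, f x = g x) : EqOn f g (Metric.ball (u : ℂ) ρ) := by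
  refine (hf.analyticOnNhd Metric.isOpen_ball).eqOn_of_preconnected_of_frequently_eq
    (hg.analyticOnNhd Metric.isOpen_ball) (convex_ball _ _).isPreconnected
    (Metric.mem_ball_self hρ) ?_
  have ht : Tendsto (fun x : ℝ => (x : ℂ)) (𝓝[≠] u) (𝓝[≠] (u : ℂ)) := by
    refine tendsto_nhdsWithin_iff.2 ⟨?_, ?_⟩
    · exact (Complex.continuous_ofReal.tendsto u).mono_left nhdsWithin_le_nhds
    · filter_upwards [self_mem_nhdsWithin] with x hx
      simpa using hx
  exact ht.frequently (h.filter_mono nhdsWithin_le_nhds).frequently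

/-- A function on `(0, ε₂)` which decreases under halving is bounded by its values on a dyadic
block. -/
theorem le_of_halving_le {Φ : ℝ → ℝ} {ε₂ B : ℝ} (hε₂ : 0 < ε₂)
    (hstep : ∀ ε ∈ Ioo 0 ε₂, Φ (ε / 2) ≤ Φ ε)
    (hB : ∀ ε ∈ Ioo 0 ε₂, ε₂ / 4 ≤ ε → Φ ε ≤ B) : ∀ ε ∈ Ioo 0 (ε₂ / 2), Φ ε ≤ B := by
  intro ε hε
  have hiter : ∀ n : ℕ, 2 ^ n * ε < ε₂ → Φ ε ≤ Φ (2 ^ n * ε) := by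
    intro n
    induction n with
    | zero => simp
    | succ n ih =>
      intro hn
      have h1 : 2 ^ n * ε < ε₂ := by
        refine lt_of_le_of_lt ?_ hn
        have := hε.1
        rw [pow_succ]
        nlinarith [pow_pos (two_pos (α := ℝ)) n, mul_pos (pow_pos (two_pos (α := ℝ)) n) hε.1]
      have h2 := hstep (2 ^ (n + 1) * ε) ⟨mul_pos (by positivity) hε.1, hn⟩
      rw [show (2 : ℝ) ^ (n + 1) * ε / 2 = 2 ^ n * ε by ring] at h2
      exact (ih h1).trans h2
  -- Doubling `ε` brings it into the block `(ε₂/4, ε₂/2]`, where `hB` applies.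
  obtain ⟨n, hn1, hn2⟩ := exists_nat_pow_near (x := ε₂ / 2 / ε) (y := (2 : ℝ))
    (by rw [le_div_iff₀ hε.1]; linarith [hε.2]) (by norm_num)
  rw [le_div_iff₀ hε.1] at hn1
  rw [div_lt_iff₀ hε.1, pow_succ] at hn2
  refine (hiter n (by linarith)).trans (hB _ ⟨mul_pos (by positivity) hε.1, by linarith⟩ ?_)
  linarith

/-- A uniformly bounded holomorphic family with a pointwise second order expansion on the reals
satisfies a Richardson-type estimate `O(ε^{3/2})` uniformly in a complex neighbourhood. -/
theorem exists_richardson_bound {g : ℝ → ℂ → ℂ} {u r C ε₁ : ℝ} (hr : 0 < r) (hε₁ : 0 < ε₁)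
    (hd : ∀ ε ∈ Ioo 0 ε₁, DifferentiableOn ℂ (g ε) (Metric.ball (u : ℂ) r))
    (hC : ∀ ε ∈ Ioo 0 ε₁, ∀ z ∈ Metric.ball (u : ℂ) r, ‖g ε z‖ ≤ C) {c₀ c₁ : ℝ → ℂ}
    (hexp : ∀ x : ℝ, |x - u| < r →
      (fun ε : ℝ => g ε x - (c₀ x + c₁ x * ε)) =O[𝓝[>] 0] fun ε : ℝ => ε ^ 2) :
    ∃ ρ K ε₂ : ℝ, 0 < ρ ∧ ρ ≤ r ∧ 0 ≤ K ∧ 0 < ε₂ ∧ ε₂ ≤ ε₁ ∧ ∀ ε ∈ Ioo 0 ε₂,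
      ∀ z ∈ Metric.ball (u : ℂ) ρ,
        ‖g ε z - 3 * g (ε / 2) z + 2 * g (ε / 4) z‖ ≤ K * (ε * Real.sqrt ε) := by
  set ρ : ℝ := r / 21297 with hρdef
  have hρ : 0 < ρ := by positivity
  have hρr : 21297 * ρ = r := by rw [hρdef]; field_simp
  have hC0 : 0 ≤ C := (norm_nonneg _).trans
    (hC (ε₁ / 2) ⟨by linarith, by linarith⟩ u (Metric.mem_ball_self hr))
  -- The weights satisfy `1 - 3 + 2 = 0` and `1 - 3/2 + 2/4 = 0`, so `E` does not see `c₀` and `c₁`,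
  -- about whose regularity nothing is known.
  set E : ℝ → ℂ → ℂ := fun ε z => g ε z - 3 * g (ε / 2) z + 2 * g (ε / 4) z with hE
  have hhalf : ∀ ε ∈ Ioo 0 ε₁, ε / 2 ∈ Ioo 0 ε₁ ∧ ε / 4 ∈ Ioo 0 ε₁ := fun ε hε =>
    ⟨⟨by linarith [hε.1], by linarith [hε.1, hε.2]⟩, ⟨by linarith [hε.1], by linarith [hε.1, hε.2]⟩⟩
  have hEd : ∀ ε ∈ Ioo 0 ε₁, DifferentiableOn ℂ (E ε) (Metric.ball (u : ℂ) r) := by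
    intro ε hε
    have h1 := hd ε hε
    have h2 := hd _ (hhalf ε hε).1
    have h3 := hd _ (hhalf ε hε).2
    exact (h1.sub (h2.const_mul 3)).add (h3.const_mul 2)
  have hEC : ∀ ε ∈ Ioo 0 ε₁, ∀ z ∈ Metric.ball (u : ℂ) r, ‖E ε z‖ ≤ 6 * C := by
    intro ε hε z hz
    have h1 := hC ε hε z hz
    have h2 := hC _ (hhalf ε hε).1 z hz
    have h3 := hC _ (hhalf ε hε).2 z hz
    calc ‖E ε z‖ ≤ ‖g ε z - 3 * g (ε / 2) z‖ + ‖2 * g (ε / 4) z‖ := norm_add_le _ _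
      _ ≤ ‖g ε z‖ + ‖3 * g (ε / 2) z‖ + ‖2 * g (ε / 4) z‖ := by gcongr; exact norm_sub_le _ _
      _ = ‖g ε z‖ + 3 * ‖g (ε / 2) z‖ + 2 * ‖g (ε / 4) z‖ := by simp
      _ ≤ _ := by linarith
  have hEx : ∀ x : ℝ, |x - u| < r →
      (fun ε : ℝ => E ε x) =O[𝓝[>] 0] fun ε : ℝ => ε ^ 2 := by
    intro x hx
    have h0 := hexp x hx
    have hcomp : ∀ a : ℝ, 0 < a →
        (fun ε : ℝ => g (ε / a) x - (c₀ x + c₁ x * (ε / a : ℝ))) =O[𝓝[>] 0]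
          fun ε : ℝ => ε ^ 2 := by
      intro a ha
      have ht : Tendsto (fun ε : ℝ => ε / a) (𝓝[>] 0) (𝓝[>] 0) := by
        refine tendsto_nhdsWithin_iff.2 ⟨?_, ?_⟩
        · have : Tendsto (fun ε : ℝ => ε / a) (𝓝 0) (𝓝 (0 / a)) :=
            (continuous_id.div_const a).tendsto 0
          rw [zero_div] at this
          exact this.mono_left nhdsWithin_le_nhds
        · filter_upwards [self_mem_nhdsWithin] with ε hε
          exact div_pos hε ha
      refine (h0.comp_tendsto ht).trans ?_
      refine IsBigO.of_bound ((a⁻¹) ^ 2) (Eventually.of_forall fun ε => ?_)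
      simp only [Function.comp, norm_pow, div_eq_mul_inv, mul_pow, norm_mul, norm_inv,
        Real.norm_eq_abs, abs_of_pos ha]
      rw [mul_comm]
    have h2 := (hcomp 2 (by norm_num)).const_mul_left (3 : ℂ)
    have h4 := (hcomp 4 (by norm_num)).const_mul_left (2 : ℂ)
    refine ((h0.sub h2).add h4).congr_left fun ε => ?_
    simp only [hE]
    push_cast
    ring
  -- The points where the `O(ε²)` bound holds with constant `N + 1` for all `ε < 1/(N + 1)`. These
  -- closed sets increase to the whole interval, of length `2ρ`, so one of them has measure at least
  -- `ρ`.
  set A : ℕ → Set ℝ := fun N => {x | x ∈ Icc (u - ρ) (u + ρ) ∧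
    ∀ ε ∈ Ioo 0 ε₁, ε < 1 / ((N : ℝ) + 1) → ‖E ε x‖ ≤ ((N : ℝ) + 1) * ε ^ 2} with hA
  have hIcc : ∀ x ∈ Icc (u - ρ) (u + ρ), |x - u| < r := by
    intro x hx
    rw [abs_lt]
    constructor <;> linarith [hx.1, hx.2]
  have hball : ∀ x ∈ Icc (u - ρ) (u + ρ), (x : ℂ) ∈ Metric.ball (u : ℂ) r := by
    intro x hx
    rw [mem_ball_iff_norm, ← Complex.ofReal_sub, Complex.norm_real, Real.norm_eq_abs]
    exact hIcc x hx
  have hAcl : ∀ N, IsClosed (A N) := by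
    intro N
    have : A N = Icc (u - ρ) (u + ρ) ∩ ⋂ ε ∈ {ε | ε ∈ Ioo 0 ε₁ ∧ ε < 1 / ((N : ℝ) + 1)},
        {x | x ∈ Icc (u - ρ) (u + ρ) ∧ ‖E ε x‖ ≤ ((N : ℝ) + 1) * ε ^ 2} := by
      ext x
      simp only [hA, mem_ofPred_eq, mem_inter_iff, mem_iInter]
      exact ⟨fun h => ⟨h.1, fun ε hε => ⟨h.1, h.2 ε hε.1 hε.2⟩⟩,
        fun h => ⟨h.1, fun ε h1 h2 => (h.2 ε ⟨h1, h2⟩).2⟩⟩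
    rw [this]
    refine isClosed_Icc.inter (isClosed_biInter fun ε hε => ?_)
    refine isClosed_Icc.isClosed_le ?_ continuousOn_const
    refine ContinuousOn.norm ?_
    exact (hEd ε hε.1).continuousOn.comp Complex.continuous_ofReal.continuousOn hball
  have hAmono : Monotone A := by
    intro N N' h x hx
    have hc : (N : ℝ) ≤ N' := by exact_mod_cast h
    refine ⟨hx.1, fun ε hε h2 => ?_⟩
    refine (hx.2 ε hε (h2.trans_le (by gcongr))).trans (by gcongr)
  have hAun : ⋃ N, A N = Icc (u - ρ) (u + ρ) := by
    apply Subset.antisymm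
    · exact iUnion_subset fun N x hx => hx.1
    · intro x hx
      obtain ⟨c, hc⟩ := (hEx x (hIcc x hx)).bound
      rw [eventually_nhdsWithin_iff, Metric.eventually_nhds_iff] at hc
      obtain ⟨η, hη, hb⟩ := hc
      obtain ⟨N, hN⟩ := exists_nat_ge (max c (1 / η))
      refine mem_iUnion.2 ⟨N, hx, fun ε hε hεN => ?_⟩
      have h1 : 1 / ((N : ℝ) + 1) ≤ η := by
        rw [div_le_comm₀ (by positivity) hη]
        linarith [le_max_right c (1 / η)]
      have h2 := hb (y := ε) (by
        rw [Real.dist_eq, sub_zero, abs_of_pos hε.1]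
        linarith) hε.1
      refine h2.trans ?_
      rw [norm_pow, Real.norm_eq_abs, abs_of_pos hε.1]
      gcongr
      linarith [le_max_left c (1 / η)]
  have hvol : ∃ N, ENNReal.ofReal ρ ≤ volume (A N) := by
    have ht := tendsto_measure_iUnion_atTop (μ := volume) hAmono
    rw [hAun, Real.volume_Icc] at ht
    have hlt : ENNReal.ofReal ρ < ENNReal.ofReal (u + ρ - (u - ρ)) := by
      rw [ENNReal.ofReal_lt_ofReal_iff (by linarith)]
      linarith
    obtain ⟨N, hN⟩ := (ht.eventually (lt_mem_nhds hlt)).exists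
    exact ⟨N, hN.le⟩
  obtain ⟨N, hN⟩ := hvol
  refine ⟨ρ, (6 + 6 * C) * ((N : ℝ) + 1) ^ (3 / 4 : ℝ), min ε₁ (1 / ((N : ℝ) + 1)), hρ,
    by linarith, by positivity, lt_min hε₁ (by positivity), min_le_left _ _, fun ε hε z hz => ?_⟩
  have hε1 : ε ∈ Ioo 0 ε₁ := ⟨hε.1, hε.2.trans_le (min_le_left _ _)⟩
  have hεN : ε < 1 / ((N : ℝ) + 1) := hε.2.trans_le (min_le_right _ _)
  have hεN' : ε * ((N : ℝ) + 1) < 1 := by rwa [lt_div_iff₀ (by positivity)] at hεN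
  have hεlt1 : ε ≤ 1 := by nlinarith [hε.1, Nat.cast_nonneg (α := ℝ) N]
  have hpos := hε.1
  have hz' : ‖z - u‖ ≤ ρ := (mem_ball_iff_norm.1 hz).le
  -- With `δ = (N + 1)ε²`, the power `δ^{3/4}` is a constant times `ε^{3/2}`.
  have key := norm_le_rpow_of_small_on_set (f := E ε) (c := u) (ρ := ρ) (C := 6 * C)
    (δ := ((N : ℝ) + 1) * ε ^ 2) hρ (by positivity) (by nlinarith)
    (by rw [hρr]; exact hEd ε hε1) (by rw [hρr]; exact hEC ε hε1) (A := A N)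
    (isCompact_Icc.of_isClosed_subset (hAcl N) fun x hx => hx.1) (fun x hx => hx.1) hN
    (fun x hx => hx.2 ε hε1 hεN) hz'
  refine key.trans (le_of_eq ?_)
  have hsqrt : ε * Real.sqrt ε = ε ^ (3 / 2 : ℝ) := by
    rw [Real.sqrt_eq_rpow, ← Real.rpow_one_add' hε.1.le (by norm_num)]
    norm_num
  rw [hsqrt, Real.mul_rpow (by positivity) (by positivity), ← Real.rpow_natCast,
    ← Real.rpow_mul hε.1.le]
  norm_num
  ring

/-- A uniformly bounded holomorphic family with a pointwise second order expansion on the reals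
converges at rate `O(ε)`, uniformly in a complex neighbourhood. -/
theorem exists_holomorphic_limit {g : ℝ → ℂ → ℂ} {u r C ε₁ : ℝ} (hr : 0 < r) (hε₁ : 0 < ε₁)
    (hd : ∀ ε ∈ Ioo 0 ε₁, DifferentiableOn ℂ (g ε) (Metric.ball (u : ℂ) r))
    (hC : ∀ ε ∈ Ioo 0 ε₁, ∀ z ∈ Metric.ball (u : ℂ) r, ‖g ε z‖ ≤ C) {c₀ c₁ : ℝ → ℂ}
    (hexp : ∀ x : ℝ, |x - u| < r →
      (fun ε : ℝ => g ε x - (c₀ x + c₁ x * ε)) =O[𝓝[>] 0] fun ε : ℝ => ε ^ 2) :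
    ∃ (G : ℂ → ℂ) (ρ K ε₂ : ℝ), 0 < ρ ∧ ρ ≤ r ∧ 0 < ε₂ ∧ ε₂ ≤ ε₁ ∧
      DifferentiableOn ℂ G (Metric.ball (u : ℂ) ρ) ∧ (∀ x : ℝ, |x - u| < ρ → G x = c₀ x) ∧
      ∀ ε ∈ Ioo 0 ε₂, ∀ z ∈ Metric.ball (u : ℂ) ρ, ‖g ε z - G z‖ ≤ K * ε := by
  obtain ⟨ρ, K, ε₂, hρ, hρr, hK, hε₂, hε₂₁, hE⟩ := exists_richardson_bound hr hε₁ hd hC hexp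
  have hsub : Metric.ball (u : ℂ) ρ ⊆ Metric.ball (u : ℂ) r := Metric.ball_subset_ball hρr
  obtain ⟨K₂, hK₂0, hT⟩ : ∃ K₂ : ℝ, 0 ≤ K₂ ∧ ∀ ε ∈ Ioo 0 (ε₂ / 2),
      ∀ z ∈ Metric.ball (u : ℂ) ρ, ‖g ε z - g (ε / 2) z‖ ≤ K₂ * ε := by
    have hC0 : 0 ≤ C := (norm_nonneg _).trans
      (hC (ε₁ / 2) ⟨by linarith, by linarith⟩ u (Metric.mem_ball_self hr))
    refine ⟨2 * C / (ε₂ / 4) + 4 * K * Real.sqrt ε₂, by positivity, fun ε hε z hz => ?_⟩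
    -- With `T(ε) = g_ε - g_{ε/2}`, the combination bounded above is `T(ε) - 2T(ε/2)`, so halving
    -- raises `|T(ε)|/ε` by at most `K√ε`. The term `4K√ε` absorbs this, because `√(ε/2) ≤ (3/4)√ε`.
    have h := le_of_halving_le (B := 2 * C / (ε₂ / 4) + 4 * K * Real.sqrt ε₂)
      (Φ := fun ε => ‖g ε z - g (ε / 2) z‖ / ε + 4 * K * Real.sqrt ε) hε₂
      (fun ε hε => by
        have h1 := hE ε hε z hz
        have hpos := hε.1
        have h2 : 2 * ‖g (ε / 2) z - g (ε / 4) z‖ ≤ ‖g ε z - g (ε / 2) z‖ +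
            K * (ε * Real.sqrt ε) := by
          calc 2 * ‖g (ε / 2) z - g (ε / 4) z‖ = ‖2 * (g (ε / 2) z - g (ε / 4) z)‖ := by simp
            _ = ‖(g ε z - g (ε / 2) z) - (g ε z - 3 * g (ε / 2) z + 2 * g (ε / 4) z)‖ := by
              ring_nf
            _ ≤ _ := (norm_sub_le _ _).trans (by gcongr)
        have h3 : Real.sqrt (ε / 2) ≤ 3 / 4 * Real.sqrt ε := by
          rw [Real.sqrt_le_left (by positivity), mul_pow, Real.sq_sqrt hpos.le]
          linarith
        rw [show ε / 2 / 2 = ε / 4 by ring]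
        have h4 : ‖g (ε / 2) z - g (ε / 4) z‖ / (ε / 2) ≤
            ‖g ε z - g (ε / 2) z‖ / ε + K * Real.sqrt ε := by
          rw [div_le_iff₀ (by positivity)]
          have : (‖g ε z - g (ε / 2) z‖ / ε + K * Real.sqrt ε) * (ε / 2) =
              (‖g ε z - g (ε / 2) z‖ + K * (ε * Real.sqrt ε)) / 2 := by
            field_simp
          rw [this]
          linarith
        nlinarith [Real.sqrt_nonneg ε])
      (fun ε hε hle => by
        have hpos := hε.1
        have h1 := hC ε ⟨hε.1, hε.2.trans_le hε₂₁⟩ z (hsub hz)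
        have h2 := hC (ε / 2) ⟨by linarith [hε.1], by linarith [hε.1, hε.2]⟩ z (hsub hz)
        have h3 : ‖g ε z - g (ε / 2) z‖ ≤ 2 * C := (norm_sub_le _ _).trans (by linarith)
        have h4 := hε.2.le
        gcongr) ε hε
    have hpos := hε.1
    have h5 : ‖g ε z - g (ε / 2) z‖ / ε ≤ 2 * C / (ε₂ / 4) + 4 * K * Real.sqrt ε₂ :=
      le_trans (le_add_of_nonneg_right (by positivity)) h
    rwa [div_le_iff₀ hpos] at h5
  have hgeom : ∀ ε ∈ Ioo 0 (ε₂ / 2), ∀ z ∈ Metric.ball (u : ℂ) ρ, ∀ n : ℕ,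
      dist (g (ε / 2 ^ n) z) (g (ε / 2 ^ (n + 1)) z) ≤ 2 * (K₂ * ε) / 2 / 2 ^ n := by
    intro ε hε z hz n
    have hpos := hε.1
    have h2n : (1 : ℝ) ≤ 2 ^ n := one_le_pow₀ (by norm_num)
    have hmem : ε / 2 ^ n ∈ Ioo 0 (ε₂ / 2) :=
      ⟨by positivity, (div_le_self hpos.le h2n).trans_lt hε.2⟩
    rw [dist_eq_norm, pow_succ, ← div_div]
    refine (hT _ hmem z hz).trans (le_of_eq ?_)
    ring
  -- The limit is taken along `ε/2^n`, so at this point it may still depend on the starting value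
  -- `ε`.
  have hlim : ∀ ε ∈ Ioo 0 (ε₂ / 2), ∃ G : ℂ → ℂ,
      DifferentiableOn ℂ G (Metric.ball (u : ℂ) ρ) ∧ (∀ x : ℝ, |x - u| < ρ → G x = c₀ x) ∧
      ∀ z ∈ Metric.ball (u : ℂ) ρ, ‖g ε z - G z‖ ≤ 2 * K₂ * ε := by
    intro ε hε
    have hpos := hε.1
    have hex : ∀ z ∈ Metric.ball (u : ℂ) ρ, ∃ a,
        Tendsto (fun n : ℕ => g (ε / 2 ^ n) z) atTop (𝓝 a) := fun z hz =>
      cauchySeq_tendsto_of_complete (cauchySeq_of_le_geometric_two (hgeom ε hε z hz))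
    choose! G hG using hex
    refine ⟨G, ?_, ?_, ?_⟩
    · have hu : TendstoUniformlyOn (fun (n : ℕ) z => g (ε / 2 ^ n) z) G atTop
          (Metric.ball (u : ℂ) ρ) := by
        rw [Metric.tendstoUniformlyOn_iff]
        intro η hη
        have ht : Tendsto (fun n : ℕ => 2 * (K₂ * ε) / 2 ^ n) atTop (𝓝 0) := by
          have := (tendsto_pow_atTop_nhds_zero_of_lt_one (r := (1 / 2 : ℝ)) (by norm_num)
            (by norm_num)).const_mul (2 * (K₂ * ε))
          rw [mul_zero] at this
          refine this.congr fun n => ?_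
          rw [one_div, inv_pow]
          rfl
        filter_upwards [ht.eventually (gt_mem_nhds hη)] with n hn z hz
        rw [dist_comm]
        exact (dist_le_of_le_geometric_two_of_tendsto (hgeom ε hε z hz) (hG z hz) n).trans_lt hn
      refine hu.tendstoLocallyUniformlyOn.differentiableOn (Eventually.of_forall fun n => ?_)
        Metric.isOpen_ball
      refine (hd _ ⟨by positivity, ?_⟩).mono hsub
      have h2n : (1 : ℝ) ≤ 2 ^ n := one_le_pow₀ (by norm_num)
      exact (div_le_self hpos.le h2n).trans_lt (by linarith [hε.2])
    · intro x hx
      have hxb : (x : ℂ) ∈ Metric.ball (u : ℂ) ρ := by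
        rwa [mem_ball_iff_norm, ← Complex.ofReal_sub, Complex.norm_real, Real.norm_eq_abs]
      refine tendsto_nhds_unique (hG x hxb) ?_
      have h0 : Tendsto (fun ε : ℝ => g ε x) (𝓝[>] 0) (𝓝 (c₀ x)) := by
        have hz : Tendsto (fun ε : ℝ => g ε x - (c₀ x + c₁ x * ε)) (𝓝[>] 0) (𝓝 0) := by
          refine (hexp x (hx.trans_le hρr)).trans_tendsto ?_
          have : Tendsto (fun ε : ℝ => ε ^ 2) (𝓝 0) (𝓝 (0 ^ 2)) := (continuous_pow 2).tendsto 0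
          rw [zero_pow two_ne_zero] at this
          exact this.mono_left nhdsWithin_le_nhds
        have h1 : Tendsto (fun ε : ℝ => c₀ x + c₁ x * ε) (𝓝[>] 0) (𝓝 (c₀ x)) := by
          have : Tendsto (fun ε : ℝ => c₀ x + c₁ x * ε) (𝓝 0) (𝓝 (c₀ x + c₁ x * (0 : ℝ))) :=
            Continuous.tendsto (by fun_prop) 0
          simp only [Complex.ofReal_zero, mul_zero, add_zero] at this
          exact this.mono_left nhdsWithin_le_nhds
        simpa using hz.add h1
      refine h0.comp (tendsto_nhdsWithin_iff.2 ⟨?_, Eventually.of_forall fun n => ?_⟩)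
      · have := (tendsto_pow_atTop_nhds_zero_of_lt_one (r := (1 / 2 : ℝ)) (by norm_num)
            (by norm_num)).const_mul ε
        rw [mul_zero] at this
        refine this.congr fun n => ?_
        rw [one_div, inv_pow]
        rfl
      · show 0 < ε / 2 ^ n
        positivity
    · intro z hz
      have := dist_le_of_le_geometric_two_of_tendsto₀ (hgeom ε hε z hz) (hG z hz)
      rw [pow_zero, div_one, dist_eq_norm] at this
      linarith
  obtain ⟨G, hGd, hGx, -⟩ := hlim (ε₂ / 4) ⟨by linarith, by linarith⟩
  refine ⟨G, ρ, 2 * K₂, ε₂ / 2, hρ, hρr, by linarith, by linarith, hGd, hGx, fun ε hε z hz => ?_⟩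
  obtain ⟨G', hG'd, hG'x, hG'⟩ := hlim ε hε
  -- Limits from different starting values agree at real points, where both equal `c₀`, hence on the
  -- disc.
  have hnear : ∀ᶠ x : ℝ in 𝓝 u, G' x = G x := by
    filter_upwards [Metric.ball_mem_nhds u hρ] with x hx
    rw [Metric.mem_ball, Real.dist_eq] at hx
    rw [hG'x x hx, hGx x hx]
  rw [← eqOn_ball_of_eq_real hρ hG'd hGd hnear hz]
  exact hG' z hz

/-! ### Uniform bounds on strips. -/

/-- A holomorphic function on a vertical strip whose real part is bounded above grows at most
exponentially along the strip, with an explicit rate. -/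
theorem exists_exp_growth_of_re_le {F : ℂ → ℂ} {u R K : ℝ} (hR : 0 < R)
    (hd : DifferentiableOn ℂ F {z | |z.re - u| < R}) (hK : ∀ z : ℂ, |z.re - u| < R → (F z).re ≤ K) :
    ∃ C, 0 ≤ C ∧ ∀ z : ℂ, |z.re - u| ≤ R / 4 →
      ‖F z‖ ≤ C * Real.exp (4 * Real.log 3 / R * |z.im|) := by
  set M : ℝ := max K 1 with hM
  have hM1 : 1 ≤ M := le_max_right _ _
  -- Borel-Carathéodory with `‖w‖ ≤ R/2` gives `‖F(z+w)‖ ≤ 2M + 3‖F z‖`. Adding `M` makes this bound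
  -- multiplicative, so that it can be iterated.
  have hstep : ∀ z w : ℂ, z.re = u → ‖w‖ ≤ R / 2 → ‖F (z + w)‖ + M ≤ 3 * (‖F z‖ + M) := by
    intro z w hz hw
    have hmem : ∀ x ∈ Metric.ball (0 : ℂ) R, |(z + x).re - u| < R := by
      intro x hx
      rw [Complex.add_re, hz, add_sub_cancel_left]
      exact (Complex.abs_re_le_norm x).trans_lt (by simpa using hx)
    have h := Complex.borelCaratheodory (f := fun x => F (z + x)) (M := M) (R := R) (z := w)
      (by linarith) (hd.comp ((differentiable_id.const_add z).differentiableOn) hmem)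
      (fun x hx => (hK _ (hmem x hx)).trans (le_max_left _ _)) hR
      (by rw [mem_ball_zero_iff]; linarith)
    rw [add_zero] at h
    have hpos : 0 < R - ‖w‖ := by linarith
    have h1 : 2 * M * ‖w‖ / (R - ‖w‖) ≤ 2 * M := by
      rw [div_le_iff₀ hpos]
      nlinarith
    have h2 : ‖F z‖ * (R + ‖w‖) / (R - ‖w‖) ≤ 3 * ‖F z‖ := by
      rw [div_le_iff₀ hpos]
      nlinarith [norm_nonneg (F z)]
    linarith
  have hiter : ∀ (σ : ℝ), |σ| = 1 → ∀ n : ℕ,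
      ‖F (⟨u, σ * (n * (R / 4))⟩ : ℂ)‖ + M ≤ 3 ^ n * (‖F u‖ + M) := by
    intro σ hσ n
    induction n with
    | zero =>
      simp only [Nat.cast_zero, zero_mul, mul_zero, pow_zero, one_mul]
      exact le_of_eq rfl
    | succ n ih =>
      have h := hstep ⟨u, σ * (n * (R / 4))⟩ ⟨0, σ * (R / 4)⟩ rfl (by
        have : (⟨0, σ * (R / 4)⟩ : ℂ) = ((σ * (R / 4) : ℝ) : ℂ) * Complex.I := by
          apply Complex.ext <;> simp
        rw [this, norm_mul, Complex.norm_I, mul_one, Complex.norm_real, Real.norm_eq_abs, abs_mul,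
          hσ, one_mul, abs_of_pos (by positivity)]
        linarith)
      have heq : (⟨u, σ * (n * (R / 4))⟩ : ℂ) + ⟨0, σ * (R / 4)⟩ =
          ⟨u, σ * ((n + 1 : ℕ) * (R / 4))⟩ := by
        apply Complex.ext
        · simp
        · simp only [Complex.add_im]
          push_cast
          ring
      rw [heq] at h
      rw [pow_succ]
      linarith
  refine ⟨3 * (‖F u‖ + M), by positivity, fun z hz => ?_⟩
  -- After `n` vertical moves of length `R/4`, at most `R/4` remains in each coordinate, within
  -- reach of one more application of `hstep`.
  set n : ℕ := ⌊|z.im| / (R / 4)⌋₊ with hn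
  have hn1 : (n : ℝ) ≤ |z.im| / (R / 4) := Nat.floor_le (by positivity)
  have hn1' : (n : ℝ) * (R / 4) ≤ |z.im| := by rwa [le_div_iff₀ (by positivity)] at hn1
  have hn2 : |z.im| < ((n : ℝ) + 1) * (R / 4) := by
    rw [← div_lt_iff₀ (by positivity)]
    exact Nat.lt_floor_add_one _
  obtain ⟨σ, hσ, hσz⟩ : ∃ σ : ℝ, |σ| = 1 ∧ z.im = σ * |z.im| := by
    rcases le_total 0 z.im with h | h
    · exact ⟨1, by simp, by rw [abs_of_nonneg h, one_mul]⟩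
    · exact ⟨-1, by simp, by rw [abs_of_nonpos h]; ring⟩
  have h1 := hiter σ hσ n
  have h2 := hstep ⟨u, σ * (n * (R / 4))⟩ (z - ⟨u, σ * (n * (R / 4))⟩) rfl (by
    refine (Complex.norm_le_abs_re_add_abs_im _).trans ?_
    have him : |(z - ⟨u, σ * (n * (R / 4))⟩ : ℂ).im| ≤ R / 4 := by
      rw [Complex.sub_im]
      simp only
      rw [hσz, ← mul_sub, abs_mul, hσ, one_mul, abs_of_nonneg (by linarith)]
      linarith
    have hre : |(z - ⟨u, σ * (n * (R / 4))⟩ : ℂ).re| ≤ R / 4 := hz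
    linarith)
  rw [add_sub_cancel] at h2
  have h3 : (3 : ℝ) ^ n ≤ Real.exp (4 * Real.log 3 / R * |z.im|) := by
    rw [← Real.log_le_iff_le_exp (by positivity), Real.log_pow]
    calc (n : ℝ) * Real.log 3 ≤ |z.im| / (R / 4) * Real.log 3 := by
          gcongr
      _ = _ := by field_simp
  have h4 : 0 ≤ ‖F u‖ + M := by positivity
  nlinarith

/-- Three lines theorem for a family of quotients `m_ε exp(-F/ε)` on a strip where `Re F` is bounded
above: uniform boundedness on vertical lines gives uniform boundedness on a substrip. -/
theorem exists_uniform_bound_on_strip {F : ℂ → ℂ} {m : ℝ → ℂ → ℂ} {u R K ε₁ : ℝ} {B : ℝ → ℝ}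
    (hR : 0 < R) (hε₁ : 0 < ε₁)
    (hd : DifferentiableOn ℂ F {z | |z.re - u| < R}) (hK : ∀ z : ℂ, |z.re - u| < R → (F z).re ≤ K)
    (hm : ∀ ε ∈ Ioo 0 ε₁, DifferentiableOn ℂ (m ε) {z | |z.re - u| < R})
    (hmB : ∀ ε ∈ Ioo 0 ε₁, ∀ z : ℂ, |z.re - u| < R / 4 → ‖m ε z‖ ≤ B ε)
    (hline : ∀ p : ℝ, |p - u| < R → ∃ C, ∃ ε₂ > 0, ∀ ε ∈ Ioo 0 ε₂, ∀ z : ℂ, z.re = p →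
      ‖m ε z * Complex.exp (-F z / ε)‖ ≤ C) :
    ∃ C, ∃ ε₂ > 0, ε₂ ≤ ε₁ ∧ ∀ ε ∈ Ioo 0 ε₂, ∀ z : ℂ, |z.re - u| ≤ R / 8 →
      ‖m ε z * Complex.exp (-F z / ε)‖ ≤ C := by
  obtain ⟨A, hA0, hA⟩ := exists_exp_growth_of_re_le hR hd hK
  have hab : |(R / 8 : ℝ)| < R := by rw [abs_of_pos (by linarith)]; linarith
  -- Only the two boundary lines are needed, so dependence of the constants on the line does no
  -- harm.
  obtain ⟨Ca, εa, hεa, ha⟩ := hline (u - R / 8) (by rw [sub_sub_cancel_left, abs_neg]; exact hab)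
  obtain ⟨Cb, εb, hεb, hb⟩ := hline (u + R / 8) (by rw [add_sub_cancel_left]; exact hab)
  refine ⟨max Ca Cb, min ε₁ (min εa εb), by positivity, min_le_left _ _, fun ε hε z hz => ?_⟩
  have hε1 : ε ∈ Ioo 0 ε₁ := ⟨hε.1, hε.2.trans_le (min_le_left _ _)⟩
  have hεa' : ε ∈ Ioo 0 εa := ⟨hε.1, hε.2.trans_le ((min_le_right _ _).trans (min_le_left _ _))⟩
  have hεb' : ε ∈ Ioo 0 εb := ⟨hε.1, hε.2.trans_le ((min_le_right _ _).trans (min_le_right _ _))⟩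
  have hsub : Complex.re ⁻¹' Icc (u - R / 8) (u + R / 8) ⊆ {z | |z.re - u| < R} := by
    intro w hw
    rw [mem_preimage, mem_Icc] at hw
    show |w.re - u| < R
    rw [abs_lt]
    constructor <;> linarith
  have hdiff : DifferentiableOn ℂ (fun z => m ε z * Complex.exp (-F z / ε))
      {z | |z.re - u| < R} :=
    (hm ε hε1).mul (hd.neg.div_const _).cexp
  rw [abs_le] at hz
  refine PhragmenLindelof.vertical_strip (f := fun z => m ε z * Complex.exp (-F z / ε))
    (a := u - R / 8) (b := u + R / 8) (C := max Ca Cb) ?_ ?_ (fun w hw => (ha ε hεa' w hw).trans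
      (le_max_left _ _)) (fun w hw => (hb ε hεb' w hw).trans (le_max_right _ _)) (by linarith)
    (by linarith)
  · refine DifferentiableOn.diffContOnCl (hdiff.mono (Subset.trans ?_ hsub))
    rw [Complex.closure_preimage_re, closure_Ioo (by linarith)]
  -- A strip of width `R/4` allows double exponential growth at any rate below `4π/R`, and `log 3 <
  -- π`. The growth constants may depend on `ε`, since they do not enter the conclusion.
  · refine ⟨4 * Real.log 3 / R, ?_, A / ε, ?_⟩
    · have h3 : Real.log 3 < 1.5 := by
        rw [Real.log_lt_iff_lt_exp (by norm_num)]
        have h1 := Real.quadratic_le_exp_of_nonneg (x := 1.5) (by norm_num)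
        norm_num at h1 ⊢
        linarith
      rw [show u + R / 8 - (u - R / 8) = R / 4 by ring, div_div_eq_mul_div]
      rw [div_lt_div_iff_of_pos_right hR]
      nlinarith [Real.pi_gt_three]
    · refine IsBigO.of_bound (B ε) ?_
      filter_upwards [mem_inf_of_right (mem_principal_self _)] with w hw
      rw [mem_preimage, mem_Ioo] at hw
      have hw1 : |w.re - u| < R / 4 := by rw [abs_lt]; constructor <;> linarith
      have hpos := hε.1
      rw [norm_mul, Real.norm_eq_abs, Real.abs_exp]
      have h1 := hmB ε hε1 w hw1
      have hB0 : 0 ≤ B ε := (norm_nonneg _).trans h1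
      gcongr
      rw [Complex.norm_exp]
      gcongr
      refine (Complex.re_le_norm _).trans ?_
      rw [norm_div, norm_neg, Complex.norm_real, Real.norm_eq_abs, abs_of_pos hpos, div_mul_eq_mul_div]
      gcongr
      exact hA w hw1.le

/-! ### Laplace's method to second order. -/

theorem HasFPowerSeriesAt.iteratedDeriv_eq_factorial_mul_coeff {f : ℂ → ℂ}
    {p : FormalMultilinearSeries ℂ ℂ ℂ} {z : ℂ} (h : HasFPowerSeriesAt f p z) (n : ℕ) :
    iteratedDeriv n f z = n.factorial * p.coeff n := by
  obtain ⟨r, hr⟩ := h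
  have := hr.factorial_smul (1 : ℂ) n
  rw [iteratedDeriv_eq_iteratedFDeriv, ← this, FormalMultilinearSeries.coeff, nsmul_eq_mul]
  rfl

/-- Removing a double zero at the origin. -/
theorem exists_quadratic_factor {φ : ℂ → ℂ} {δ : ℝ} (hδ : 0 < δ)
    (hφ : DifferentiableOn ℂ φ (Metric.ball 0 δ)) (h0 : φ 0 = 0) (h1 : deriv φ 0 = 0) :
    ∃ T : ℂ → ℂ, DifferentiableOn ℂ T (Metric.ball 0 δ) ∧ (∀ z, φ z = z ^ 2 * T z) ∧
      T 0 = iteratedDeriv 2 φ 0 / 2 ∧ deriv T 0 = iteratedDeriv 3 φ 0 / 6 ∧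
      iteratedDeriv 2 T 0 = iteratedDeriv 4 φ 0 / 12 := by
  have hn : Metric.ball (0 : ℂ) δ ∈ 𝓝 0 := Metric.ball_mem_nhds _ hδ
  obtain ⟨p, hp⟩ := hφ.analyticAt hn
  -- Two divided slopes at `0` shift the Taylor coefficients by two places, from which the three
  -- derivative values follow.
  have hT := hp.has_fpower_series_iterate_dslope_fslope 2
  refine ⟨(Function.swap dslope 0)^[2] φ, ?_, fun z => ?_, ?_, ?_, ?_⟩
  · exact (Complex.differentiableOn_dslope hn).2 ((Complex.differentiableOn_dslope hn).2 hφ)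
  · have e1 := sub_smul_dslope φ 0 z
    have e2 := sub_smul_dslope (dslope φ 0) 0 z
    rw [dslope_same, h1] at e2
    rw [h0] at e1
    simp only [sub_zero, smul_eq_mul] at e1 e2
    show φ z = z ^ 2 * dslope (dslope φ 0) 0 z
    rw [← e1, ← e2]
    ring
  · have e := hT.iteratedDeriv_eq_factorial_mul_coeff 0
    rw [FormalMultilinearSeries.coeff_iterate_fslope] at e
    rw [hp.iteratedDeriv_eq_factorial_mul_coeff 2]
    simp only [iteratedDeriv_zero] at e
    rw [e]
    norm_num [Nat.factorial]
  · have e := hT.iteratedDeriv_eq_factorial_mul_coeff 1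
    rw [FormalMultilinearSeries.coeff_iterate_fslope, iteratedDeriv_one] at e
    rw [hp.iteratedDeriv_eq_factorial_mul_coeff 3, e]
    norm_num [Nat.factorial]
  · have e := hT.iteratedDeriv_eq_factorial_mul_coeff 2
    rw [FormalMultilinearSeries.coeff_iterate_fslope] at e
    rw [hp.iteratedDeriv_eq_factorial_mul_coeff 4, e]
    norm_num [Nat.factorial]
    ring

/-- For `s = v²/ε` the powers of `s` separate the contributions of order `v²`, `v⁴/ε` and `v⁶/ε²` in
the Laplace integrand. -/
theorem iteratedDeriv_two_cexp_mul {R q : ℂ → ℂ} {s : ℂ} (hR : AnalyticAt ℂ R 0)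
    (hq : AnalyticAt ℂ q 0) (hR0 : R 0 = 0) :
    iteratedDeriv 2 (fun z => Complex.exp (s * R z) * q z) 0 =
      q 0 * (s * iteratedDeriv 2 R 0 + s ^ 2 * deriv R 0 ^ 2) + 2 * s * deriv R 0 * deriv q 0 +
        iteratedDeriv 2 q 0 := by
  have h1 : deriv (fun z => Complex.exp (s * R z) * q z) =ᶠ[𝓝 0]
      fun z => Complex.exp (s * R z) * (s * deriv R z * q z + deriv q z) := by
    filter_upwards [hR.eventually_analyticAt, hq.eventually_analyticAt] with z hRz hqz
    have := (((hRz.differentiableAt.hasDerivAt.const_mul s).cexp).mul hqz.differentiableAt.hasDerivAt).deriv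
    refine Eq.trans this ?_
    ring
  have hdR := hR.deriv.differentiableAt.hasDerivAt
  have hdq := hq.deriv.differentiableAt.hasDerivAt
  have h2 := ((hR.differentiableAt.hasDerivAt.const_mul s).cexp).mul
    (((hdR.const_mul s).mul hq.differentiableAt.hasDerivAt).add hdq)
  have e2 : ∀ f : ℂ → ℂ, iteratedDeriv 2 f 0 = deriv (deriv f) 0 := fun f => by
    rw [iteratedDeriv_succ, iteratedDeriv_one]
  rw [e2, e2, e2, h1.deriv_eq]
  refine Eq.trans h2.deriv ?_
  simp only [hR0, mul_zero, Complex.exp_zero, Pi.mul_apply, Pi.add_apply]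
  ring

/-- Fourth order remainder of the even part of a bounded holomorphic function. -/
theorem norm_even_remainder_le {H : ℂ → ℂ} {ρ M : ℝ} (hρ : 0 < ρ)
    (hd : DifferentiableOn ℂ H (Metric.ball 0 ρ)) (hM : ∀ z ∈ Metric.ball 0 ρ, ‖H z‖ ≤ M)
    {z : ℂ} (hz : z ∈ Metric.ball 0 ρ) :
    ‖H z + H (-z) - 2 * H 0 - iteratedDeriv 2 H 0 * z ^ 2‖ ≤ 12 * M * (‖z‖ / ρ) ^ 4 := by
  have h0 : (0 : ℂ) ∈ Metric.ball 0 ρ := Metric.mem_ball_self hρ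
  have hM0 : 0 ≤ M := (norm_nonneg _).trans (hM 0 h0)
  obtain ⟨p, hp⟩ := hd.analyticAt (Metric.ball_mem_nhds _ hρ)
  have hneg : ∀ x ∈ Metric.ball (0 : ℂ) ρ, -x ∈ Metric.ball (0 : ℂ) ρ := fun x hx => by
    simpa using hx
  set E : ℂ → ℂ := fun z => H z + H (-z) - 2 * H 0 - iteratedDeriv 2 H 0 * z ^ 2 with hE
  have hE0 : E 0 = 0 := by simp only [hE, neg_zero]; ring
  have hH2 : ‖iteratedDeriv 2 H 0‖ ≤ 8 * M / ρ ^ 2 := by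
    have h2 := Complex.norm_iteratedDeriv_le_of_forall_mem_sphere_norm_le (f := H) (c := 0)
      (R := ρ / 2) (C := M) 2 (by linarith)
      (DifferentiableOn.diffContOnCl (hd.mono (by
        rw [closure_ball _ (by positivity)]
        exact Metric.closedBall_subset_ball (by linarith))))
      (fun w hw => hM w (by
        rw [mem_sphere_zero_iff_norm] at hw
        rw [mem_ball_zero_iff]; linarith))
    refine h2.trans (le_of_eq ?_)
    norm_num [Nat.factorial]
    field_simp
    ring
  have hEd : DifferentiableOn ℂ E (Metric.ball 0 ρ) := by
    have := hd.comp (differentiable_neg.differentiableOn) hneg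
    exact ((hd.add this).sub_const _).sub
      ((differentiable_id.pow 2).const_mul _).differentiableOn
  have hEM : MapsTo E (Metric.ball 0 ρ) (Metric.closedBall (E 0) (12 * M)) := by
    intro w hw
    rw [hE0, mem_closedBall_zero_iff]
    have hw' := mem_ball_zero_iff.1 hw
    calc ‖E w‖ ≤ ‖H w‖ + ‖H (-w)‖ + ‖2 * H 0‖ + ‖iteratedDeriv 2 H 0 * w ^ 2‖ := by
          refine (norm_sub_le _ _).trans ?_
          gcongr
          refine (norm_sub_le _ _).trans ?_
          gcongr
          exact norm_add_le _ _
      _ ≤ M + M + 2 * M + 8 * M / ρ ^ 2 * ρ ^ 2 := by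
          rw [norm_mul, norm_mul, norm_pow]
          gcongr
          · exact hM w hw
          · exact hM _ (hneg w hw)
          · simp
          · exact hM 0 h0
      _ = 12 * M := by field_simp; ring
  -- Odd terms cancel in `H z + H (-z)` and those of degree `0` and `2` are subtracted, so `E`
  -- vanishes to order four. The higher order Schwarz lemma takes this in the form `o(|w|³)`.
  have hlit : (fun w => E w - E 0) =o[𝓝 0] fun w => ‖w - 0‖ ^ 3 := by
    have hO := hp.isBigO_sub_partialSum_pow 4
    simp only [zero_add] at hO
    have htn : Tendsto (fun w : ℂ => -w) (𝓝 0) (𝓝 0) := by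
      have := (continuous_neg (G := ℂ)).tendsto 0
      rwa [neg_zero] at this
    have hO2 := hO.comp_tendsto htn
    have hsum : (fun w => E w - E 0) =O[𝓝 0] fun w : ℂ => ‖w‖ ^ 4 := by
      refine (hO.add (hO2.congr_right fun w => by simp)).congr_left fun w => ?_
      have hc0 := hp.iteratedDeriv_eq_factorial_mul_coeff 0
      have hc2 := hp.iteratedDeriv_eq_factorial_mul_coeff 2
      simp only [iteratedDeriv_zero, Nat.factorial, Nat.cast_one, one_mul] at hc0 hc2
      simp only [Function.comp, FormalMultilinearSeries.partialSum, Finset.sum_range_succ,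
        Finset.sum_range_zero, FormalMultilinearSeries.apply_eq_pow_smul_coeff, smul_eq_mul]
      rw [hE0, hE]
      simp only
      rw [hc0, hc2]
      push_cast
      ring
    refine hsum.trans_isLittleO ?_
    simp only [sub_zero]
    refine IsLittleO.of_norm_left ?_
    simp only [norm_pow, norm_norm]
    exact (isLittleO_pow_pow (𝕜 := ℝ) (by norm_num : 3 < 4)).comp_tendsto tendsto_norm_zero
  have h := Complex.dist_le_mul_div_pow_of_mapsTo_ball_of_isLittleO hEd hEM hlit hz
  rwa [hE0, dist_zero_right, dist_zero_right] at h

theorem integrable_pow_mul_exp_neg_mul_sq {b : ℝ} (hb : 0 < b) (n : ℕ) :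
    Integrable fun v : ℝ => v ^ n * Real.exp (-b * v ^ 2) := by
  have := integrable_rpow_mul_exp_neg_mul_sq hb (s := n) (by
    have : (0 : ℝ) ≤ n := Nat.cast_nonneg n
    linarith)
  simpa only [Real.rpow_natCast] using this

/-- Even Gaussian moments. -/
theorem integral_pow_mul_exp_neg_mul_sq {c ε : ℝ} (hc : 0 < c) (hε : 0 < ε) (n : ℕ) :
    ∫ v : ℝ, v ^ (2 * n) * Real.exp (-(c / ε) * v ^ 2) =
      (2 * n - 1 : ℕ).doubleFactorial / (2 * c) ^ n * ε ^ n * Real.sqrt (Real.pi * ε / c) := by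
  have h1 : ∫ v : ℝ, v ^ (2 * n) * Real.exp (-(c / ε) * v ^ 2) =
      2 * ∫ v in Ioi (0 : ℝ), v ^ ((2 * n : ℕ) : ℝ) * Real.exp (-(c / ε) * v ^ (2 : ℝ)) := by
    have h := integral_comp_abs (f := fun v : ℝ => v ^ (2 * n) * Real.exp (-(c / ε) * v ^ 2))
    simp only [sq_abs, pow_mul] at h
    simp only [pow_mul] at h ⊢
    rw [h]
    congr 1
    refine setIntegral_congr_fun measurableSet_Ioi fun v _ => ?_
    simp only [Real.rpow_natCast, Real.rpow_two, pow_mul]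
  rw [h1, integral_rpow_mul_exp_neg_mul_rpow (by norm_num) (by
    have : (0 : ℝ) ≤ (2 * n : ℕ) := Nat.cast_nonneg _
    linarith) (by positivity)]
  have h2 : (((2 * n : ℕ) : ℝ) + 1) / 2 = n + 1 / 2 := by push_cast; ring
  have h3 : -(((2 * n : ℕ) : ℝ) + 1) / 2 = -(n + 1 / 2) := by push_cast; ring
  rw [h2, h3, Real.Gamma_nat_add_half, Real.rpow_neg (by positivity), Real.rpow_add (by positivity),
    Real.rpow_natCast, ← Real.sqrt_eq_rpow, mul_div_assoc Real.pi, Real.sqrt_mul Real.pi_pos.le,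
    ← inv_div c ε, Real.sqrt_inv]
  rw [mul_inv, ← inv_pow, inv_div, div_pow, mul_pow]
  have hs : Real.sqrt (c / ε) ≠ 0 := by positivity
  field_simp

/-- Any power above `5/2` would do; the cubic term of the exponential series is the first that
suffices. -/
theorem exp_neg_div_le {η ε : ℝ} (hη : 0 < η) (hε : 0 < ε) :
    Real.exp (-η / ε) ≤ 6 / η ^ 3 * ε ^ 3 := by
  have h := Real.pow_div_factorial_le_exp (η / ε) (by positivity) 3
  rw [neg_div, Real.exp_neg, inv_le_comm₀ (Real.exp_pos _) (by positivity)]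
  refine le_trans (le_of_eq ?_) h
  norm_num [Nat.factorial]
  field_simp

theorem integral_linear_combination_four {𝕜 : Type*} [RCLike 𝕜] {f₁ f₂ f₃ f₄ : ℝ → 𝕜}
    (h₁ : Integrable f₁) (h₂ : Integrable f₂) (h₃ : Integrable f₃) (h₄ : Integrable f₄)
    (c₁ c₂ c₃ c₄ : 𝕜) :
    ∫ v, (c₁ * f₁ v + c₂ * f₂ v + c₃ * f₃ v + c₄ * f₄ v) =
      c₁ * (∫ v, f₁ v) + c₂ * (∫ v, f₂ v) + c₃ * (∫ v, f₃ v) + c₄ * ∫ v, f₄ v := by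
  have i12 : Integrable fun v => c₁ * f₁ v + c₂ * f₂ v := (h₁.const_mul _).add (h₂.const_mul _)
  have i123 : Integrable fun v => c₁ * f₁ v + c₂ * f₂ v + c₃ * f₃ v := i12.add (h₃.const_mul _)
  rw [integral_add i123 (h₄.const_mul _), integral_add i12 (h₃.const_mul _),
    integral_add (h₁.const_mul _) (h₂.const_mul _)]
  simp only [integral_const_mul]

/-- The Gaussian approximation, to second order, of the symmetrized Laplace integrand. -/
noncomputable def laplaceMain (a ε : ℝ) (c₀ c₂ c₄ c₆ : ℂ) (v : ℝ) : ℂ :=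
  c₀ * ((v ^ 0 * Real.exp (-(a / 2 / ε) * v ^ 2) : ℝ) : ℂ)
    + c₂ * ((v ^ 2 * Real.exp (-(a / 2 / ε) * v ^ 2) : ℝ) : ℂ)
    + c₄ / ε * ((v ^ 4 * Real.exp (-(a / 2 / ε) * v ^ 2) : ℝ) : ℂ)
    + c₆ / ε ^ 2 * ((v ^ 6 * Real.exp (-(a / 2 / ε) * v ^ 2) : ℝ) : ℂ)

theorem integrable_laplaceMain {a ε : ℝ} (ha : 0 < a) (hε : 0 < ε) (c₀ c₂ c₄ c₆ : ℂ) :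
    Integrable (laplaceMain a ε c₀ c₂ c₄ c₆) := by
  have h := fun n => (integrable_pow_mul_exp_neg_mul_sq (b := a / 2 / ε) (by positivity) n).ofReal
    (𝕜 := ℂ)
  exact ((((h 0).const_mul _).add ((h 2).const_mul _)).add ((h 4).const_mul _)).add
    ((h 6).const_mul _)

theorem integral_laplaceMain {a ε : ℝ} (ha : 0 < a) (hε : 0 < ε) (c₀ c₂ c₄ c₆ : ℂ) :
    ∫ v, laplaceMain a ε c₀ c₂ c₄ c₆ v = (Real.sqrt (2 * Real.pi * ε / a) : ℂ) *
      (c₀ + ε * (c₂ / a + 3 * c₄ / a ^ 2 + 15 * c₆ / a ^ 3)) := by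
  have h : ∀ n : ℕ, Integrable fun v : ℝ =>
      ((v ^ n * Real.exp (-(a / 2 / ε) * v ^ 2) : ℝ) : ℂ) := fun n =>
    (integrable_pow_mul_exp_neg_mul_sq (by positivity) n).ofReal
  have hm := fun n => integral_pow_mul_exp_neg_mul_sq (c := a / 2) (by positivity) hε n
  have hm0 := hm 0
  have hm1 := hm 1
  have hm2 := hm 2
  have hm3 := hm 3
  norm_num [Nat.doubleFactorial] at hm0 hm1 hm2 hm3
  rw [show Real.pi * ε / (a / 2) = 2 * Real.pi * ε / a by field_simp] at hm0 hm1 hm2 hm3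
  have hs : (a : ℂ) ≠ 0 := by exact_mod_cast ha.ne'
  have hs' : (ε : ℂ) ≠ 0 := by exact_mod_cast hε.ne'
  simp only [laplaceMain]
  rw [integral_linear_combination_four (h 0) (h 2) (h 4) (h 6)]
  simp only [integral_complex_ofReal]
  simp only [pow_zero, one_mul, neg_mul] at hm0 hm1 hm2 hm3 ⊢
  rw [hm0, hm1, hm2, hm3]
  push_cast
  field_simp
  ring

/-- Half of the Gaussian rate is given up so that the bound has the same shape as the error from the
region near the origin. -/
theorem norm_laplaceMain_le {a ε K : ℝ} (ha : 0 < a) (hpos : 0 < ε) {c₀ c₂ c₄ c₆ : ℂ}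
    (h₀ : ‖c₀‖ ≤ K) (h₂ : ‖c₂‖ ≤ K) (h₄ : ‖c₄‖ ≤ K) (h₆ : ‖c₆‖ ≤ K) (v : ℝ) :
    ‖laplaceMain a ε c₀ c₂ c₄ c₆ v‖ ≤ K * (1 + v ^ 2 + 1 / ε * v ^ 4 + 1 / ε ^ 2 * v ^ 6) *
      Real.exp (-(a / 4 / ε) * v ^ 2) := by
  have hK0 : 0 ≤ K := (norm_nonneg _).trans h₀
  have hexp : Real.exp (-(a / 2 / ε) * v ^ 2) ≤ Real.exp (-(a / 4 / ε) * v ^ 2) := by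
    rw [neg_mul, neg_mul]
    gcongr
    linarith
  have hterm : ∀ (c : ℂ) (n : ℕ), Even n → ‖c‖ ≤ K →
      ‖c * ((v ^ n * Real.exp (-(a / 2 / ε) * v ^ 2) : ℝ) : ℂ)‖ ≤
        K * (v ^ n * Real.exp (-(a / 4 / ε) * v ^ 2)) := by
    intro c n hn' hc
    have hvn : 0 ≤ v ^ n := hn'.pow_nonneg v
    rw [norm_mul, Complex.norm_real, Real.norm_eq_abs, abs_of_nonneg (by positivity)]
    gcongr
  have hn4 : ‖c₄ / ε * ((v ^ 4 * Real.exp (-(a / 2 / ε) * v ^ 2) : ℝ) : ℂ)‖ ≤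
      1 / ε * (K * (v ^ 4 * Real.exp (-(a / 4 / ε) * v ^ 2))) := by
    rw [div_mul_eq_mul_div, norm_div, Complex.norm_real, Real.norm_eq_abs, abs_of_pos hpos,
      one_div_mul_eq_div]
    gcongr
    exact hterm _ 4 (by decide) h₄
  have hn6 : ‖c₆ / ε ^ 2 * ((v ^ 6 * Real.exp (-(a / 2 / ε) * v ^ 2) : ℝ) : ℂ)‖ ≤
      1 / ε ^ 2 * (K * (v ^ 6 * Real.exp (-(a / 4 / ε) * v ^ 2))) := by
    rw [div_mul_eq_mul_div, norm_div, norm_pow, Complex.norm_real, Real.norm_eq_abs,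
      abs_of_pos hpos, one_div_mul_eq_div]
    gcongr
    exact hterm _ 6 (by decide) h₆
  have hn0 := hterm (c₀) 0 (by decide) h₀
  have hn2 := hterm (c₂) 2 (by decide) h₂
  refine (norm_add_le _ _).trans ((add_le_add ((norm_add_le _ _).trans (add_le_add
    ((norm_add_le _ _).trans (add_le_add hn0 hn2)) hn4)) hn6).trans (le_of_eq ?_))
  rw [pow_zero]
  ring

/-- Under the Gaussian weight `v²` counts as `ε`, so each monomial integrates to `O(ε²√ε)`. The
exponentially small Cauchy-type term represents the tail of the integrand. -/
theorem integral_gaussian_error_le {L B η b ε : ℝ} (hL0 : 0 ≤ L) (hB : 0 ≤ B) (hη : 0 < η)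
    (hb0 : 0 < b) (hpos : 0 < ε) (hεone : ε < 1) :
    Integrable (fun v : ℝ => L * (v ^ 4 * Real.exp (-(b / ε) * v ^ 2)
      + v ^ 6 * Real.exp (-(b / ε) * v ^ 2)
      + 1 / ε * (v ^ 8 * Real.exp (-(b / ε) * v ^ 2))
      + 1 / ε ^ 2 * (v ^ 10 * Real.exp (-(b / ε) * v ^ 2)))
      + B * Real.exp (-η / ε) * (1 + v ^ 2)⁻¹) ∧
    ∫ v : ℝ, (L * (v ^ 4 * Real.exp (-(b / ε) * v ^ 2)
      + v ^ 6 * Real.exp (-(b / ε) * v ^ 2)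
      + 1 / ε * (v ^ 8 * Real.exp (-(b / ε) * v ^ 2))
      + 1 / ε ^ 2 * (v ^ 10 * Real.exp (-(b / ε) * v ^ 2)))
      + B * Real.exp (-η / ε) * (1 + v ^ 2)⁻¹) ≤
      (L * Real.sqrt (Real.pi / b) * (3 / (2 * b) ^ 2 + 15 / (2 * b) ^ 3 +
        105 / (2 * b) ^ 4 + 945 / (2 * b) ^ 5) + B * (6 / η ^ 3) * Real.pi) *
        (ε ^ 2 * Real.sqrt ε) := by
  have hG := fun n => integrable_pow_mul_exp_neg_mul_sq (b := b / ε) (by positivity) n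
  have hcau := integrable_inv_one_add_sq
  have hbi : Integrable fun v : ℝ => L * (v ^ 4 * Real.exp (-(b / ε) * v ^ 2)
      + v ^ 6 * Real.exp (-(b / ε) * v ^ 2)
      + 1 / ε * (v ^ 8 * Real.exp (-(b / ε) * v ^ 2))
      + 1 / ε ^ 2 * (v ^ 10 * Real.exp (-(b / ε) * v ^ 2))) :=
    ((((hG 4).add (hG 6)).add ((hG 8).const_mul _)).add ((hG 10).const_mul _)).const_mul L
  have hci : Integrable fun v : ℝ => B * Real.exp (-η / ε) * (1 + v ^ 2)⁻¹ :=
    hcau.const_mul _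
  refine ⟨hbi.add hci, ?_⟩
  have hval : ∫ v : ℝ, L * (v ^ 4 * Real.exp (-(b / ε) * v ^ 2)
      + v ^ 6 * Real.exp (-(b / ε) * v ^ 2)
      + 1 / ε * (v ^ 8 * Real.exp (-(b / ε) * v ^ 2))
      + 1 / ε ^ 2 * (v ^ 10 * Real.exp (-(b / ε) * v ^ 2)))
      + B * Real.exp (-η / ε) * (1 + v ^ 2)⁻¹ =
      L * (3 / (2 * b) ^ 2 * ε ^ 2 + 15 / (2 * b) ^ 3 * ε ^ 3 + 105 / (2 * b) ^ 4 * ε ^ 3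
        + 945 / (2 * b) ^ 5 * ε ^ 3) * Real.sqrt (Real.pi * ε / b)
        + B * Real.exp (-η / ε) * Real.pi := by
    have hm := fun n => integral_pow_mul_exp_neg_mul_sq (c := b) hb0 hpos n
    have hm2 := hm 2
    have hm3 := hm 3
    have hm4 := hm 4
    have hm5 := hm 5
    simp only [Nat.reduceMul, Nat.reduceSub, Nat.doubleFactorial, Nat.reduceAdd] at hm2 hm3 hm4 hm5
    have hlin := integral_linear_combination_four (hG 4) (hG 6) (hG 8) (hG 10) 1 1 (1 / ε)
      (1 / ε ^ 2)
    simp only [one_mul] at hlin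
    rw [integral_add hbi hci, integral_const_mul, integral_const_mul,
      integral_univ_inv_one_add_sq, hlin, hm2, hm3, hm4, hm5]
    push_cast
    field_simp
  refine (le_of_eq hval).trans ?_
  have hsq : Real.sqrt (Real.pi * ε / b) = Real.sqrt (Real.pi / b) * Real.sqrt ε := by
    rw [← Real.sqrt_mul (by positivity)]
    congr 1
    ring
  have hε32 : ε ^ 3 ≤ ε ^ 2 := pow_le_pow_of_le_one hpos.le hεone.le (by norm_num)
  have hsqle : ε ≤ Real.sqrt ε := by
    rw [Real.le_sqrt hpos.le hpos.le]
    nlinarith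
  have hexp := exp_neg_div_le hη hpos
  have hexp' : Real.exp (-η / ε) ≤ 6 / η ^ 3 * (ε ^ 2 * Real.sqrt ε) := by
    refine hexp.trans ?_
    rw [show ε ^ 3 = ε ^ 2 * ε by ring]
    gcongr
  rw [hsq]
  calc L * (3 / (2 * b) ^ 2 * ε ^ 2 + 15 / (2 * b) ^ 3 * ε ^ 3 + 105 / (2 * b) ^ 4 * ε ^ 3
        + 945 / (2 * b) ^ 5 * ε ^ 3) * (Real.sqrt (Real.pi / b) * Real.sqrt ε)
        + B * Real.exp (-η / ε) * Real.pi
      ≤ L * (3 / (2 * b) ^ 2 * ε ^ 2 + 15 / (2 * b) ^ 3 * ε ^ 2 + 105 / (2 * b) ^ 4 * ε ^ 2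
        + 945 / (2 * b) ^ 5 * ε ^ 2) * (Real.sqrt (Real.pi / b) * Real.sqrt ε)
        + B * (6 / η ^ 3 * (ε ^ 2 * Real.sqrt ε)) * Real.pi := by gcongr
    _ = _ := by ring

set_option maxHeartbeats 1000000 in
/-- Second order Laplace expansion with a complex phase and an amplitude that is holomorphic,
uniformly in the parameter. -/
theorem laplace_expansion {φ : ℂ → ℂ} {p : ℝ → ℂ → ℂ} {J : ℝ → ℝ → ℂ} {a δ ε₁ C : ℝ}
    (ha : 0 < a) (hδ : 0 < δ) (hε₁ : 0 < ε₁)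
    (hφ : DifferentiableOn ℂ φ (Metric.ball 0 δ)) (h0 : φ 0 = 0) (h1 : deriv φ 0 = 0)
    (h2 : iteratedDeriv 2 φ 0 = -a)
    (hp : ∀ ε ∈ Ioo 0 ε₁, DifferentiableOn ℂ (p ε) (Metric.ball 0 δ))
    (hpC : ∀ ε ∈ Ioo 0 ε₁, ∀ z ∈ Metric.ball 0 δ, ‖p ε z‖ ≤ C)
    (hJ : ∀ ε ∈ Ioo 0 ε₁, ∀ v : ℝ, |v| < δ → J ε v = Complex.exp (φ v / ε) * p ε v)
    (hJint : ∀ ε ∈ Ioo 0 ε₁, Integrable (J ε))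
    (htail : ∀ δ' > 0, ∃ η > 0, ∃ B : ℝ, ∀ ε ∈ Ioo 0 ε₁, ∀ v : ℝ, δ' ≤ |v| →
      ‖J ε v‖ ≤ B * Real.exp (-η / ε) * (1 + v ^ 2)⁻¹) :
    (fun ε : ℝ => (∫ v, J ε v) - (Real.sqrt (2 * Real.pi * ε / a) : ℂ) *
      (p ε 0 + ε * (p ε 0 * (iteratedDeriv 4 φ 0 / (8 * a ^ 2) +
          5 * iteratedDeriv 3 φ 0 ^ 2 / (24 * a ^ 3))
        + deriv (p ε) 0 * iteratedDeriv 3 φ 0 / (2 * a ^ 2)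
        + iteratedDeriv 2 (p ε) 0 / (2 * a)))) =O[𝓝[>] 0] fun ε : ℝ => ε ^ 2 * Real.sqrt ε := by
  have hn : Metric.ball (0 : ℂ) δ ∈ 𝓝 0 := Metric.ball_mem_nhds _ hδ
  obtain ⟨T, hTd, hTφ, hT0, hT1, hT2⟩ := exists_quadratic_factor hδ hφ h0 h1
  -- The phase becomes `φ(v) = -a v²/2 + v² R(v)` with `R(0) = 0`. Near the origin `|R| ≤ a/4`, so
  -- the correction costs at most half of the Gaussian.
  set R : ℂ → ℂ := fun z => T z + a / 2 with hR
  have hRd : DifferentiableOn ℂ R (Metric.ball 0 δ) := hTd.add_const _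
  have hR0 : R 0 = 0 := by simp only [hR]; rw [hT0, h2]; ring
  have hdR : deriv R = deriv T := by funext z; simp [hR]
  have hR1 : deriv R 0 = iteratedDeriv 3 φ 0 / 6 := by rw [hdR, hT1]
  have hR2 : iteratedDeriv 2 R 0 = iteratedDeriv 4 φ 0 / 12 := by
    rw [← hT2, iteratedDeriv_succ, iteratedDeriv_one, iteratedDeriv_succ, iteratedDeriv_one, hdR]
  obtain ⟨ρ, hρ, hρδ, hRρ⟩ : ∃ ρ > 0, ρ ≤ δ ∧ ∀ z ∈ Metric.ball (0 : ℂ) ρ, ‖R z‖ ≤ a / 4 := by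
    have hc : ContinuousAt R 0 := (hRd.differentiableAt hn).continuousAt
    have hc' := hc.norm
    rw [ContinuousAt, hR0, norm_zero] at hc'
    obtain ⟨ρ, hρ, hb⟩ := Metric.eventually_nhds_iff_ball.1
      (hc'.eventually (gt_mem_nhds (show (0 : ℝ) < a / 4 by positivity)))
    exact ⟨min ρ δ, lt_min hρ hδ, min_le_right _ _, fun z hz =>
      (hb z (Metric.ball_subset_ball (min_le_left _ _) hz)).le⟩
  have hsub : Metric.ball (0 : ℂ) ρ ⊆ Metric.ball 0 δ := Metric.ball_subset_ball hρδ
  obtain ⟨η, hη, B, hB⟩ := htail (ρ / 2) (by positivity)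
  have hC0 : 0 ≤ C := (norm_nonneg _).trans
    (hpC (ε₁ / 2) ⟨by linarith, by linarith⟩ 0 (Metric.mem_ball_self hδ))
  set R1 := deriv R 0
  set R2 := iteratedDeriv 2 R 0
  -- A common bound for the four coefficients of the Gaussian approximation, each summand being the
  -- bound for one of them.
  set K : ℝ := C + 4 * C / ρ ^ 2 + (C * ‖R2‖ / 2 + ‖R1‖ * (2 * C / ρ)) + C * ‖R1‖ ^ 2 / 2 with hK
  have hK0 : 0 ≤ K := by positivity
  -- The first summand serves the Taylor remainder for `|v| < ρ/2`, the second the Gaussian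
  -- approximation for `|v| ≥ ρ/2`.
  set L : ℝ := 6 * C / ρ ^ 4 + 16 * K / ρ ^ 4 with hL
  have hL0 : 0 ≤ L := by positivity
  set c2 : ℝ → ℂ := fun ε => iteratedDeriv 2 (p ε) 0 / 2 with hc2
  set c4 : ℝ → ℂ := fun ε => p ε 0 * R2 / 2 + R1 * deriv (p ε) 0 with hc4
  set c6 : ℝ → ℂ := fun ε => p ε 0 * R1 ^ 2 / 2 with hc6
  have hp0K : ∀ ε ∈ Ioo 0 ε₁, ‖p ε 0‖ ≤ C := fun ε hε => hpC ε hε 0 (Metric.mem_ball_self hδ)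
  have hcauchy : ∀ ε ∈ Ioo 0 ε₁, ∀ n : ℕ, ‖iteratedDeriv n (p ε) 0‖ ≤
      n.factorial * C / (ρ / 2) ^ n := fun ε hε n =>
    Complex.norm_iteratedDeriv_le_of_forall_mem_sphere_norm_le n (by linarith)
      (DifferentiableOn.diffContOnCl (((hp ε hε).mono hsub).mono (by
        rw [closure_ball _ (by positivity)]
        exact Metric.closedBall_subset_ball (by linarith))))
      (fun w hw => hpC ε hε w (hsub (by
        rw [mem_sphere_zero_iff_norm] at hw
        rw [mem_ball_zero_iff]; linarith)))
  have hp1 : ∀ ε ∈ Ioo 0 ε₁, ‖deriv (p ε) 0‖ ≤ 2 * C / ρ := by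
    intro ε hε
    have h := hcauchy ε hε 1
    rw [iteratedDeriv_one] at h
    refine h.trans (le_of_eq ?_)
    norm_num [Nat.factorial]
    field_simp
  have hp2 : ∀ ε ∈ Ioo 0 ε₁, ‖iteratedDeriv 2 (p ε) 0‖ ≤ 8 * C / ρ ^ 2 := by
    intro ε hε
    refine (hcauchy ε hε 2).trans (le_of_eq ?_)
    norm_num [Nat.factorial]
    field_simp
    ring
  have hKterms : 0 ≤ 4 * C / ρ ^ 2 ∧ 0 ≤ C * ‖R2‖ / 2 ∧ 0 ≤ ‖R1‖ * (2 * C / ρ) ∧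
    0 ≤ C * ‖R1‖ ^ 2 / 2 := ⟨by positivity, by positivity, by positivity, by positivity⟩
  obtain ⟨hk1, hk2, hk3, hk4⟩ := hKterms
  have hc2K : ∀ ε ∈ Ioo 0 ε₁, ‖c2 ε‖ ≤ K := by
    intro ε hε
    have := hp2 ε hε
    simp only [hc2, norm_div, Complex.norm_ofNat]
    have e : 8 * C / ρ ^ 2 = 2 * (4 * C / ρ ^ 2) := by ring
    linarith
  have hc4K : ∀ ε ∈ Ioo 0 ε₁, ‖c4 ε‖ ≤ K := by
    intro ε hε
    calc ‖c4 ε‖ ≤ ‖p ε 0 * R2 / 2‖ + ‖R1 * deriv (p ε) 0‖ := norm_add_le _ _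
      _ ≤ C * ‖R2‖ / 2 + ‖R1‖ * (2 * C / ρ) := by
        rw [norm_div, norm_mul, norm_mul, Complex.norm_ofNat]
        gcongr
        · exact hp0K ε hε
        · exact hp1 ε hε
      _ ≤ K := by linarith
  have hc6K : ∀ ε ∈ Ioo 0 ε₁, ‖c6 ε‖ ≤ K := by
    intro ε hε
    calc ‖c6 ε‖ ≤ C * ‖R1‖ ^ 2 / 2 := by
          simp only [hc6]
          rw [norm_div, norm_mul, norm_pow, Complex.norm_ofNat]
          gcongr
          exact hp0K ε hε
      _ ≤ K := by linarith
  have hpoint : ∀ ε ∈ Ioo 0 ε₁, ∀ v : ℝ,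
      ‖(J ε v + J ε (-v)) / 2 - laplaceMain a ε (p ε 0) (c2 ε) (c4 ε) (c6 ε) v‖ ≤
        L * (v ^ 4 * Real.exp (-(a / 4 / ε) * v ^ 2) + v ^ 6 * Real.exp (-(a / 4 / ε) * v ^ 2)
          + 1 / ε * (v ^ 8 * Real.exp (-(a / 4 / ε) * v ^ 2))
          + 1 / ε ^ 2 * (v ^ 10 * Real.exp (-(a / 4 / ε) * v ^ 2)))
        + |B| * Real.exp (-η / ε) * (1 + v ^ 2)⁻¹ := by
    intro ε hε v
    have hpos := hε.1
    have hεC : (ε : ℂ) ≠ 0 := by exact_mod_cast hpos.ne'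
    have hevenpos : 0 ≤ v ^ 4 ∧ 0 ≤ v ^ 6 ∧ 0 ≤ v ^ 8 ∧ 0 ≤ v ^ 10 :=
      ⟨by positivity, by positivity, by positivity, by positivity⟩
    obtain ⟨hv4, hv6, hv8, hv10⟩ := hevenpos
    rcases lt_or_ge |v| (ρ / 2) with hv | hv
    · have hvρ : (v : ℂ) ∈ Metric.ball (0 : ℂ) ρ := by
        rw [mem_ball_zero_iff, Complex.norm_real, Real.norm_eq_abs]; linarith
      -- With `s` frozen at `v²/ε`, the function `H` is holomorphic in `z` with an explicit bound on
      -- the disc. Its even Taylor remainder at `z = v` is exactly the error of the symmetrized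
      -- integrand.
      set s : ℝ := v ^ 2 / ε with hs
      have hs0 : 0 ≤ s := by positivity
      set H : ℂ → ℂ := fun z => Complex.exp (s * R z) * p ε z with hH
      have hHd : DifferentiableOn ℂ H (Metric.ball 0 ρ) :=
        (((hRd.mono hsub).const_mul _).cexp).mul ((hp ε hε).mono hsub)
      have hHM : ∀ z ∈ Metric.ball 0 ρ, ‖H z‖ ≤ Real.exp (s * (a / 4)) * C := by
        intro z hz
        rw [norm_mul, Complex.norm_exp]
        gcongr
        · refine (Complex.re_le_norm _).trans ?_
          rw [norm_mul, Complex.norm_real, Real.norm_eq_abs, abs_of_nonneg hs0]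
          gcongr
          exact hRρ z hz
        · exact hpC ε hε z (hsub hz)
      have hrem := norm_even_remainder_le hρ hHd hHM hvρ
      have hH2 := iteratedDeriv_two_cexp_mul (R := R) (q := p ε) (s := s)
        (hRd.analyticAt hn) ((hp ε hε).analyticAt hn) hR0
      have hJv : ∀ w : ℝ, w ^ 2 = v ^ 2 → |w| < δ →
          J ε w = Complex.exp (-(a / 2 / ε) * v ^ 2) * H w := by
        intro w hwv hw
        rw [hJ ε hε w hw, hTφ]
        simp only [hH]
        rw [← mul_assoc, ← Complex.exp_add]
        congr 2
        simp only [hR, hs]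
        have : (w : ℂ) ^ 2 = v ^ 2 := by exact_mod_cast hwv
        rw [this]
        push_cast
        field_simp
        ring
      have hJ1 := hJv v rfl (by linarith)
      have hJ2 := hJv (-v) (by ring) (by rw [abs_neg]; linarith)
      have hH0 : H 0 = p ε 0 := by simp [hH, hR0]
      have hid : (J ε v + J ε (-v)) / 2 - laplaceMain a ε (p ε 0) (c2 ε) (c4 ε) (c6 ε) v =
          Complex.exp (-(a / 2 / ε) * v ^ 2) * ((H v + H (-v) - 2 * H 0 -
            iteratedDeriv 2 H 0 * v ^ 2) / 2) := by
        rw [hJ1, hJ2, hH2, hH0]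
        simp only [laplaceMain, hc2, hc4, hc6, hs]
        push_cast
        field_simp
        ring
      rw [hid, norm_mul, norm_div, Complex.norm_exp, Complex.norm_ofNat]
      have hre : (-((a : ℂ) / 2 / ε) * v ^ 2).re = -(a / 2 / ε) * v ^ 2 := by
        rw [← Complex.ofReal_re (-(a / 2 / ε) * v ^ 2)]
        push_cast
        rfl
      rw [hre]
      have hexp : Real.exp (-(a / 2 / ε) * v ^ 2) * Real.exp (s * (a / 4)) =
          Real.exp (-(a / 4 / ε) * v ^ 2) := by
        rw [← Real.exp_add]
        congr 1
        rw [hs]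
        field_simp
        ring
      have hrem' : Real.exp (-(a / 2 / ε) * v ^ 2) * (‖H v + H (-v) - 2 * H 0 -
          iteratedDeriv 2 H 0 * v ^ 2‖ / 2) ≤
          6 * C / ρ ^ 4 * (v ^ 4 * Real.exp (-(a / 4 / ε) * v ^ 2)) := by
        rw [← hexp]
        have hv4' : ‖(v : ℂ)‖ ^ 4 = v ^ 4 := by
          rw [Complex.norm_real, Real.norm_eq_abs]
          exact Even.pow_abs (by decide) v
        calc _ ≤ Real.exp (-(a / 2 / ε) * v ^ 2) *
              (12 * (Real.exp (s * (a / 4)) * C) * (‖(v : ℂ)‖ / ρ) ^ 4 / 2) := by gcongr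
          _ = _ := by rw [div_pow, hv4']; ring
      refine hrem'.trans ?_
      have h16 : 0 ≤ 16 * K / ρ ^ 4 := by positivity
      have hE4 : 0 ≤ v ^ 4 * Real.exp (-(a / 4 / ε) * v ^ 2) := by positivity
      have hE6 : 0 ≤ v ^ 6 * Real.exp (-(a / 4 / ε) * v ^ 2) := by positivity
      have hE8 : 0 ≤ 1 / ε * (v ^ 8 * Real.exp (-(a / 4 / ε) * v ^ 2)) := by positivity
      have hE10 : 0 ≤ 1 / ε ^ 2 * (v ^ 10 * Real.exp (-(a / 4 / ε) * v ^ 2)) := by positivity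
      have hBB : 0 ≤ |B| * Real.exp (-η / ε) * (1 + v ^ 2)⁻¹ := by positivity
      calc 6 * C / ρ ^ 4 * (v ^ 4 * Real.exp (-(a / 4 / ε) * v ^ 2))
          ≤ L * (v ^ 4 * Real.exp (-(a / 4 / ε) * v ^ 2)) := by gcongr; linarith
        _ ≤ L * (v ^ 4 * Real.exp (-(a / 4 / ε) * v ^ 2) + v ^ 6 * Real.exp (-(a / 4 / ε) * v ^ 2)
          + 1 / ε * (v ^ 8 * Real.exp (-(a / 4 / ε) * v ^ 2))
          + 1 / ε ^ 2 * (v ^ 10 * Real.exp (-(a / 4 / ε) * v ^ 2))) := by gcongr; linarith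
        _ ≤ _ := by linarith
    · have hBv := hB ε hε v hv
      have hBv' := hB ε hε (-v) (by rwa [abs_neg])
      rw [neg_sq] at hBv'
      have hBle : B * Real.exp (-η / ε) * (1 + v ^ 2)⁻¹ ≤
          |B| * Real.exp (-η / ε) * (1 + v ^ 2)⁻¹ := by
        gcongr
        exact le_abs_self B
      have hJJ : ‖(J ε v + J ε (-v)) / 2‖ ≤ |B| * Real.exp (-η / ε) * (1 + v ^ 2)⁻¹ := by
        rw [norm_div, Complex.norm_ofNat]
        have := norm_add_le (J ε v) (J ε (-v))
        linarith
      -- Far from the origin the Gaussian approximation is multiplied by this factor, which raises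
      -- its powers of `v` to those in the error bound.
      have hone : 1 ≤ 16 / ρ ^ 4 * v ^ 4 := by
        have h4 : (ρ / 2) ^ 4 ≤ |v| ^ 4 := by gcongr
        rw [Even.pow_abs (by decide) v] at h4
        rw [div_mul_eq_mul_div, le_div_iff₀ (by positivity)]
        nlinarith
      have hmainle := norm_laplaceMain_le ha hpos ((hp0K ε hε).trans (by linarith)) (hc2K ε hε)
        (hc4K ε hε) (hc6K ε hε) v
      have hmainle' : ‖laplaceMain a ε (p ε 0) (c2 ε) (c4 ε) (c6 ε) v‖ ≤
          L * (v ^ 4 * Real.exp (-(a / 4 / ε) * v ^ 2) + v ^ 6 * Real.exp (-(a / 4 / ε) * v ^ 2)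
          + 1 / ε * (v ^ 8 * Real.exp (-(a / 4 / ε) * v ^ 2))
          + 1 / ε ^ 2 * (v ^ 10 * Real.exp (-(a / 4 / ε) * v ^ 2))) := by
        have h6C : 0 ≤ 6 * C / ρ ^ 4 := by positivity
        calc _ ≤ _ := hmainle
          _ ≤ (16 / ρ ^ 4 * v ^ 4) * (K * (1 + v ^ 2 + 1 / ε * v ^ 4 + 1 / ε ^ 2 * v ^ 6) *
            Real.exp (-(a / 4 / ε) * v ^ 2)) := le_mul_of_one_le_left (by positivity) hone
          _ = 16 * K / ρ ^ 4 * (v ^ 4 * Real.exp (-(a / 4 / ε) * v ^ 2)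
            + v ^ 6 * Real.exp (-(a / 4 / ε) * v ^ 2)
            + 1 / ε * (v ^ 8 * Real.exp (-(a / 4 / ε) * v ^ 2))
            + 1 / ε ^ 2 * (v ^ 10 * Real.exp (-(a / 4 / ε) * v ^ 2))) := by ring
          _ ≤ _ := by gcongr; linarith
      calc _ ≤ ‖(J ε v + J ε (-v)) / 2‖ +
            ‖laplaceMain a ε (p ε 0) (c2 ε) (c4 ε) (c6 ε) v‖ := norm_sub_le _ _
        _ ≤ _ := by linarith
  set b := a / 4 with hb
  have hb0 : 0 < b := by positivity
  refine IsBigO.of_bound (L * Real.sqrt (Real.pi / b) * (3 / (2 * b) ^ 2 + 15 / (2 * b) ^ 3 +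
    105 / (2 * b) ^ 4 + 945 / (2 * b) ^ 5) + |B| * (6 / η ^ 3) * Real.pi) ?_
  filter_upwards [Ioo_mem_nhdsGT (lt_min hε₁ one_pos)] with ε hε
  have hε1 : ε ∈ Ioo 0 ε₁ := ⟨hε.1, hε.2.trans_le (min_le_left _ _)⟩
  have hεone : ε < 1 := hε.2.trans_le (min_le_right _ _)
  have hpos := hε.1
  have hJi := hJint ε hε1
  have hJi' : Integrable fun v => J ε (-v) := hJi.comp_neg
  -- Symmetrizing removes the odd terms, which would otherwise contribute at intermediate orders to
  -- the pointwise error.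
  have hsym : ∫ v, J ε v = ∫ v, (J ε v + J ε (-v)) / 2 := by
    rw [integral_div, integral_add hJi hJi', integral_neg_eq_self (fun v => J ε v)]
    ring
  have hmain := integral_laplaceMain ha hpos (p ε 0) (c2 ε) (c4 ε) (c6 ε)
  have hmaini := integrable_laplaceMain ha hpos (p ε 0) (c2 ε) (c4 ε) (c6 ε)
  have haC : (a : ℂ) ≠ 0 := by exact_mod_cast ha.ne'
  have hformula : p ε 0 + (ε : ℂ) * (p ε 0 * (iteratedDeriv 4 φ 0 / (8 * a ^ 2) +
          5 * iteratedDeriv 3 φ 0 ^ 2 / (24 * a ^ 3))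
        + deriv (p ε) 0 * iteratedDeriv 3 φ 0 / (2 * a ^ 2)
        + iteratedDeriv 2 (p ε) 0 / (2 * a)) =
      p ε 0 + ε * (c2 ε / a + 3 * c4 ε / a ^ 2 + 15 * c6 ε / a ^ 3) := by
    simp only [hc2, hc4, hc6]
    rw [hR1, hR2]
    field_simp
    ring
  have hJs : Integrable fun v => (J ε v + J ε (-v)) / 2 := (hJi.add hJi').div_const 2
  rw [hformula, ← hmain, hsym, ← integral_sub hJs hmaini]
  obtain ⟨hgi, hgle⟩ := integral_gaussian_error_le (B := |B|) hL0 (abs_nonneg B) hη hb0 hpos hεone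
  refine (norm_integral_le_of_norm_le hgi
    (Eventually.of_forall fun v => hpoint ε hε1 v)).trans (hgle.trans (le_of_eq ?_))
  rw [Real.norm_eq_abs, abs_of_nonneg (show 0 ≤ ε ^ 2 * Real.sqrt ε by positivity)]

/-! ### Fourier inversion for the payoffs. -/

theorem norm_inv_mul_le {a b m : ℝ} (hm : 0 < m) (hm1 : m ≤ 1) (ha : m ≤ |a|) (hb : m ≤ |b|)
    (v : ℝ) : ‖(((a : ℂ) + v * Complex.I) * (b + v * Complex.I))⁻¹‖ ≤ (m ^ 2)⁻¹ * (1 + v ^ 2)⁻¹ := by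
  have key : ∀ c : ℝ, m ≤ |c| → m * Real.sqrt (1 + v ^ 2) ≤ ‖(c : ℂ) + v * Complex.I‖ := by
    intro c hc
    rw [Complex.norm_add_mul_I]
    refine Real.le_sqrt_of_sq_le ?_
    rw [mul_pow, Real.sq_sqrt (by positivity)]
    have h1 : m ^ 2 ≤ c ^ 2 := by rw [← sq_abs c]; gcongr
    have h2 : m ^ 2 ≤ 1 := pow_le_one₀ hm.le hm1
    nlinarith [sq_nonneg v]
  rw [norm_inv, norm_mul, ← mul_inv]
  refine inv_anti₀ (by positivity) ?_
  calc m ^ 2 * (1 + v ^ 2) = (m * Real.sqrt (1 + v ^ 2)) * (m * Real.sqrt (1 + v ^ 2)) := by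
        rw [mul_mul_mul_comm, Real.mul_self_sqrt (by positivity)]
        ring
    _ ≤ _ := by
        gcongr
        · exact key a ha
        · exact key b hb

theorem continuous_inv_mul {a b : ℝ} (ha : a ≠ 0) (hb : b ≠ 0) :
    Continuous fun v : ℝ => (((a : ℂ) + v * Complex.I) * (b + v * Complex.I))⁻¹ := by
  have key : ∀ c : ℝ, c ≠ 0 → ∀ v : ℝ, (c : ℂ) + v * Complex.I ≠ 0 := by
    intro c hc v h
    have := congrArg Complex.re h
    simp at this
    exact hc this
  exact Continuous.inv₀ (by fun_prop) fun v => mul_ne_zero (key a ha v) (key b hb v)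

theorem integrable_inv_mul {a b : ℝ} (ha : a ≠ 0) (hb : b ≠ 0) :
    Integrable fun v : ℝ => (((a : ℂ) + v * Complex.I) * (b + v * Complex.I))⁻¹ := by
  have hm : 0 < min 1 (min |a| |b|) :=
    lt_min one_pos (lt_min (abs_pos.2 ha) (abs_pos.2 hb))
  refine Integrable.mono' (integrable_inv_one_add_sq.const_mul ((min 1 (min |a| |b|)) ^ 2)⁻¹)
    (continuous_inv_mul ha hb).aestronglyMeasurable (Eventually.of_forall fun v => ?_)
  exact norm_inv_mul_le hm (min_le_left _ _) ((min_le_right _ _).trans (min_le_left _ _))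
    ((min_le_right _ _).trans (min_le_right _ _)) v

/-- Inversion of the damped Fourier transform `v ↦ ((β + iv)(β - 1 + iv))⁻¹`. -/
theorem eq_integral_of_fourier_transform {h : ℝ → ℝ} (hc : Continuous h) {β : ℝ} (hβ : β ≠ 0)
    (hβ1 : β - 1 ≠ 0) (hi : Integrable fun x => h x * Real.exp (-β * x))
    (hF : ∀ v : ℝ, ∫ x : ℝ, Complex.exp (-(β + v * Complex.I) * x) * (h x : ℂ) =
      (((β : ℂ) + v * Complex.I) * ((β - 1 : ℝ) + v * Complex.I))⁻¹) (x : ℝ) :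
    (h x : ℂ) = (2 * Real.pi)⁻¹ * ∫ v : ℝ, Complex.exp ((β + v * Complex.I) * x) *
      (((β : ℂ) + v * Complex.I) * ((β - 1 : ℝ) + v * Complex.I))⁻¹ := by
  set G : ℝ → ℂ := fun v => (((β : ℂ) + v * Complex.I) * ((β - 1 : ℝ) + v * Complex.I))⁻¹ with hG
  set f : ℝ → ℂ := fun x => ((h x * Real.exp (-β * x) : ℝ) : ℂ) with hf
  have hpi : (2 * Real.pi) ≠ 0 := by positivity
  have hfF : FourierTransform.fourier f = fun w : ℝ => G (2 * Real.pi * w) := by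
    funext w
    rw [Real.fourier_real_eq_integral_exp_smul]
    simp only [hG]
    rw [← hF]
    refine integral_congr_ae (Eventually.of_forall fun y => ?_)
    simp only [hf, smul_eq_mul]
    push_cast
    rw [mul_comm (h y : ℂ), ← mul_assoc, ← Complex.exp_add]
    congr 2
    ring
  have hGi : Integrable G := integrable_inv_mul hβ hβ1
  have hinv := (Continuous.fourierInv_fourier_eq (f := f) (by fun_prop) hi.ofReal
    (by rw [hfF]; exact hGi.comp_mul_left' hpi))
  have hx := congrFun hinv x
  rw [hfF, Real.fourierInv_eq'] at hx
  have hx2 : f x = ((2 * Real.pi)⁻¹ : ℝ) * ∫ v : ℝ, Complex.exp (v * x * Complex.I) * G v := by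
    rw [← hx]
    have := Measure.integral_comp_mul_left
      (g := fun v : ℝ => Complex.exp (v * x * Complex.I) * G v) (2 * Real.pi)
    rw [abs_of_pos (by positivity), Complex.real_smul] at this
    rw [← this]
    refine integral_congr_ae (Eventually.of_forall fun w => ?_)
    simp only [smul_eq_mul]
    congr 2
    rw [real_inner_eq_re_inner]
    simp
    ring
  have hhx : (h x : ℂ) = Complex.exp (β * x) * f x := by
    simp only [hf]
    push_cast
    rw [mul_left_comm, ← Complex.exp_add]
    simp
  rw [hhx, hx2, mul_left_comm, ← integral_const_mul]
  congr 1
  refine integral_congr_ae (Eventually.of_forall fun v => ?_)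
  simp only
  rw [← mul_assoc, ← Complex.exp_add]
  congr 2
  ring

/-- The two exponentials on `x > 0` are integrable exactly to the right of the poles `0` and `1` of
the transform. -/
theorem call_fourier_transform {β : ℝ} (hβ : 1 < β) :
    (Integrable fun x : ℝ => max (Real.exp x - 1) 0 * Real.exp (-β * x)) ∧
    ∀ v : ℝ, ∫ x : ℝ, Complex.exp (-(β + v * Complex.I) * x) * (max (Real.exp x - 1) 0 : ℝ) =
      (((β : ℂ) + v * Complex.I) * ((β - 1 : ℝ) + v * Complex.I))⁻¹ := by
  have hformula : ∀ v : ℝ, (fun x : ℝ => Complex.exp (-(β + v * Complex.I) * x) *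
      ((max (Real.exp x - 1) 0 : ℝ) : ℂ)) =
      (Ioi (0 : ℝ)).indicator fun x : ℝ => Complex.exp ((-((β - 1 : ℝ) + v * Complex.I)) * x) -
        Complex.exp (-(β + v * Complex.I) * x) := by
    intro v
    funext x
    by_cases hx : 0 < x
    · rw [indicator_of_mem (mem_Ioi.2 hx), max_eq_left (by linarith [Real.add_one_le_exp x])]
      push_cast
      rw [mul_sub, ← Complex.exp_add, mul_one]
      congr 2
      ring
    · rw [indicator_of_notMem (by simpa using hx), max_eq_right (by
        have := Real.exp_le_one_iff.2 (not_lt.1 hx)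
        linarith)]
      simp
  have hre : ∀ (c v : ℝ), (-((c : ℂ) + v * Complex.I)).re = -c := by intro c v; simp
  have hi1 : ∀ v : ℝ, IntegrableOn (fun x : ℝ =>
      Complex.exp ((-((β - 1 : ℝ) + v * Complex.I)) * x)) (Ioi 0) := fun v =>
    integrableOn_exp_mul_complex_Ioi (by rw [hre]; linarith) 0
  have hi2 : ∀ v : ℝ, IntegrableOn (fun x : ℝ =>
      Complex.exp ((-(β + v * Complex.I)) * x)) (Ioi 0) := fun v =>
    integrableOn_exp_mul_complex_Ioi (by rw [hre]; linarith) 0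
  constructor
  · have h0 : Integrable (fun x : ℝ => Complex.exp (-(β + (0 : ℝ) * Complex.I) * x) *
        ((max (Real.exp x - 1) 0 : ℝ) : ℂ)) := by
      rw [hformula 0, integrable_indicator_iff measurableSet_Ioi]
      exact (hi1 0).sub (hi2 0)
    refine h0.re.congr (Eventually.of_forall fun x => ?_)
    simp only [Complex.ofReal_zero, zero_mul, add_zero]
    rw [mul_comm, ← Complex.ofReal_neg, ← Complex.ofReal_mul, ← Complex.ofReal_exp,
      ← Complex.ofReal_mul]
    exact Complex.ofReal_re _
  · intro v
    rw [hformula v, integral_indicator measurableSet_Ioi, integral_sub (hi1 v) (hi2 v),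
      integral_exp_mul_complex_Ioi (by rw [hre]; linarith),
      integral_exp_mul_complex_Ioi (by rw [hre]; linarith)]
    have hne : ∀ c : ℝ, c ≠ 0 → (c : ℂ) + v * Complex.I ≠ 0 := by
      intro c hc h
      have := congrArg Complex.re h
      simp at this
      exact hc this
    have h1 := hne β (by linarith)
    have h2 := hne (β - 1) (by linarith)
    simp only [Complex.ofReal_zero, mul_zero, Complex.exp_zero]
    rw [neg_div_neg_eq, neg_div_neg_eq]
    field_simp
    push_cast
    ring

/-- The same rational function as for the call, now to the left of both poles. -/
theorem put_fourier_transform {β : ℝ} (hβ : β < 0) :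
    (Integrable fun x : ℝ => max (1 - Real.exp x) 0 * Real.exp (-β * x)) ∧
    ∀ v : ℝ, ∫ x : ℝ, Complex.exp (-(β + v * Complex.I) * x) * (max (1 - Real.exp x) 0 : ℝ) =
      (((β : ℂ) + v * Complex.I) * ((β - 1 : ℝ) + v * Complex.I))⁻¹ := by
  have hformula : ∀ v : ℝ, (fun x : ℝ => Complex.exp (-(β + v * Complex.I) * x) *
      ((max (1 - Real.exp x) 0 : ℝ) : ℂ)) =
      (Iic (0 : ℝ)).indicator fun x : ℝ => Complex.exp (-(β + v * Complex.I) * x) -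
        Complex.exp ((-((β - 1 : ℝ) + v * Complex.I)) * x) := by
    intro v
    funext x
    by_cases hx : x ≤ 0
    · rw [indicator_of_mem (mem_Iic.2 hx), max_eq_left (by
        have := Real.exp_le_one_iff.2 hx
        linarith)]
      push_cast
      rw [mul_sub, ← Complex.exp_add, mul_one]
      congr 2
      ring
    · rw [indicator_of_notMem (by simpa using hx), max_eq_right (by
        linarith [Real.add_one_le_exp x])]
      simp
  have hre : ∀ (c v : ℝ), (-((c : ℂ) + v * Complex.I)).re = -c := by intro c v; simp
  have hi1 : ∀ v : ℝ, IntegrableOn (fun x : ℝ =>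
      Complex.exp ((-((β - 1 : ℝ) + v * Complex.I)) * x)) (Iic 0) := fun v =>
    integrableOn_exp_mul_complex_Iic (by rw [hre]; linarith) 0
  have hi2 : ∀ v : ℝ, IntegrableOn (fun x : ℝ =>
      Complex.exp ((-(β + v * Complex.I)) * x)) (Iic 0) := fun v =>
    integrableOn_exp_mul_complex_Iic (by rw [hre]; linarith) 0
  constructor
  · have h0 : Integrable (fun x : ℝ => Complex.exp (-(β + (0 : ℝ) * Complex.I) * x) *
        ((max (1 - Real.exp x) 0 : ℝ) : ℂ)) := by
      rw [hformula 0, integrable_indicator_iff measurableSet_Iic]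
      exact (hi2 0).sub (hi1 0)
    refine h0.re.congr (Eventually.of_forall fun x => ?_)
    simp only [Complex.ofReal_zero, zero_mul, add_zero]
    rw [mul_comm, ← Complex.ofReal_neg, ← Complex.ofReal_mul, ← Complex.ofReal_exp,
      ← Complex.ofReal_mul]
    exact Complex.ofReal_re _
  · intro v
    rw [hformula v, integral_indicator measurableSet_Iic, integral_sub (hi2 v) (hi1 v),
      integral_exp_mul_complex_Iic (by rw [hre]; linarith),
      integral_exp_mul_complex_Iic (by rw [hre]; linarith)]
    have hne : ∀ c : ℝ, c ≠ 0 → (c : ℂ) + v * Complex.I ≠ 0 := by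
      intro c hc h
      have := congrArg Complex.re h
      simp at this
      exact hc this
    have h1 := hne β (by linarith)
    have h2 := hne (β - 1) (by linarith)
    simp only [Complex.ofReal_zero, mul_zero, Complex.exp_zero]
    rw [div_neg, div_neg]
    field_simp
    push_cast
    ring

/-- Expectation of a payoff as an integral of the complex moment generating function. -/
theorem integral_payoff_eq {Ω : Type*} [MeasurableSpace Ω] {μ : Measure Ω} [IsFiniteMeasure μ]
    {Y : Ω → ℝ} (hY : Measurable Y) {h : ℝ → ℝ} (hc : Continuous h) {β : ℝ} (hβ : β ≠ 0)
    (hβ1 : β - 1 ≠ 0) (hi : Integrable fun x => h x * Real.exp (-β * x))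
    (hF : ∀ v : ℝ, ∫ x : ℝ, Complex.exp (-(β + v * Complex.I) * x) * (h x : ℂ) =
      (((β : ℂ) + v * Complex.I) * ((β - 1 : ℝ) + v * Complex.I))⁻¹)
    (hexp : Integrable (fun w => Real.exp (β * Y w)) μ) (k : ℝ) :
    ((∫ w, h (Y w - k) ∂μ : ℝ) : ℂ) = (2 * Real.pi)⁻¹ * ∫ v : ℝ,
      complexMGF Y μ (β + v * Complex.I) * Complex.exp (-(β + v * Complex.I) * k) *
      (((β : ℂ) + v * Complex.I) * ((β - 1 : ℝ) + v * Complex.I))⁻¹ := by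
  set G : ℝ → ℂ := fun v => (((β : ℂ) + v * Complex.I) * ((β - 1 : ℝ) + v * Complex.I))⁻¹ with hG
  have hGi : Integrable G := integrable_inv_mul hβ hβ1
  have hGc : Continuous G := continuous_inv_mul hβ hβ1
  -- On the line the exponential has modulus `exp(β(Y - k))`, independent of `v`, and the kernel is
  -- integrable in `v`. This justifies Fubini.
  have hprod : Integrable (Function.uncurry fun (w : Ω) (v : ℝ) =>
      Complex.exp ((β + v * Complex.I) * ((Y w - k : ℝ) : ℂ)) * G v) (μ.prod volume) := by
    refine Integrable.mono' (g := fun x : Ω × ℝ => (Real.exp (β * Y x.1) * Real.exp (-β * k)) *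
      ‖G x.2‖) ((hexp.mul_const _).mul_prod hGi.norm) ?_ (Eventually.of_forall fun x => ?_)
    · refine Measurable.aestronglyMeasurable ?_
      simp only [Function.uncurry_def]
      have := hGc.measurable
      fun_prop
    · simp only [Function.uncurry_def]
      rw [norm_mul, Complex.norm_exp, ← Real.exp_add]
      refine le_of_eq ?_
      congr 2
      simp
      ring
  rw [← integral_complex_ofReal]
  simp_rw [eq_integral_of_fourier_transform hc hβ hβ1 hi hF]
  rw [integral_const_mul]
  congr 1
  rw [integral_integral_swap hprod]
  refine integral_congr_ae (Eventually.of_forall fun v => ?_)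
  simp only
  rw [complexMGF, ← integral_mul_const, ← integral_mul_const]
  refine integral_congr_ae (Eventually.of_forall fun w => ?_)
  simp only
  rw [← Complex.exp_add]
  congr 2
  push_cast
  ring

/-- The rescaled inversion formula along the vertical line through `u`. -/
theorem integral_payoff_eq_rescaled {Ω : Type*} [MeasurableSpace Ω] {μ : Measure Ω}
    [IsFiniteMeasure μ]
    {Y : Ω → ℝ} (hY : Measurable Y) {h : ℝ → ℝ} (hc : Continuous h) {u ε : ℝ} (hε : 0 < ε)
    (hu : u ≠ 0) (huε : u - ε ≠ 0) (hi : Integrable fun x => h x * Real.exp (-(u / ε) * x))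
    (hF : ∀ v : ℝ, ∫ x : ℝ, Complex.exp (-((u / ε : ℝ) + v * Complex.I) * x) * (h x : ℂ) =
      (((u / ε : ℝ) + v * Complex.I) * ((u / ε - 1 : ℝ) + v * Complex.I))⁻¹)
    (hexp : Integrable (fun w => Real.exp (u / ε * Y w)) μ) (k : ℝ) :
    ((∫ w, h (Y w - k) ∂μ : ℝ) : ℂ) = ε * (2 * Real.pi)⁻¹ * ∫ v : ℝ,
      complexMGF Y μ ((u + v * Complex.I) / ε) * Complex.exp (-((u + v * Complex.I) / ε) * k) *
      (((u : ℂ) + v * Complex.I) * ((u - ε : ℝ) + v * Complex.I))⁻¹ := by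
  have hεC : (ε : ℂ) ≠ 0 := by exact_mod_cast hε.ne'
  have h1 : u / ε - 1 = (u - ε) / ε := by field_simp
  rw [integral_payoff_eq hY hc (β := u / ε) (div_ne_zero hu hε.ne')
    (by rw [h1]; exact div_ne_zero huε hε.ne') hi hF hexp k]
  have h2 := Measure.integral_comp_mul_left (g := fun v : ℝ =>
    complexMGF Y μ ((u / ε : ℝ) + v * Complex.I) *
      Complex.exp (-((u / ε : ℝ) + v * Complex.I) * k) *
      (((u / ε : ℝ) + v * Complex.I) * ((u / ε - 1 : ℝ) + v * Complex.I))⁻¹) ε⁻¹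
  rw [inv_inv, abs_of_pos hε, Complex.real_smul] at h2
  have h3 : ∀ v : ℝ, ((u / ε : ℝ) : ℂ) + (ε⁻¹ * v : ℝ) * Complex.I =
      (u + v * Complex.I) / ε := by
    intro v; push_cast; field_simp
  have h4 : ∀ v : ℝ, ((u / ε - 1 : ℝ) : ℂ) + (ε⁻¹ * v : ℝ) * Complex.I =
      ((u - ε : ℝ) + v * Complex.I) / ε := by
    intro v; push_cast; field_simp
  simp_rw [h3, h4] at h2
  -- The kernel yields `ε²` and the change of variables takes one power back, leaving the prefactor
  -- `ε`.
  have h5 : ∀ v : ℝ, ((((u : ℂ) + v * Complex.I) / ε) * (((u - ε : ℝ) + v * Complex.I) / ε))⁻¹ =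
      ε ^ 2 * (((u : ℂ) + v * Complex.I) * ((u - ε : ℝ) + v * Complex.I))⁻¹ := by
    intro v
    rw [div_mul_div_comm, inv_div, div_eq_mul_inv, sq]
  simp_rw [h5] at h2
  have h6 : ∀ v : ℝ, complexMGF Y μ ((u + v * Complex.I) / ε) *
      Complex.exp (-((u + v * Complex.I) / ε) * k) *
      (ε ^ 2 * (((u : ℂ) + v * Complex.I) * ((u - ε : ℝ) + v * Complex.I))⁻¹) =
      ε ^ 2 * (complexMGF Y μ ((u + v * Complex.I) / ε) *
      Complex.exp (-((u + v * Complex.I) / ε) * k) *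
      (((u : ℂ) + v * Complex.I) * ((u - ε : ℝ) + v * Complex.I))⁻¹) := by
    intro v; ring
  simp_rw [h6] at h2
  rw [integral_const_mul] at h2
  have h7 : ∀ A B : ℂ, (ε : ℂ) ^ 2 * A = ε * B → B = ε * A := by
    intro A B h
    refine mul_left_cancel₀ hεC ?_
    rw [← h]
    ring
  rw [h7 _ _ h2]
  ring

/-! ### Convexity and existence of saddlepoints. -/

/-- A strictly convex function lies strictly above its tangent lines. -/
theorem StrictConvexOn.tangent_lt {f : ℝ → ℝ} {S : Set ℝ} {u v : ℝ} (hf : StrictConvexOn ℝ S f)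
    (hu : u ∈ S) (hv : v ∈ S) (hd : DifferentiableAt ℝ f u) (hvu : v ≠ u) :
    f u + deriv f u * (v - u) < f v := by
  rcases lt_or_gt_of_ne hvu with h | h
  · have h1 := hf.slope_lt_of_hasDerivAt hv hu h hd.hasDerivAt
    rw [slope_def_field, div_lt_iff₀ (by linarith)] at h1
    linarith
  · have h1 := hf.lt_slope_of_hasDerivAt hu hv h hd.hasDerivAt
    rw [slope_def_field, lt_div_iff₀ (by linarith)] at h1
    linarith

theorem FwdStart.legendre_eq {Λ₀ : ℝ → ℝ} {S : Set ℝ} {k u : ℝ} (hf : StrictConvexOn ℝ S Λ₀)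
    (hd : DifferentiableAt ℝ Λ₀ u) (hu : FwdStart.IsSaddlepoint Λ₀ S k u) :
    FwdStart.legendre Λ₀ S k = u * k - Λ₀ u := by
  refine IsGreatest.csSup_eq ⟨⟨u, hu.1, rfl⟩, ?_⟩
  rintro _ ⟨v, hv, rfl⟩
  rcases eq_or_ne v u with rfl | hvu
  · exact le_rfl
  · have := hf.tangent_lt hu.1 hv hd hvu
    rw [hu.2] at this
    show v * k - Λ₀ v ≤ u * k - Λ₀ u
    linarith

theorem exists_saddlepoint_of_bddAbove {f : ℝ → ℝ} {S : Set ℝ} (hS : IsOpen S)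
    (hf : StrictConvexOn ℝ S f) (hs : FwdStart.EssentiallySmoothOn f S) (h0 : (0 : ℝ) ∈ S)
    (hb : BddAbove S) {k : ℝ} (hk : deriv f 0 < k) : ∃ u, FwdStart.IsSaddlepoint f S k u := by
  have hd : ∀ x ∈ S, DifferentiableAt ℝ f x := fun x hx =>
    (hs.differentiable x hx).differentiableAt (hS.mem_nhds hx)
  have hmono := (hf.strictMonoOn_deriv hd).monotoneOn
  have hcl : sSup S ∈ closure S := csSup_mem_closure ⟨0, h0⟩ hb
  have hnot : sSup S ∉ S := fun hmem => by
    obtain ⟨η, hη, hball⟩ := Metric.isOpen_iff.1 hS _ hmem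
    have : sSup S + η / 2 ∈ S := hball (by
      rw [Metric.mem_ball, Real.dist_eq, add_sub_cancel_left, abs_of_pos (by linarith)]; linarith)
    linarith [le_csSup hb this]
  have hpos : 0 < sSup S := lt_of_le_of_ne (le_csSup hb h0) (fun h => hnot (h ▸ h0))
  have hsteep := hs.steep (sSup S) (by rw [hS.frontier_eq]; exact ⟨hcl, hnot⟩)
  have := mem_closure_iff_nhdsWithin_neBot.1 hcl
  have hpos' : ∀ᶠ v in 𝓝[S] sSup S, 0 < v :=
    (lt_mem_nhds hpos).filter_mono nhdsWithin_le_nhds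
  obtain ⟨v, ⟨hv1, hv2⟩, hvS⟩ :=
    (((hsteep.eventually_gt_atTop (|k| + |deriv f 0|)).and hpos').and
      (self_mem_nhdsWithin : ∀ᶠ v in 𝓝[S] sSup S, v ∈ S)).exists
  have h1 := hmono h0 hvS hv2.le
  -- Monotonicity gives `f'(v) ≥ f'(0)`, so a large `|f'(v)|` can only mean a large positive
  -- `f'(v)`.
  have h2 : k ≤ deriv f v := by
    rcases le_total 0 (deriv f v) with h | h
    · rw [abs_of_nonneg h] at hv1
      linarith [le_abs_self k, abs_nonneg (deriv f 0)]
    · rw [abs_of_nonpos h] at hv1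
      linarith [abs_nonneg k, neg_abs_le (deriv f 0)]
  -- Darboux's theorem: continuity of the derivative is not needed.
  obtain ⟨u, hu, hku⟩ := (hf.1.ordConnected.image_deriv hd).out ⟨0, h0, rfl⟩ ⟨v, hvS, rfl⟩
    ⟨hk.le, h2⟩
  exact ⟨u, hu, hku⟩

theorem exists_saddlepoint_of_bddBelow {f : ℝ → ℝ} {S : Set ℝ} (hS : IsOpen S)
    (hf : StrictConvexOn ℝ S f) (hs : FwdStart.EssentiallySmoothOn f S) (h0 : (0 : ℝ) ∈ S)
    (hb : BddBelow S) {k : ℝ} (hk : k < deriv f 0) : ∃ u, FwdStart.IsSaddlepoint f S k u := by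
  have hd : ∀ x ∈ S, DifferentiableAt ℝ f x := fun x hx =>
    (hs.differentiable x hx).differentiableAt (hS.mem_nhds hx)
  have hmono := (hf.strictMonoOn_deriv hd).monotoneOn
  have hcl : sInf S ∈ closure S := csInf_mem_closure ⟨0, h0⟩ hb
  have hnot : sInf S ∉ S := fun hmem => by
    obtain ⟨η, hη, hball⟩ := Metric.isOpen_iff.1 hS _ hmem
    have : sInf S - η / 2 ∈ S := hball (by
      rw [Metric.mem_ball, Real.dist_eq, sub_sub_cancel_left, abs_neg, abs_of_pos (by linarith)]
      linarith)
    linarith [csInf_le hb this]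
  have hneg : sInf S < 0 := lt_of_le_of_ne (csInf_le hb h0) (fun h => hnot (h ▸ h0))
  have hsteep := hs.steep (sInf S) (by rw [hS.frontier_eq]; exact ⟨hcl, hnot⟩)
  have := mem_closure_iff_nhdsWithin_neBot.1 hcl
  have hneg' : ∀ᶠ v in 𝓝[S] sInf S, v < 0 :=
    (gt_mem_nhds hneg).filter_mono nhdsWithin_le_nhds
  obtain ⟨v, ⟨hv1, hv2⟩, hvS⟩ :=
    (((hsteep.eventually_gt_atTop (|k| + |deriv f 0|)).and hneg').and
      (self_mem_nhdsWithin : ∀ᶠ v in 𝓝[S] sInf S, v ∈ S)).exists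
  have h1 := hmono hvS h0 hv2.le
  have h2 : deriv f v ≤ k := by
    rcases le_total 0 (deriv f v) with h | h
    · rw [abs_of_nonneg h] at hv1
      linarith [abs_nonneg k, le_abs_self (deriv f 0)]
    · rw [abs_of_nonpos h] at hv1
      linarith [neg_abs_le k, abs_nonneg (deriv f 0)]
  obtain ⟨u, hu, hku⟩ := (hf.1.ordConnected.image_deriv hd).out ⟨v, hvS, rfl⟩ ⟨0, h0, rfl⟩
    ⟨h2, hk.le⟩
  exact ⟨u, hu, hku⟩

/-! ### Real and complex derivatives, and positivity of the second derivative. -/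

/-- A holomorphic function which is real on the real axis has the same derivatives as its
restriction. -/
theorem eventually_iteratedDeriv_eq_ofReal {f : ℂ → ℂ} {g : ℝ → ℝ} {u : ℝ}
    (hf : AnalyticAt ℂ f u) (h : ∀ᶠ x : ℝ in 𝓝 u, f x = g x) (n : ℕ) :
    ∀ᶠ x : ℝ in 𝓝 u, iteratedDeriv n f x = (iteratedDeriv n g x : ℝ) := by
  induction n with
  | zero => simpa using h
  | succ n ih =>
    have hfn : AnalyticAt ℂ (iteratedDeriv n f) u := by
      rw [iteratedDeriv_eq_iterate]
      exact hf.iterated_deriv n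
    have han : ∀ᶠ x : ℝ in 𝓝 u, AnalyticAt ℂ (iteratedDeriv n f) x :=
      (Complex.continuous_ofReal.tendsto u).eventually hfn.eventually_analyticAt
    filter_upwards [ih.eventually_nhds, han] with x hx hax
    rw [iteratedDeriv_succ, iteratedDeriv_succ]
    have hD := hax.differentiableAt.hasDerivAt
    have h1 : HasDerivAt (fun y : ℝ => ((iteratedDeriv n g y : ℝ) : ℂ))
        (deriv (iteratedDeriv n f) x) x :=
      hD.comp_ofReal.congr_of_eventuallyEq (hx.mono fun y hy => hy.symm)
    have h2 : HasDerivAt (iteratedDeriv n g) (deriv (iteratedDeriv n f) x).re x :=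
      hD.real_of_complex.congr_of_eventuallyEq (hx.mono fun y hy => by
        simp only [hy, Complex.ofReal_re])
    rw [h2.deriv]
    exact h1.unique h2.ofReal_comp

theorem contDiffAt_of_eq_analyticAt {f : ℂ → ℂ} {g : ℝ → ℝ} {u : ℝ}
    (hf : AnalyticAt ℂ f u) (h : ∀ᶠ x : ℝ in 𝓝 u, f x = g x) : ContDiffAt ℝ (⊤ : ℕ∞) g u := by
  have h1 : ContDiffAt ℝ (⊤ : ℕ∞) (fun x : ℝ => (f x).re) u :=
    (hf.contDiffAt (n := (⊤ : ℕ∞))).real_of_complex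
  exact h1.congr_of_eventuallyEq (h.mono fun y hy => by simp only [hy, Complex.ofReal_re])

theorem iteratedDeriv_comp_add_mul (f : ℂ → ℂ) (a b : ℂ) (n : ℕ) :
    iteratedDeriv n (fun z => f (a + b * z)) = fun z => b ^ n * iteratedDeriv n f (a + b * z) := by
  induction n with
  | zero => simp
  | succ n ih =>
    rw [iteratedDeriv_succ, ih]
    funext z
    have h1 : deriv (fun z => iteratedDeriv n f (a + b * z)) z =
        b * deriv (iteratedDeriv n f) (a + b * z) := by
      have := deriv_comp_mul_left b (fun w => iteratedDeriv n f (a + w)) z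
      rw [this, deriv_comp_const_add, smul_eq_mul]
    rw [deriv_const_mul_field, h1, iteratedDeriv_succ]
    ring

/-- A holomorphic function whose real part is maximal, on each vertical line, at the real point, and
which is positive off the origin on the reals, vanishes to order exactly two. -/
theorem iteratedDeriv_two_re_pos {f : ℂ → ℂ} (hf : AnalyticAt ℂ f 0) (h0 : f 0 = 0)
    (h1 : deriv f 0 = 0) (hle : ∀ᶠ z : ℂ in 𝓝 0, (f z).re ≤ (f z.re).re)
    (hpos : ∀ᶠ x : ℝ in 𝓝[>] 0, 0 < (f x).re ∧ (f x).im = 0) :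
    0 < (iteratedDeriv 2 f 0).re := by
  have hcast : Tendsto (fun x : ℝ => (x : ℂ)) (𝓝[>] 0) (𝓝 0) :=
    (Complex.continuous_ofReal.tendsto 0).mono_left nhdsWithin_le_nhds
  have hne : ¬ ∀ᶠ z in 𝓝 (0 : ℂ), f z = 0 := by
    intro hz
    obtain ⟨x, hx1, hx2⟩ := ((hcast.eventually hz).and hpos).exists
    rw [hx1] at hx2
    simp at hx2
  -- Near `0`, `f = z^m g` with `g 0 ≠ 0`. Positivity on the positive reals makes `g 0` real and
  -- positive, and it remains to show `m = 2`.
  obtain ⟨m, g, hg, hg0, hfg⟩ := hf.exists_eventuallyEq_pow_smul_nonzero_iff.2 hne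
  simp only [sub_zero, smul_eq_mul] at hfg
  have hgc : Tendsto g (𝓝 0) (𝓝 (g 0)) := hg.continuousAt
  have hgpos : ∀ᶠ x : ℝ in 𝓝[>] 0, 0 < (g x).re ∧ (g x).im = 0 := by
    filter_upwards [hcast.eventually hfg, hpos, self_mem_nhdsWithin] with x hx hx2 hx0
    rw [hx, ← Complex.ofReal_pow, Complex.re_ofReal_mul, Complex.im_ofReal_mul] at hx2
    have hxm : 0 < x ^ m := pow_pos hx0 m
    exact ⟨(mul_pos_iff_of_pos_left hxm).1 hx2.1, (mul_eq_zero_iff_left hxm.ne').1 hx2.2⟩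
  have hgre : 0 ≤ (g 0).re :=
    ge_of_tendsto ((Complex.continuous_re.tendsto _).comp (hgc.comp hcast))
      (hgpos.mono fun x hx => hx.1.le)
  have hgim : (g 0).im = 0 :=
    tendsto_nhds_unique ((Complex.continuous_im.tendsto _).comp (hgc.comp hcast))
      (tendsto_const_nhds.congr' (hgpos.mono fun x hx => hx.2.symm))
  have hgre' : 0 < (g 0).re := by
    refine lt_of_le_of_ne hgre fun h => hg0 ?_
    apply Complex.ext <;> simp [← h, hgim]
  have hgd := hg.differentiableAt.hasDerivAt
  match m, hfg with
  | 0, hfg =>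
    have := hfg.self_of_nhds
    simp [h0] at this
    exact absurd this.symm hg0
  | 1, hfg =>
    have hd := ((hasDerivAt_pow 1 (0 : ℂ)).mul hgd).deriv
    rw [(EventuallyEq.deriv_eq hfg : deriv f 0 = _)] at h1
    rw [show deriv (fun z => z ^ 1 * g z) 0 = _ from hd] at h1
    simp at h1
    exact absurd h1 hg0
  | 2, hfg =>
    have hd : deriv f =ᶠ[𝓝 0] fun z => z * (2 * g z + z * deriv g z) := by
      filter_upwards [(show f =ᶠ[𝓝 0] _ from hfg).deriv, hg.eventually_analyticAt] with z hz hgz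
      rw [hz]
      refine Eq.trans (((hasDerivAt_pow 2 z).mul hgz.differentiableAt.hasDerivAt).deriv) ?_
      simp
      ring
    have hh : DifferentiableAt ℂ (fun z => 2 * g z + z * deriv g z) 0 :=
      (hg.differentiableAt.const_mul 2).add (differentiableAt_id.mul hg.deriv.differentiableAt)
    have hd2 := ((hasDerivAt_id (0 : ℂ)).mul hh.hasDerivAt).deriv
    have e2 : iteratedDeriv 2 f 0 = 2 * g 0 := by
      rw [iteratedDeriv_succ, iteratedDeriv_one, hd.deriv_eq]
      refine Eq.trans hd2 ?_
      simp
    rw [e2]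
    simpa using hgre'
  | m + 3, hfg =>
    exfalso
    -- Along the ray through this root of unity `f` is again about `r^n g(0)`, with `n` the order of
    -- the zero, whereas at the real part `r cos θ` it is about `(r cos θ)^n g(0)`. Order at least
    -- three puts `θ` in `(0, π)`, so `|cos θ| < 1`, against maximality at the real point.
    set θ : ℝ := 2 * Real.pi / (m + 3 : ℕ) with hθ
    set ζ : ℂ := Complex.exp (θ * Complex.I) with hζ
    set c : ℝ := Real.cos θ with hc
    have hζm : ζ ^ (m + 3) = 1 := by
      rw [hζ, ← Complex.exp_nat_mul, ← Complex.exp_two_pi_mul_I]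
      congr 1
      rw [hθ]
      have : ((m + 3 : ℕ) : ℂ) ≠ 0 := by exact_mod_cast (Nat.succ_ne_zero (m + 2))
      push_cast at this ⊢
      field_simp
    have hζre : ∀ r : ℝ, ((r : ℂ) * ζ).re = r * c := by
      intro r
      rw [Complex.re_ofReal_mul, hζ, Complex.exp_ofReal_mul_I_re]
    have hθ0 : 0 < θ := by positivity
    have hθπ : θ < Real.pi := by
      rw [hθ, div_lt_iff₀ (by positivity)]
      push_cast
      nlinarith [Real.pi_pos, Nat.cast_nonneg (α := ℝ) m]
    have hc1 : |c| < 1 := by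
      rw [abs_lt]
      constructor
      · rw [← Real.cos_pi]
        exact Real.cos_lt_cos_of_nonneg_of_le_pi hθ0.le le_rfl hθπ
      · rw [← Real.cos_zero]
        exact Real.cos_lt_cos_of_nonneg_of_le_pi le_rfl hθπ.le hθ0
    have ht1 : Tendsto (fun r : ℝ => (r : ℂ) * ζ) (𝓝[>] 0) (𝓝 0) := by
      simpa using hcast.mul_const ζ
    have ht2 : Tendsto (fun r : ℝ => ((r * c : ℝ) : ℂ)) (𝓝[>] 0) (𝓝 0) := by
      simpa using hcast.mul_const (c : ℂ)
    have hev : ∀ᶠ r : ℝ in 𝓝[>] 0, (g (r * ζ)).re ≤ c ^ (m + 3) * (g (r * c : ℝ)).re := by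
      filter_upwards [ht1.eventually hle, ht1.eventually hfg, ht2.eventually hfg,
        self_mem_nhdsWithin] with r hr1 hr2 hr3 hr0
      rw [hζre, hr2, hr3, mul_pow, hζm, mul_one, ← Complex.ofReal_pow, ← Complex.ofReal_pow,
        Complex.re_ofReal_mul, Complex.re_ofReal_mul, mul_pow, mul_assoc] at hr1
      exact le_of_mul_le_mul_left hr1 (pow_pos hr0 _)
    have hlim := le_of_tendsto_of_tendsto
      ((Complex.continuous_re.tendsto _).comp (hgc.comp ht1))
      (((Complex.continuous_re.tendsto _).comp (hgc.comp ht2)).const_mul (c ^ (m + 3))) hev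
    have hcm : c ^ (m + 3) < 1 :=
      (le_abs_self _).trans_lt (by rw [abs_pow]; exact pow_lt_one₀ (abs_nonneg c) hc1 (by omega))
    nlinarith

/-! ### The moment generating function ratio. -/

/-- Second order expansion of the exponential of an asymptotic expansion. -/
theorem isBigO_exp_expansion {f : ℝ → ℝ} {a b : ℝ}
    (hf : (fun ε => f ε - (a + b * ε)) =O[𝓝[>] 0] fun ε : ℝ => ε ^ 2) :
    (fun ε => Real.exp (f ε) - (Real.exp a + Real.exp a * b * ε)) =O[𝓝[>] 0]
      fun ε : ℝ => ε ^ 2 := by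
  have hid : Tendsto (fun ε : ℝ => ε) (𝓝[>] 0) (𝓝 0) := tendsto_id.mono_left nhdsWithin_le_nhds
  have hε2 : (fun ε : ℝ => ε ^ 2) =O[𝓝[>] 0] fun ε : ℝ => ε := by
    have h := (isLittleO_pow_id (𝕜 := ℝ) (n := 2) (by norm_num)).isBigO
    exact h.mono nhdsWithin_le_nhds
  have hg : (fun ε => f ε - a) =O[𝓝[>] 0] fun ε : ℝ => ε := by
    refine ((hf.trans hε2).add ((isBigO_refl (fun ε : ℝ => ε) _).const_mul_left b)).congr_left
      fun ε => ?_
    ring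
  have hexp : (fun x : ℝ => Real.exp x - 1 - x) =O[𝓝 0] fun x : ℝ => x ^ 2 := by
    refine IsBigO.of_bound 1 ?_
    filter_upwards [Metric.ball_mem_nhds (0 : ℝ) one_pos] with x hx
    have := Real.abs_exp_sub_one_sub_id_le (x := x) (by
      rw [Metric.mem_ball, dist_zero_right, Real.norm_eq_abs] at hx
      exact hx.le)
    rw [Real.norm_eq_abs, Real.norm_eq_abs, one_mul, abs_of_nonneg (sq_nonneg x)]
    exact this
  have hcomp := (hexp.comp_tendsto (hg.trans_tendsto hid)).trans (hg.pow 2)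
  have h2 := (hcomp.add hf).const_mul_left (Real.exp a)
  refine h2.congr_left fun ε => ?_
  simp only [Function.comp]
  have : Real.exp (f ε) = Real.exp a * Real.exp (f ε - a) := by
    rw [← Real.exp_add, add_sub_cancel]
  rw [this]
  ring

namespace FwdStart

variable {Ω : Type*} [MeasurableSpace Ω]

/-- The moment generating function of `Y_ε / ε` divided by its exponential growth rate. -/
noncomputable def mgfRatio (μ : Measure Ω) (Y : ℝ → Ω → ℝ) (F : ℂ → ℂ) (ε : ℝ) (z : ℂ) : ℂ :=
  complexMGF (Y ε) μ (z / ε) * Complex.exp (-F z / ε)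

theorem div_mem_interior_integrableExpSet {μ : Measure Ω} {Y : ℝ → Ω → ℝ} {S : Set ℝ}
    (hS : IsOpen S) {ε : ℝ} (hε : 0 < ε) (hsub : S ⊆ lmgfDomain μ Y ε) {x : ℝ} (hx : x ∈ S) :
    x / ε ∈ interior (integrableExpSet (Y ε) μ) := by
  rw [mem_interior]
  refine ⟨(fun y => y * ε) ⁻¹' S, fun y hy => ?_, hS.preimage (continuous_id.mul continuous_const),
    ?_⟩
  · have := hsub hy
    rwa [lmgfDomain, mem_ofPred_eq, mul_div_cancel_right₀ _ hε.ne'] at this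
  · rwa [mem_preimage, div_mul_cancel₀ _ hε.ne']

theorem differentiableOn_scaled_complexMGF {μ : Measure Ω} {Y : ℝ → Ω → ℝ} {S : Set ℝ}
    (hS : IsOpen S) {ε : ℝ} (hε : 0 < ε) (hsub : S ⊆ lmgfDomain μ Y ε) :
    DifferentiableOn ℂ (fun z : ℂ => complexMGF (Y ε) μ (z / ε)) {z : ℂ | z.re ∈ S} := by
  refine differentiableOn_complexMGF.comp ((differentiable_id.div_const _).differentiableOn)
    fun z hz => ?_
  show (z / ε).re ∈ interior _
  rw [Complex.div_ofReal_re]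
  exact div_mem_interior_integrableExpSet hS hε hsub hz

/-- Uniform boundedness of the ratio on each vertical line. -/
theorem exists_mgfRatio_bound_on_line {μ : Measure Ω} {Y : ℝ → Ω → ℝ} {F : ℂ → ℂ} {p : ℝ}
    (ha : ∀ B > 0, ∃ C > 0, ∃ ε₁ > 0, ∀ ε ∈ Ioo 0 ε₁, ∀ pi : ℝ, |pi| ≤ B →
        complexMGF (Y ε) μ (cpt p pi / ε) ≠ 0 ∧
        |lmgfRe μ Y ε (cpt p pi) - (F (cpt p pi)).re| ≤ C * ε)
    (hc : ∃ ε₁ > 0, ∃ pstar > 0, ∃ M : ℝ, ∀ ε ∈ Ioc 0 ε₁, ∀ pi : ℝ, pstar ≤ |pi| →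
        complexMGF (Y ε) μ (cpt p pi / ε) ≠ 0 →
        lmgfRe μ Y ε (cpt p pi) - (F (cpt p pi)).re ≤ M * ε) :
    ∃ C, ∃ ε₂ > 0, ∀ ε ∈ Ioo 0 ε₂, ∀ z : ℂ, z.re = p → ‖mgfRatio μ Y F ε z‖ ≤ C := by
  obtain ⟨ε₁, hε₁, ps, hps, M, hM⟩ := hc
  obtain ⟨C, hC, ε₂, hε₂, hC2⟩ := ha ps hps
  refine ⟨Real.exp (max C M), min ε₁ ε₂, lt_min hε₁ hε₂, fun ε hε z hz => ?_⟩
  have hpos : 0 < ε := hε.1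
  have hz' : z = cpt p z.im := by apply Complex.ext <;> simp [cpt, hz]
  have key : complexMGF (Y ε) μ (z / ε) ≠ 0 →
      lmgfRe μ Y ε z - (F z).re ≤ max C M * ε := by
    intro hne
    -- Assumption (a) covers the bounded part of the line and (c) the tails.
    rcases le_total |z.im| ps with h | h
    · have := (hC2 ε ⟨hpos, hε.2.trans_le (min_le_right _ _)⟩ z.im h).2
      rw [← hz'] at this
      exact (le_abs_self _).trans (this.trans (by gcongr; exact le_max_left _ _))
    · have := hM ε ⟨hpos, hε.2.le.trans (min_le_left _ _)⟩ z.im h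
      rw [← hz'] at this
      exact (this hne).trans (by gcongr; exact le_max_right _ _)
  -- Zeros of the transform are harmless: the ratio vanishes there as well.
  by_cases hne : complexMGF (Y ε) μ (z / ε) = 0
  · rw [mgfRatio, hne, zero_mul, norm_zero]
    positivity
  · have h1 := key hne
    have hn : 0 < ‖complexMGF (Y ε) μ (z / ε)‖ := norm_pos_iff.2 hne
    rw [lmgfRe] at h1
    rw [mgfRatio, norm_mul, Complex.norm_exp, Complex.div_ofReal_re, Complex.neg_re,
      ← Real.exp_log hn, ← Real.exp_add]
    gcongr
    rw [neg_div, ← sub_eq_add_neg, sub_le_iff_le_add, ← sub_le_iff_le_add, le_max_iff] at *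
    have h2 : Real.log ‖complexMGF (Y ε) μ (z / ε)‖ - (F z).re / ε ≤ max C M := by
      have : Real.log ‖complexMGF (Y ε) μ (z / ε)‖ - (F z).re / ε =
          (ε * Real.log ‖complexMGF (Y ε) μ (z / ε)‖ - (F z).re) / ε := by field_simp
      rw [this, div_le_iff₀ hpos]
      exact h1
    rw [le_max_iff] at h2
    exact h2

/-- Analytic data of the ratio near a nonzero point of the domain. -/
theorem exists_mgfRatio_bound_on_strip {μ : Measure Ω} [IsProbabilityMeasure μ] {Y : ℝ → Ω → ℝ}
    {Λ₀ : ℝ → ℝ} {S : Set ℝ} (hS : IsOpen S) {ε₀ : ℝ} (hε₀ : 0 < ε₀)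
    (hdom : ∀ ε ∈ Ioo 0 ε₀, S ⊆ lmgfDomain μ Y ε) (hΛ₀ : ContinuousOn Λ₀ S) {F : ℂ → ℂ}
    (hF : DifferentiableOn ℂ F {z : ℂ | z.re ∈ S ∧ z.re ≠ 0})
    (hFΛ : ∀ u ∈ S, u ≠ 0 → F (u : ℂ) = (Λ₀ u : ℂ))
    (hb : ∀ z : ℂ, z.re ∈ S → z.re ≠ 0 → (F z).re ≤ (F z.re).re)
    (hline : ∀ p ∈ S, p ≠ 0 → ∃ C, ∃ ε₂ > 0, ∀ ε ∈ Ioo 0 ε₂, ∀ z : ℂ, z.re = p →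
      ‖mgfRatio μ Y F ε z‖ ≤ C) {u : ℝ} (hu : u ∈ S) (hu0 : u ≠ 0) :
    ∃ r > 0, ∃ C, ∃ ε₂ > 0, ε₂ ≤ ε₀ ∧ (∀ x : ℝ, |x - u| ≤ r → x ∈ S ∧ x ≠ 0) ∧
      ∀ ε ∈ Ioo 0 ε₂, ∀ z : ℂ, |z.re - u| ≤ r → ‖mgfRatio μ Y F ε z‖ ≤ C := by
  have hopen : IsOpen (S ∩ {0}ᶜ) := hS.inter isOpen_compl_singleton
  obtain ⟨R', hR', hball⟩ := Metric.isOpen_iff.1 hopen u ⟨hu, hu0⟩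
  set R := R' / 2 with hRdef
  have hR : 0 < R := by positivity
  have hin : ∀ x : ℝ, |x - u| ≤ R → x ∈ S ∧ x ≠ 0 := by
    intro x hx
    have := hball (show x ∈ Metric.ball u R' by
      rw [Metric.mem_ball, Real.dist_eq]; linarith)
    exact ⟨this.1, this.2⟩
  have hIccS : Icc (u - R) (u + R) ⊆ S := fun x hx => (hin x (by
    rw [abs_le]; constructor <;> linarith [hx.1, hx.2])).1
  obtain ⟨K, hK⟩ := (isCompact_Icc.image_of_continuousOn (hΛ₀.mono hIccS)).bddAbove
  -- By (b), `Re F` on a vertical line is largest at the real point, where it equals `Λ₀`, bounded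
  -- on a compact interval.
  have hreK : ∀ z : ℂ, |z.re - u| < R → (F z).re ≤ K := by
    intro z hz
    obtain ⟨h1, h2⟩ := hin z.re hz.le
    refine (hb z h1 h2).trans ?_
    rw [hFΛ _ h1 h2, Complex.ofReal_re]
    rw [abs_lt] at hz
    exact hK ⟨z.re, ⟨by linarith [hz.1], by linarith [hz.2]⟩, rfl⟩
  have hB : ∀ ε ∈ Ioo 0 ε₀, ∃ B : ℝ, ∀ z : ℂ, |z.re - u| < R / 4 →
      ‖complexMGF (Y ε) μ (z / ε)‖ ≤ B := by
    intro ε hε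
    have hcont : ContinuousOn (fun x : ℝ => mgf (Y ε) μ (x / ε)) (Icc (u - R) (u + R)) := by
      refine continuousOn_mgf.comp (continuous_id.div_const _).continuousOn fun x hx => ?_
      exact div_mem_interior_integrableExpSet hS hε.1 (hdom ε hε) (hIccS hx)
    obtain ⟨B, hB⟩ := (isCompact_Icc.image_of_continuousOn hcont).bddAbove
    refine ⟨B, fun z hz => norm_complexMGF_le_mgf.trans ?_⟩
    rw [Complex.div_ofReal_re]
    rw [abs_lt] at hz
    exact hB ⟨z.re, ⟨by linarith [hz.1], by linarith [hz.2]⟩, rfl⟩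
  choose! B hB using hB
  obtain ⟨C, ε₂, hε₂, hle, hC⟩ := exists_uniform_bound_on_strip (F := F)
    (m := fun ε z => complexMGF (Y ε) μ (z / ε)) (u := u) (B := B) hR hε₀
    (hF.mono fun z hz => hin z.re (le_of_lt hz)) hreK
    (fun ε hε => (differentiableOn_scaled_complexMGF hS hε.1 (hdom ε hε)).mono
      fun z hz => (hin z.re (le_of_lt hz)).1) hB
    (fun p hp => hline p (hin p hp.le).1 (hin p hp.le).2)
  exact ⟨R / 8, by positivity, C, ε₂, hε₂, hle, fun x hx => hin x (by linarith), hC⟩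

/-- Pointwise expansion of the ratio on the reals. -/
theorem isBigO_mgfRatio_sub {μ : Measure Ω} [IsProbabilityMeasure μ] {Y : ℝ → Ω → ℝ}
    {Λ₀ Λ₁ Λ₂ : ℝ → ℝ} {F : ℂ → ℂ} {x ε₀ : ℝ} (hε₀ : 0 < ε₀)
    (hdom : ∀ ε ∈ Ioo 0 ε₀, x ∈ lmgfDomain μ Y ε) (hFΛ : F (x : ℂ) = (Λ₀ x : ℂ))
    (hexp : (fun ε => lmgf μ Y ε x - (Λ₀ x + Λ₁ x * ε + Λ₂ x * ε ^ 2)) =O[𝓝[>] 0]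
      fun ε => ε ^ 3) :
    (fun ε : ℝ => mgfRatio μ Y F ε x - (((Real.exp (Λ₁ x) : ℝ) : ℂ) +
      ((Real.exp (Λ₁ x) * Λ₂ x : ℝ) : ℂ) * ε)) =O[𝓝[>] 0] fun ε : ℝ => ε ^ 2 := by
  -- At a real point the ratio is the exponential of `(Λ_ε - Λ₀)/ε`, so the cubic error becomes
  -- quadratic.
  have hdiv : (fun ε => (lmgf μ Y ε x - Λ₀ x) / ε - (Λ₁ x + Λ₂ x * ε)) =O[𝓝[>] 0]
      fun ε : ℝ => ε ^ 2 := by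
    have h := hexp.mul (isBigO_refl (fun ε : ℝ => ε⁻¹) (𝓝[>] 0))
    refine h.congr' ?_ ?_
    · filter_upwards [self_mem_nhdsWithin] with ε hε
      have : ε ≠ 0 := ne_of_gt hε
      field_simp
      ring
    · filter_upwards [self_mem_nhdsWithin] with ε hε
      have : ε ≠ 0 := ne_of_gt hε
      field_simp
  have h2 := isBigO_exp_expansion hdiv
  have h3 : (fun ε : ℝ => ((Real.exp ((lmgf μ Y ε x - Λ₀ x) / ε) -
      (Real.exp (Λ₁ x) + Real.exp (Λ₁ x) * Λ₂ x * ε) : ℝ) : ℂ)) =O[𝓝[>] 0]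
      fun ε : ℝ => ε ^ 2 := by
    refine IsBigO.of_norm_left ?_
    simp only [Complex.norm_real]
    exact h2.norm_left
  refine h3.congr' ?_ EventuallyEq.rfl
  filter_upwards [Ioo_mem_nhdsGT hε₀] with ε hε
  have hε0 : ε ≠ 0 := hε.1.ne'
  have hmgf : 0 < mgf (Y ε) μ (x / ε) := mgf_pos (hdom ε hε)
  have hM : mgfRatio μ Y F ε x = ((Real.exp ((lmgf μ Y ε x - Λ₀ x) / ε) : ℝ) : ℂ) := by
    rw [mgfRatio, hFΛ, ← Complex.ofReal_div, complexMGF_ofReal, ← Complex.ofReal_neg,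
      ← Complex.ofReal_div, ← Complex.ofReal_exp, ← Complex.ofReal_mul]
    congr 1
    rw [lmgf, cgf, sub_div, mul_div_cancel_left₀ _ hε0, sub_eq_add_neg, Real.exp_add,
      Real.exp_log hmgf, neg_div]
  rw [hM]
  push_cast
  ring

end FwdStart

/-! ### Amplitudes depending on `ε`. -/

/-- Cauchy estimate for the Taylor coefficients of a uniformly convergent family. -/
theorem isBigO_iteratedDeriv_sub {p : ℝ → ℂ → ℂ} {q : ℂ → ℂ} {c : ℂ} {δ K ε₁ : ℝ} (hδ : 0 < δ)
    (hε₁ : 0 < ε₁) (hp : ∀ ε ∈ Ioo 0 ε₁, DifferentiableOn ℂ (p ε) (Metric.ball c δ))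
    (hq : DifferentiableOn ℂ q (Metric.ball c δ))
    (hK : ∀ ε ∈ Ioo 0 ε₁, ∀ z ∈ Metric.ball c δ, ‖p ε z - q z‖ ≤ K * ε) (n : ℕ) :
    (fun ε : ℝ => iteratedDeriv n (p ε) c - iteratedDeriv n q c) =O[𝓝[>] 0] fun ε : ℝ => ε := by
  have hδ2 : 0 < δ / 2 := by positivity
  refine IsBigO.of_bound (n.factorial * K / (δ / 2) ^ n) ?_
  filter_upwards [Ioo_mem_nhdsGT hε₁] with ε hε
  have hd : DifferentiableOn ℂ (p ε - q) (Metric.ball c δ) := (hp ε hε).sub hq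
  have hcl : Metric.closedBall c (δ / 2) ⊆ Metric.ball c δ :=
    Metric.closedBall_subset_ball (by linarith)
  have hmem : Metric.ball c δ ∈ 𝓝 c := Metric.ball_mem_nhds c hδ
  have hpa := ((hp ε hε).analyticAt hmem).contDiffAt (n := n)
  have hqa := (hq.analyticAt hmem).contDiffAt (n := n)
  have h := Complex.norm_iteratedDeriv_le_of_forall_mem_sphere_norm_le n hδ2
    (f := p ε - q) (c := c) (C := K * ε) ((hd.mono (by
      rw [closure_ball c hδ2.ne']; exact hcl)).diffContOnCl) (fun z hz =>
      hK ε hε z (hcl (Metric.sphere_subset_closedBall hz)))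
  rw [iteratedDeriv_sub hpa hqa] at h
  refine h.trans (le_of_eq ?_)
  rw [Real.norm_of_nonneg hε.1.le]
  ring

/-- First two derivatives of `exp ℓ(z) / z²`. -/
theorem deriv_cexp_mul_inv_sq {l : ℂ → ℂ} {u : ℂ} (hl : AnalyticAt ℂ l u) (hu : u ≠ 0) :
    deriv (fun z => Complex.exp (l z) * (z * z)⁻¹) u =
        Complex.exp (l u) * (u * u)⁻¹ * (deriv l u - 2 / u) ∧
      iteratedDeriv 2 (fun z => Complex.exp (l z) * (z * z)⁻¹) u =
        Complex.exp (l u) * (u * u)⁻¹ *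
          (iteratedDeriv 2 l u + deriv l u ^ 2 - 4 * deriv l u / u + 6 / u ^ 2) := by
  have h1 : ∀ z, AnalyticAt ℂ l z → z ≠ 0 →
      HasDerivAt (fun z => Complex.exp (l z) * (z * z)⁻¹)
        (Complex.exp (l z) * (z * z)⁻¹ * (deriv l z - 2 / z)) z := by
    intro z hz hz0
    have ha := hz.differentiableAt.hasDerivAt.cexp
    have hb := ((hasDerivAt_id z).mul (hasDerivAt_id z)).fun_inv
      (show (id z * id z : ℂ) ≠ 0 from mul_ne_zero hz0 hz0)
    refine (ha.mul hb).congr_deriv ?_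
    simp only [id, Pi.mul_apply]
    field_simp
    ring
  refine ⟨(h1 u hl hu).deriv, ?_⟩
  have hev : deriv (fun z => Complex.exp (l z) * (z * z)⁻¹) =ᶠ[𝓝 u]
      fun z => Complex.exp (l z) * (z * z)⁻¹ * (deriv l z - 2 / z) := by
    filter_upwards [hl.eventually_analyticAt, isOpen_ne.mem_nhds hu] with z hz hz0
    exact (h1 z hz hz0).deriv
  rw [iteratedDeriv_succ, iteratedDeriv_one, hev.deriv_eq]
  have h2 : HasDerivAt (fun z : ℂ => deriv l z - 2 / z) (iteratedDeriv 2 l u + 2 / u ^ 2) u := by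
    have ha : HasDerivAt (deriv l) (iteratedDeriv 2 l u) u := by
      rw [iteratedDeriv_succ, iteratedDeriv_one]
      exact hl.deriv.differentiableAt.hasDerivAt
    have hb := (hasDerivAt_inv hu).const_mul (2 : ℂ)
    refine ((ha.sub hb).congr_deriv ?_).congr_of_eventuallyEq ?_
    · field_simp
      ring
    · filter_upwards with z
      simp [div_eq_mul_inv]
  refine (((h1 u hl hu).mul h2).deriv).trans ?_
  field_simp
  ring

/-- Laplace expansion with the amplitude expanded in `ε`. -/
theorem isBigO_laplace_quotient {I : ℝ → ℂ} {a : ℝ} (ha : 0 < a) {f₃ f₄ P₀ κ P₁ P₂ c : ℂ}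
    {p₀ p₁ p₂ : ℝ → ℂ} (hP₀ : P₀ ≠ 0)
    (h0 : (fun ε : ℝ => p₀ ε - (P₀ + P₀ * κ * ε)) =O[𝓝[>] 0] fun ε : ℝ => ε ^ 2)
    (h1 : (fun ε : ℝ => p₁ ε - P₁) =O[𝓝[>] 0] fun ε : ℝ => ε)
    (h2 : (fun ε : ℝ => p₂ ε - P₂) =O[𝓝[>] 0] fun ε : ℝ => ε)
    (hc : P₀ * c = P₀ * κ + (P₀ * (f₄ / (8 * a ^ 2) + 5 * f₃ ^ 2 / (24 * a ^ 3))
      + P₁ * f₃ / (2 * a ^ 2) + P₂ / (2 * a)))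
    (hI : (fun ε : ℝ => I ε - (Real.sqrt (2 * Real.pi * ε / a) : ℂ) * (p₀ ε + ε *
      (p₀ ε * (f₄ / (8 * a ^ 2) + 5 * f₃ ^ 2 / (24 * a ^ 3)) + p₁ ε * f₃ / (2 * a ^ 2)
        + p₂ ε / (2 * a)))) =O[𝓝[>] 0] fun ε : ℝ => ε ^ 2 * Real.sqrt ε) :
    (fun ε : ℝ => I ε / ((Real.sqrt (2 * Real.pi * ε / a) : ℂ) * P₀) - (1 + c * ε)) =O[𝓝[>] 0]
      fun ε : ℝ => ε ^ 2 := by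
  set s : ℝ → ℝ := fun ε => Real.sqrt (2 * Real.pi * ε / a) with hs
  set A : ℂ := f₄ / (8 * a ^ 2) + 5 * f₃ ^ 2 / (24 * a ^ 3) with hA
  have hε2 : (fun ε : ℝ => ε ^ 2) =O[𝓝[>] 0] fun ε : ℝ => ε :=
    ((isLittleO_pow_id (𝕜 := ℝ) (n := 2) (by norm_num)).isBigO).mono nhdsWithin_le_nhds
  have hεc : (fun ε : ℝ => (ε : ℂ)) =O[𝓝[>] 0] fun ε : ℝ => ε :=
    IsBigO.of_norm_left (by simpa using (isBigO_refl (fun ε : ℝ => ε) _).norm_left)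
  have h0' : (fun ε : ℝ => p₀ ε - P₀) =O[𝓝[>] 0] fun ε : ℝ => ε := by
    refine ((h0.trans hε2).add (hεc.const_mul_left (P₀ * κ))).congr_left fun ε => ?_
    ring
  have hsum : (fun ε : ℝ => (p₀ ε - P₀) * A + (p₁ ε - P₁) * (f₃ / (2 * a ^ 2))
      + (p₂ ε - P₂) * (1 / (2 * a))) =O[𝓝[>] 0] fun ε : ℝ => ε := by
    refine IsBigO.add (IsBigO.add ?_ ?_) ?_
    · simpa only [mul_comm] using h0'.const_mul_left A
    · simpa only [mul_comm] using h1.const_mul_left (f₃ / (2 * a ^ 2) : ℂ)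
    · simpa only [mul_comm] using h2.const_mul_left (1 / (2 * a) : ℂ)
  -- The derivatives enter with a factor `ε`, so knowing them to `O(ε)` is enough; only the value at
  -- the centre needs an expansion to `O(ε²)`.
  have hE := ((hεc.mul hsum).add (h0.congr_right fun ε => by rw [sq])).congr_right
    (fun ε => (sq ε).symm)
  have hsinv : (fun ε : ℝ => ε ^ 2 * Real.sqrt ε / s ε) =O[𝓝[>] 0] fun ε : ℝ => ε ^ 2 := by
    refine IsBigO.of_bound (Real.sqrt (2 * Real.pi / a))⁻¹ ?_
    filter_upwards [self_mem_nhdsWithin] with ε hε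
    have hε' : (0 : ℝ) < ε := hε
    have hsq : 0 < Real.sqrt ε := Real.sqrt_pos.2 hε'
    have hsa : 0 < Real.sqrt (2 * Real.pi / a) := Real.sqrt_pos.2 (by positivity)
    have : s ε = Real.sqrt (2 * Real.pi / a) * Real.sqrt ε := by
      change Real.sqrt (2 * Real.pi * ε / a) = _
      rw [← Real.sqrt_mul (by positivity)]
      congr 1
      ring
    rw [this]
    have e : ε ^ 2 * Real.sqrt ε / (Real.sqrt (2 * Real.pi / a) * Real.sqrt ε) =
        (Real.sqrt (2 * Real.pi / a))⁻¹ * ε ^ 2 := by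
      field_simp
    rw [e, norm_mul, norm_inv, Real.norm_of_nonneg hsa.le]
  have hmain2 : (fun ε : ℝ => (I ε - (s ε : ℂ) * (p₀ ε + ε *
      (p₀ ε * A + p₁ ε * f₃ / (2 * a ^ 2) + p₂ ε / (2 * a)))) * (s ε : ℂ)⁻¹) =O[𝓝[>] 0]
      fun ε : ℝ => ε ^ 2 := by
    refine IsBigO.trans ?_ hsinv
    have := hI.norm_norm.mul (isBigO_refl (fun ε : ℝ => ‖((s ε : ℂ))⁻¹‖) (𝓝[>] 0))
    refine IsBigO.of_norm_norm (this.congr (fun ε => ?_) fun ε => ?_)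
    · rw [norm_mul]
    · rw [norm_div, norm_inv, Complex.norm_real, div_eq_mul_inv]
  have htot := (hmain2.add hE).const_mul_left P₀⁻¹
  refine htot.congr' ?_ EventuallyEq.rfl
  filter_upwards [self_mem_nhdsWithin] with ε hε
  have hε' : (0 : ℝ) < ε := hε
  have hs0 : (s ε : ℂ) ≠ 0 := by
    rw [Complex.ofReal_ne_zero]
    exact (Real.sqrt_pos.2 (by positivity)).ne'
  have hcc : c = P₀⁻¹ * (P₀ * κ + (P₀ * A + P₁ * f₃ / (2 * a ^ 2) + P₂ / (2 * a))) := by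
    rw [← hc, inv_mul_cancel_left₀ hP₀]
  rw [hcc]
  have e1 : (I ε - (s ε : ℂ) * (p₀ ε + ε *
      (p₀ ε * A + p₁ ε * f₃ / (2 * a ^ 2) + p₂ ε / (2 * a)))) * (s ε : ℂ)⁻¹ =
      I ε * (s ε : ℂ)⁻¹ - (p₀ ε + ε *
      (p₀ ε * A + p₁ ε * f₃ / (2 * a ^ 2) + p₂ ε / (2 * a))) := by
    field_simp
  have e2 : P₀⁻¹ * P₀ = 1 := inv_mul_cancel₀ hP₀
  change _ = I ε / ((s ε : ℂ) * P₀) - _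
  rw [e1, div_eq_mul_inv (I ε), mul_inv]
  linear_combination (-1 : ℂ) * e2

/-! ### Analytic data on the vertical line through the saddlepoint. -/

namespace FwdStart

variable {Ω : Type*} [MeasurableSpace Ω]

/-- Analytic control of the moment generating functions near the vertical line through `u`. -/
structure LineData (μ : Measure Ω) (Y : ℝ → Ω → ℝ) (Λ₀ Λ₁ Λ₂ : ℝ → ℝ) (S : Set ℝ) (u : ℝ)
    (F G : ℂ → ℂ) (r C K ε₀ : ℝ) : Prop where
  isOpen : IsOpen S
  r_pos : 0 < r
  ε₀_pos : 0 < ε₀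
  strip : ∀ x : ℝ, |x - u| ≤ r → x ∈ S ∧ x ≠ 0
  domain : ∀ ε ∈ Ioo 0 ε₀, S ⊆ lmgfDomain μ Y ε
  F_diff : DifferentiableOn ℂ F {z : ℂ | z.re ∈ S ∧ z.re ≠ 0}
  F_real : ∀ x ∈ S, x ≠ 0 → F (x : ℂ) = (Λ₀ x : ℂ)
  F_re_le : ∀ z : ℂ, z.re ∈ S → z.re ≠ 0 → (F z).re ≤ (F z.re).re
  F_re_gap : ∀ δ > 0, ∃ η > 0, ∀ v : ℝ, δ ≤ |v| → (F (u + v * Complex.I)).re ≤ Λ₀ u - η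
  ratio_bound : ∀ ε ∈ Ioo 0 ε₀, ∀ z : ℂ, |z.re - u| ≤ r → ‖mgfRatio μ Y F ε z‖ ≤ C
  G_diff : DifferentiableOn ℂ G (Metric.ball (u : ℂ) r)
  G_real : ∀ x : ℝ, |x - u| < r → G x = (Real.exp (Λ₁ x) : ℝ)
  ratio_sub : ∀ ε ∈ Ioo 0 ε₀, ∀ z ∈ Metric.ball (u : ℂ) r, ‖mgfRatio μ Y F ε z - G z‖ ≤ K * ε
  ratio_exp : (fun ε : ℝ => mgfRatio μ Y F ε u - (((Real.exp (Λ₁ u) : ℝ) : ℂ) +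
      ((Real.exp (Λ₁ u) * Λ₂ u : ℝ) : ℂ) * ε)) =O[𝓝[>] 0] fun ε : ℝ => ε ^ 2

theorem cpt_eq (x y : ℝ) : cpt x y = x + y * Complex.I := by
  apply Complex.ext <;> simp [cpt]

theorem abs_re_sub_lt_of_mem_ball {z : ℂ} {u r : ℝ} (hz : z ∈ Metric.ball (u : ℂ) r) :
    |z.re - u| < r := by
  rw [Metric.mem_ball, dist_eq_norm] at hz
  refine lt_of_le_of_lt ?_ hz
  simpa using Complex.abs_re_le_norm (z - u)

/-- Everything drawn from the tail and expansion hypotheses is collected here: bounds on lines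
become a bound on a strip, and this with the pointwise expansions produces `G`. -/
theorem StandingAssumptions.exists_lineData {μ : Measure Ω} [IsProbabilityMeasure μ]
    {Y : ℝ → Ω → ℝ} {Λ₀ Λ₁ Λ₂ : ℝ → ℝ} (h : StandingAssumptions μ Y Λ₀ Λ₁ Λ₂) {u : ℝ}
    (hu : u ∈ interior (limDomain μ Y)) (hu0 : u ≠ 0) :
    ∃ F G r C K ε₀, LineData μ Y Λ₀ Λ₁ Λ₂ (interior (limDomain μ Y)) u F G r C K ε₀ := by
  set S := interior (limDomain μ Y) with hSdef
  have hS : IsOpen S := isOpen_interior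
  obtain ⟨F, hF, hFΛ, hT⟩ := h.tail
  obtain ⟨ε₀, hε₀, hdom, -⟩ := h.smooth
  have hre : ∀ z : ℂ, cpt z.re z.im = z := fun z => by apply Complex.ext <;> simp [cpt]
  have hcpt0 : ∀ x : ℝ, cpt x 0 = x := fun x => by simp [cpt_eq]
  have hb : ∀ z : ℂ, z.re ∈ S → z.re ≠ 0 → (F z).re ≤ (F z.re).re := by
    intro z hz hz0
    by_cases him : z.im = 0
    · rw [← Complex.ext_iff.2 (show z.re = (z.re : ℂ).re ∧ z.im = (z.re : ℂ).im by simp [him])]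
    · have := ((hT z.re hz hz0).2.1 z.im him).le
      rwa [hre, hcpt0] at this
  have hline : ∀ p ∈ S, p ≠ 0 → ∃ C, ∃ ε₂ > 0, ∀ ε ∈ Ioo 0 ε₂, ∀ z : ℂ, z.re = p →
      ‖mgfRatio μ Y F ε z‖ ≤ C := fun p hp hp0 =>
    exists_mgfRatio_bound_on_line (hT p hp hp0).1 (hT p hp hp0).2.2.2
  obtain ⟨r, hr, C, ε₂, hε₂, hle, hstrip, hC⟩ := exists_mgfRatio_bound_on_strip hS hε₀ hdom
    h.essSmooth.differentiable.continuousOn hF hFΛ hb hline hu hu0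
  have hball : Metric.ball (u : ℂ) r ⊆ {z : ℂ | z.re ∈ S ∧ z.re ≠ 0} := fun z hz =>
    hstrip z.re (abs_re_sub_lt_of_mem_ball hz).le
  have hexp : ∀ x : ℝ, |x - u| < r → _ := fun x hx =>
    isBigO_mgfRatio_sub (Λ₂ := Λ₂) (Λ₁ := Λ₁) hε₀ (fun ε hε => hdom ε hε (hstrip x hx.le).1)
      (hFΛ x (hstrip x hx.le).1 (hstrip x hx.le).2) (h.expansion x (hstrip x hx.le).1)
  have hdiff : ∀ ε ∈ Ioo 0 ε₂, DifferentiableOn ℂ (mgfRatio μ Y F ε) (Metric.ball (u : ℂ) r) := by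
    intro ε hε
    refine ((differentiableOn_scaled_complexMGF hS hε.1
      (hdom ε ⟨hε.1, hε.2.trans_le hle⟩)).mono fun z hz => (hball hz).1).mul ?_
    exact (((hF.mono hball).neg).div_const _).cexp
  obtain ⟨G, ρ, K, ε₃, hρ, hρr, hε₃, hε₃₂, hG, hGr, hGK⟩ := exists_holomorphic_limit hr hε₂ hdiff
    (fun ε hε z hz => hC ε hε z (abs_re_sub_lt_of_mem_ball hz).le)
    (c₀ := fun x => ((Real.exp (Λ₁ x) : ℝ) : ℂ))
    (c₁ := fun x => ((Real.exp (Λ₁ x) * Λ₂ x : ℝ) : ℂ)) hexp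
  -- For `|v| ≥ B` the gap is part of (b). For `δ ≤ |v| ≤ B` it comes from the strict inequality and
  -- compactness.
  have hgap : ∀ δ > 0, ∃ η > 0, ∀ v : ℝ, δ ≤ |v| →
      (F (u + v * Complex.I)).re ≤ Λ₀ u - η := by
    intro δ hδ
    obtain ⟨-, hlt, ⟨η, hη, B, -, hB⟩, -⟩ := hT u hu hu0
    have hu' : (F (cpt u 0)).re = Λ₀ u := by rw [hcpt0, hFΛ u hu hu0, Complex.ofReal_re]
    rw [hu'] at hB hlt
    simp only [cpt_eq] at hB hlt
    have hcomp : IsCompact (Icc (-B) B ∩ {v : ℝ | δ ≤ |v|}) :=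
      isCompact_Icc.inter_right (isClosed_le continuous_const continuous_abs)
    have hcont : Continuous fun v : ℝ => (F (u + v * Complex.I)).re := by
      refine Complex.continuous_re.comp (hF.continuousOn.comp_continuous (by fun_prop) fun v => ?_)
      simpa using ⟨hu, hu0⟩
    rcases (Icc (-B) B ∩ {v : ℝ | δ ≤ |v|}).eq_empty_or_nonempty with he | hne
    · refine ⟨η, hη, fun v hv => hB v ?_⟩
      by_contra hlt'
      have : v ∈ Icc (-B) B ∩ {v : ℝ | δ ≤ |v|} := ⟨abs_le.1 (not_le.1 hlt').le, hv⟩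
      rw [he] at this
      exact this
    · obtain ⟨v₀, hv₀, hmax⟩ := hcomp.exists_isMaxOn hne hcont.continuousOn
      have hv₀0 : v₀ ≠ 0 := fun h0 => by
        have := hv₀.2
        rw [h0] at this
        simp at this
        linarith
      refine ⟨min η (Λ₀ u - (F (u + v₀ * Complex.I)).re), lt_min hη (sub_pos.2 (hlt v₀ hv₀0)),
        fun v hv => ?_⟩
      rcases le_total B |v| with hv' | hv'
      · linarith [hB v hv', min_le_left η (Λ₀ u - (F (u + v₀ * Complex.I)).re)]
      · have h1 : (F (u + v * Complex.I)).re ≤ (F (u + v₀ * Complex.I)).re :=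
          hmax ⟨abs_le.1 hv', hv⟩
        linarith [min_le_right η (Λ₀ u - (F (u + v₀ * Complex.I)).re)]
  refine ⟨F, G, ρ / 2, C, K, ε₃, hS, by positivity, hε₃, fun x hx => hstrip x (by linarith),
    fun ε hε => hdom ε ⟨hε.1, hε.2.trans_le (hε₃₂.trans hle)⟩, hF, hFΛ, hb, hgap,
    fun ε hε z hz => hC ε ⟨hε.1, hε.2.trans_le hε₃₂⟩ z (by linarith),
    hG.mono (Metric.ball_subset_ball (by linarith)), fun x hx => hGr x (by linarith),
    fun ε hε z hz => hGK ε hε z (Metric.ball_subset_ball (by linarith) hz),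
    hexp u (by simpa using hr)⟩

end FwdStart

/-- Subtracting an affine function does not change derivatives of order at least two. -/
theorem iteratedDeriv_add_two_sub_affine {F : ℂ → ℂ} {u : ℂ} (hF : AnalyticAt ℂ F u) (b k : ℂ)
    (n : ℕ) : iteratedDeriv (n + 2) (fun z => F (u + z) - b - k * z) 0 =
      iteratedDeriv (n + 2) F u := by
  have hev : ∀ᶠ z : ℂ in 𝓝 0, AnalyticAt ℂ F (u + z) := by
    have : Tendsto (fun z : ℂ => u + z) (𝓝 0) (𝓝 u) := by
      simpa using (continuous_const_add u).tendsto 0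
    exact this.eventually hF.eventually_analyticAt
  have h1 : deriv (fun z => F (u + z) - b - k * z) =ᶠ[𝓝 0] fun z => deriv F (u + z) - k := by
    filter_upwards [hev] with z hz
    have := ((hz.differentiableAt.hasDerivAt.comp_const_add u z).sub_const b).sub
      ((hasDerivAt_id z).const_mul k)
    rw [mul_one] at this
    exact this.deriv
  have h2 : deriv (fun z => deriv F (u + z) - k) = fun z => deriv (deriv F) (u + z) := by
    funext z
    rw [deriv_sub_const, deriv_comp_const_add]
  rw [iteratedDeriv_succ', iteratedDeriv_succ', (h1.deriv.trans (by rw [h2])).iteratedDeriv_eq n,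
    iteratedDeriv_comp_const_add, iteratedDeriv_succ', iteratedDeriv_succ']
  simp

namespace FwdStart

variable {Ω : Type*} [MeasurableSpace Ω] {μ : Measure Ω} {Y : ℝ → Ω → ℝ} {Λ₀ Λ₁ Λ₂ : ℝ → ℝ}
  {S : Set ℝ} {u : ℝ} {F G : ℂ → ℂ} {r C K ε₀ : ℝ}

namespace LineData

theorem mem (L : LineData μ Y Λ₀ Λ₁ Λ₂ S u F G r C K ε₀) : u ∈ S ∧ u ≠ 0 :=
  L.strip u (by simpa using L.r_pos.le)

theorem ball_subset (L : LineData μ Y Λ₀ Λ₁ Λ₂ S u F G r C K ε₀) :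
    Metric.ball (u : ℂ) r ⊆ {z : ℂ | z.re ∈ S ∧ z.re ≠ 0} := fun z hz =>
  L.strip z.re (abs_re_sub_lt_of_mem_ball hz).le

theorem analyticAt_F (L : LineData μ Y Λ₀ Λ₁ Λ₂ S u F G r C K ε₀) : AnalyticAt ℂ F u :=
  (L.F_diff.mono L.ball_subset).analyticAt (Metric.ball_mem_nhds _ L.r_pos)

theorem eventually_F_eq (L : LineData μ Y Λ₀ Λ₁ Λ₂ S u F G r C K ε₀) :
    ∀ᶠ x : ℝ in 𝓝 u, F x = Λ₀ x := by
  filter_upwards [Metric.ball_mem_nhds u L.r_pos] with x hx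
  rw [Metric.mem_ball, Real.dist_eq] at hx
  exact L.F_real x (L.strip x hx.le).1 (L.strip x hx.le).2

theorem contDiffAt_limit (L : LineData μ Y Λ₀ Λ₁ Λ₂ S u F G r C K ε₀) :
    ContDiffAt ℝ (⊤ : ℕ∞) Λ₀ u :=
  contDiffAt_of_eq_analyticAt L.analyticAt_F L.eventually_F_eq

theorem iteratedDeriv_F (L : LineData μ Y Λ₀ Λ₁ Λ₂ S u F G r C K ε₀) (n : ℕ) :
    iteratedDeriv n F u = (iteratedDeriv n Λ₀ u : ℝ) :=
  (eventually_iteratedDeriv_eq_ofReal L.analyticAt_F L.eventually_F_eq n).self_of_nhds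

theorem deriv_F (L : LineData μ Y Λ₀ Λ₁ Λ₂ S u F G r C K ε₀) :
    deriv F u = (deriv Λ₀ u : ℝ) := by
  simpa only [iteratedDeriv_one] using L.iteratedDeriv_F 1

theorem analyticAt_G (L : LineData μ Y Λ₀ Λ₁ Λ₂ S u F G r C K ε₀) : AnalyticAt ℂ G u :=
  L.G_diff.analyticAt (Metric.ball_mem_nhds _ L.r_pos)

theorem G_apply (L : LineData μ Y Λ₀ Λ₁ Λ₂ S u F G r C K ε₀) : G u = (Real.exp (Λ₁ u) : ℝ) :=
  L.G_real u (by simpa using L.r_pos)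

/-- `G u = exp (Λ₁ u)` is positive, so the principal logarithm is analytic there and extends `Λ₁`,
whose smoothness follows. -/
theorem analyticAt_log (L : LineData μ Y Λ₀ Λ₁ Λ₂ S u F G r C K ε₀) :
    AnalyticAt ℂ (fun z => Complex.log (G z)) u := by
  refine L.analyticAt_G.clog ?_
  rw [L.G_apply]
  exact Complex.ofReal_mem_slitPlane.2 (Real.exp_pos _)

theorem eventually_log_eq (L : LineData μ Y Λ₀ Λ₁ Λ₂ S u F G r C K ε₀) :
    ∀ᶠ x : ℝ in 𝓝 u, Complex.log (G x) = Λ₁ x := by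
  filter_upwards [Metric.ball_mem_nhds u L.r_pos] with x hx
  rw [Metric.mem_ball, Real.dist_eq] at hx
  rw [L.G_real x hx, ← Complex.ofReal_log (Real.exp_pos _).le, Real.log_exp]

theorem contDiffAt_correction (L : LineData μ Y Λ₀ Λ₁ Λ₂ S u F G r C K ε₀) :
    ContDiffAt ℝ (⊤ : ℕ∞) Λ₁ u :=
  contDiffAt_of_eq_analyticAt L.analyticAt_log L.eventually_log_eq

theorem deriv_log (L : LineData μ Y Λ₀ Λ₁ Λ₂ S u F G r C K ε₀) :
    deriv (fun z => Complex.log (G z)) u = (deriv Λ₁ u : ℝ) ∧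
      iteratedDeriv 2 (fun z => Complex.log (G z)) u = (iteratedDeriv 2 Λ₁ u : ℝ) := by
  have h := fun n => (eventually_iteratedDeriv_eq_ofReal L.analyticAt_log
    L.eventually_log_eq n).self_of_nhds
  exact ⟨by simpa only [iteratedDeriv_one] using h 1, h 2⟩

theorem deriv_sub_tangent (L : LineData μ Y Λ₀ Λ₁ Λ₂ S u F G r C K ε₀) :
    deriv (fun z : ℂ => F (u + z) - F u - (deriv Λ₀ u : ℝ) * z) 0 = 0 := by
  have hF0 : HasDerivAt F (deriv F u) (u + 0) := by
    rw [add_zero]; exact L.analyticAt_F.differentiableAt.hasDerivAt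
  have := ((hF0.comp_const_add (u : ℂ) 0).sub_const (F u)).sub
    ((hasDerivAt_id (0 : ℂ)).const_mul ((deriv Λ₀ u : ℝ) : ℂ))
  refine this.deriv.trans ?_
  rw [L.deriv_F, mul_one, sub_self]

/-- The limit has positive second derivative away from the origin. -/
theorem iteratedDeriv_two_pos (L : LineData μ Y Λ₀ Λ₁ Λ₂ S u F G r C K ε₀)
    (hf : StrictConvexOn ℝ S Λ₀) : 0 < iteratedDeriv 2 Λ₀ u := by
  have hu := L.mem
  have hFu : F u = Λ₀ u := L.F_real u hu.1 hu.2
  have htends : Tendsto (fun z : ℂ => (u : ℂ) + z) (𝓝 0) (𝓝 u) := by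
    simpa using (continuous_const_add (u : ℂ)).tendsto 0
  have hd : DifferentiableAt ℝ Λ₀ u := L.contDiffAt_limit.differentiableAt (by simp)
  have han : AnalyticAt ℂ (fun z : ℂ => F (u + z) - F u - (deriv Λ₀ u : ℝ) * z) 0 := by
    have h1 : AnalyticAt ℂ (fun z : ℂ => F (u + z)) 0 :=
      AnalyticAt.fun_comp (g := F) (f := fun z : ℂ => (u : ℂ) + z) (by simpa using L.analyticAt_F)
        (analyticAt_const.add analyticAt_id)
    exact (h1.sub analyticAt_const).sub (analyticAt_const.mul analyticAt_id)
  -- Subtracting the tangent line preserves maximality at real points, since its slope is real.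
  -- Strict convexity gives positivity on the reals.
  have key := iteratedDeriv_two_re_pos han (by simp) ?_ ?_ ?_
  · rw [iteratedDeriv_add_two_sub_affine L.analyticAt_F _ _ 0, zero_add, L.iteratedDeriv_F,
      Complex.ofReal_re] at key
    exact key
  · exact L.deriv_sub_tangent
  · filter_upwards [htends (Metric.ball_mem_nhds (u : ℂ) L.r_pos)] with z hz
    have hz' := L.ball_subset hz
    have h := L.F_re_le (u + z) hz'.1 hz'.2
    rw [Complex.add_re, Complex.ofReal_re, Complex.ofReal_add] at h
    simp only [Complex.sub_re, Complex.re_ofReal_mul, Complex.ofReal_re]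
    linarith
  · filter_upwards [Ioo_mem_nhdsGT L.r_pos] with x hx
    have hx' := L.strip (u + x) (by rw [add_sub_cancel_left, abs_of_pos hx.1]; exact hx.2.le)
    have h1 : F (u + x) = (Λ₀ (u + x) : ℝ) := by
      rw [← L.F_real _ hx'.1 hx'.2, Complex.ofReal_add]
    have h2 := hf.tangent_lt hu.1 hx'.1 hd (by linarith [hx.1])
    have h3 : F (u + x) - F u - (deriv Λ₀ u : ℝ) * x =
        ((Λ₀ (u + x) - Λ₀ u - deriv Λ₀ u * x : ℝ) : ℂ) := by
      rw [h1, hFu]; push_cast; ring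
    rw [h3, Complex.ofReal_re, Complex.ofReal_im]
    refine ⟨?_, rfl⟩
    rw [add_sub_cancel_left] at h2
    linarith

end LineData

end FwdStart

/-! ### The saddlepoint integral. -/

namespace FwdStart

variable {Ω : Type*} [MeasurableSpace Ω] {μ : Measure Ω} {Y : ℝ → Ω → ℝ} {Λ₀ Λ₁ Λ₂ : ℝ → ℝ}
  {S : Set ℝ} {u : ℝ} {F G : ℂ → ℂ} {r C K ε₀ : ℝ}

/-- The inversion integrand, centred at the saddlepoint. -/
noncomputable def saddleIntegrand (μ : Measure Ω) (Y : ℝ → Ω → ℝ) (F : ℂ → ℂ) (k u ε v : ℝ) : ℂ :=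
  Complex.exp ((F (u + v * Complex.I) - F u - k * (v * Complex.I)) / ε) *
    (mgfRatio μ Y F ε (u + v * Complex.I) *
      (((u : ℂ) + v * Complex.I) * ((u - ε : ℝ) + v * Complex.I))⁻¹)

namespace LineData

theorem continuous_F (L : LineData μ Y Λ₀ Λ₁ Λ₂ S u F G r C K ε₀) :
    Continuous fun v : ℝ => F (u + v * Complex.I) :=
  L.F_diff.continuousOn.comp_continuous (by fun_prop) fun v => by simpa using L.mem

theorem continuous_mgfRatio [IsProbabilityMeasure μ]
    (L : LineData μ Y Λ₀ Λ₁ Λ₂ S u F G r C K ε₀) {ε : ℝ} (hε : ε ∈ Ioo 0 ε₀) :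
    Continuous fun v : ℝ => mgfRatio μ Y F ε (u + v * Complex.I) := by
  have h := (differentiableOn_scaled_complexMGF L.isOpen hε.1
    (L.domain ε hε)).continuousOn.comp_continuous (f := fun v : ℝ => (u : ℂ) + v * Complex.I)
      (by fun_prop) fun v => by simpa using L.mem.1
  exact h.mul ((L.continuous_F.neg.div_const _).cexp)

theorem bound_nonneg (L : LineData μ Y Λ₀ Λ₁ Λ₂ S u F G r C K ε₀) : 0 ≤ C ∧ 0 ≤ K := by
  have h := L.ε₀_pos
  have hε : ε₀ / 2 ∈ Ioo 0 ε₀ := ⟨by linarith, by linarith⟩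
  refine ⟨(norm_nonneg _).trans (L.ratio_bound _ hε u (by simpa using L.r_pos.le)), ?_⟩
  have := (norm_nonneg _).trans (L.ratio_sub _ hε u (Metric.mem_ball_self L.r_pos))
  exact nonneg_of_mul_nonneg_left this hε.1

/-- The phase supplies `e^{-η/ε}`, the ratio is bounded, and the kernel decays quadratically because
`ε < |u|/4` keeps `u - ε` away from `0`. Positive `η` handles the tails, `η = 0` integrability. -/
theorem norm_saddleIntegrand_le (L : LineData μ Y Λ₀ Λ₁ Λ₂ S u F G r C K ε₀) (k : ℝ) {ε η v : ℝ}
    (hε : ε ∈ Ioo 0 (min ε₀ (|u| / 4)))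
    (hη : (F (u + v * Complex.I)).re ≤ Λ₀ u - η) :
    ‖saddleIntegrand μ Y F k u ε v‖ ≤
      C * ((min 1 (|u| / 2)) ^ 2)⁻¹ * Real.exp (-η / ε) * (1 + v ^ 2)⁻¹ := by
  have hu : 0 < |u| := abs_pos.2 L.mem.2
  have hε0 : ε ∈ Ioo 0 ε₀ := ⟨hε.1, hε.2.trans_le (min_le_left _ _)⟩
  have hεu : ε < |u| / 4 := hε.2.trans_le (min_le_right _ _)
  have hsub : |u| / 2 ≤ |u - ε| := by
    have := abs_sub_abs_le_abs_sub u ε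
    rw [abs_of_pos hε.1] at this
    linarith
  have h1 := norm_inv_mul_le (m := min 1 (|u| / 2)) (a := u) (b := u - ε) (by positivity)
    (min_le_left _ _) ((min_le_right _ _).trans (by linarith)) ((min_le_right _ _).trans hsub) v
  have h2 := L.ratio_bound ε hε0 (u + v * Complex.I) (by simpa using L.r_pos.le)
  have h3 : ‖Complex.exp ((F (u + v * Complex.I) - F u - k * (v * Complex.I)) / ε)‖ ≤
      Real.exp (-η / ε) := by
    rw [Complex.norm_exp, Complex.div_ofReal_re, L.F_real u L.mem.1 L.mem.2]
    have hpos := hε.1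
    gcongr
    simp
    linarith
  rw [saddleIntegrand, norm_mul, norm_mul]
  calc _ ≤ Real.exp (-η / ε) * (C * (((min 1 (|u| / 2)) ^ 2)⁻¹ * (1 + v ^ 2)⁻¹)) := by
        have := L.bound_nonneg.1
        gcongr
    _ = _ := by ring

theorem F_re_le_apply (L : LineData μ Y Λ₀ Λ₁ Λ₂ S u F G r C K ε₀) (v : ℝ) :
    (F (u + v * Complex.I)).re ≤ Λ₀ u := by
  have h := L.F_re_le (u + v * Complex.I) (by simpa using L.mem.1) (by simpa using L.mem.2)
  have hre : ((u : ℂ) + v * Complex.I).re = u := by simp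
  rwa [hre, L.F_real u L.mem.1 L.mem.2, Complex.ofReal_re] at h

theorem integrable_saddleIntegrand [IsProbabilityMeasure μ]
    (L : LineData μ Y Λ₀ Λ₁ Λ₂ S u F G r C K ε₀) (k : ℝ) {ε : ℝ}
    (hε : ε ∈ Ioo 0 (min ε₀ (|u| / 4))) :
    Integrable (saddleIntegrand μ Y F k u ε) := by
  have hu : 0 < |u| := abs_pos.2 L.mem.2
  have hεu : ε < |u| / 4 := hε.2.trans_le (min_le_right _ _)
  have hsub : u - ε ≠ 0 := by
    intro h
    rw [sub_eq_zero] at h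
    rw [h, abs_of_pos hε.1] at hεu
    linarith [hε.1]
  have hcont : Continuous (saddleIntegrand μ Y F k u ε) := by
    refine Continuous.mul ?_ (Continuous.mul (L.continuous_mgfRatio
      ⟨hε.1, hε.2.trans_le (min_le_left _ _)⟩) (continuous_inv_mul L.mem.2 hsub))
    refine (Continuous.div_const (Continuous.sub (L.continuous_F.sub continuous_const) ?_) _).cexp
    fun_prop
  refine Integrable.mono' (integrable_inv_one_add_sq.const_mul
    (C * ((min 1 (|u| / 2)) ^ 2)⁻¹)) hcont.aestronglyMeasurable (ae_of_all _ fun v => ?_)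
  have := L.norm_saddleIntegrand_le k hε (η := 0) (v := v) (by simpa using L.F_re_le_apply v)
  simpa using this

/-- Parametrizing the vertical line by `u + iz` turns the minimum of the tilted convex function
along the reals into a maximum: the second derivative becomes `-Λ₀''(u)`. -/
theorem iteratedDeriv_phase (L : LineData μ Y Λ₀ Λ₁ Λ₂ S u F G r C K ε₀) :
    let φ : ℂ → ℂ := fun z => F (u + Complex.I * z) - F u - (deriv Λ₀ u : ℝ) * (Complex.I * z)
    deriv φ 0 = 0 ∧ ∀ n : ℕ,
      iteratedDeriv (n + 2) φ 0 = Complex.I ^ (n + 2) * (iteratedDeriv (n + 2) Λ₀ u : ℝ) := by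
  intro φ
  have h : ∀ n, iteratedDeriv n φ 0 = Complex.I ^ n *
      iteratedDeriv n (fun z : ℂ => F (u + z) - F u - (deriv Λ₀ u : ℝ) * z) 0 := by
    intro n
    have := congrFun (iteratedDeriv_comp_add_mul
      (fun z : ℂ => F (u + z) - F u - (deriv Λ₀ u : ℝ) * z) 0 Complex.I n) 0
    simpa only [zero_add, mul_zero] using this
  refine ⟨?_, fun n => ?_⟩
  · have := h 1
    rwa [iteratedDeriv_one, iteratedDeriv_one, L.deriv_sub_tangent, mul_zero] at this
  · rw [h, iteratedDeriv_add_two_sub_affine L.analyticAt_F, L.iteratedDeriv_F]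

theorem deriv_amplitude (L : LineData μ Y Λ₀ Λ₁ Λ₂ S u F G r C K ε₀) :
    let q : ℂ → ℂ := fun z => G (u + Complex.I * z) *
      (((u : ℂ) + Complex.I * z) * (u + Complex.I * z))⁻¹
    iteratedDeriv 1 q 0 = Complex.I * (((Real.exp (Λ₁ u) * (u * u)⁻¹ *
        (deriv Λ₁ u - 2 / u) : ℝ)) : ℂ) ∧
      iteratedDeriv 2 q 0 = -(((Real.exp (Λ₁ u) * (u * u)⁻¹ *
        (iteratedDeriv 2 Λ₁ u + deriv Λ₁ u ^ 2 - 4 * deriv Λ₁ u / u + 6 / u ^ 2) : ℝ)) : ℂ) := by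
  intro q
  have hq : ∀ n, iteratedDeriv n q 0 = Complex.I ^ n *
      iteratedDeriv n (fun z => G z * (z * z)⁻¹) u := by
    intro n
    have := congrFun (iteratedDeriv_comp_add_mul (fun z => G z * (z * z)⁻¹) u Complex.I n) 0
    simpa only [mul_zero, add_zero] using this
  have hev : (fun z => G z * (z * z)⁻¹) =ᶠ[𝓝 (u : ℂ)]
      fun z => Complex.exp (Complex.log (G z)) * (z * z)⁻¹ := by
    have hne : G u ≠ 0 := by
      rw [L.G_apply]
      exact_mod_cast (Real.exp_pos _).ne'
    filter_upwards [L.analyticAt_G.continuousAt.eventually_ne hne] with z hz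
    rw [Complex.exp_log hz]
  have hd := deriv_cexp_mul_inv_sq L.analyticAt_log
    (show (u : ℂ) ≠ 0 from Complex.ofReal_ne_zero.2 L.mem.2)
  have hexp : Complex.exp (Complex.log (G u)) = (Real.exp (Λ₁ u) : ℝ) := by
    rw [L.eventually_log_eq.self_of_nhds, Complex.ofReal_exp]
  rw [L.deriv_log.1, L.deriv_log.2, hexp] at hd
  refine ⟨?_, ?_⟩
  · rw [hq, hev.iteratedDeriv_eq, iteratedDeriv_one, hd.1]
    push_cast
    ring
  · rw [hq, hev.iteratedDeriv_eq, hd.2, Complex.I_sq]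
    push_cast
    ring

/-- The coefficient match required by `isBigO_laplace_quotient`, after the powers of `i` have been
evaluated. The extra `1/u` comes from `1/(u(u-ε)) = u⁻²(1 + ε/u + O(ε²))`. -/
theorem mul_Upsilon_add (hu : u ≠ 0) (ha : 0 < iteratedDeriv 2 Λ₀ u) (P : ℝ) :
    P * (Upsilon Λ₀ Λ₁ Λ₂ 0 u + 1 / u) = P * (Λ₂ u + 1 / u) +
      (P * (iteratedDeriv 4 Λ₀ u / (8 * iteratedDeriv 2 Λ₀ u ^ 2)
          - 5 * iteratedDeriv 3 Λ₀ u ^ 2 / (24 * iteratedDeriv 2 Λ₀ u ^ 3))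
        + P * (deriv Λ₁ u - 2 / u) * iteratedDeriv 3 Λ₀ u / (2 * iteratedDeriv 2 Λ₀ u ^ 2)
        - P * (iteratedDeriv 2 Λ₁ u + deriv Λ₁ u ^ 2 - 4 * deriv Λ₁ u / u + 6 / u ^ 2)
          / (2 * iteratedDeriv 2 Λ₀ u)) := by
  have ha' := ha.ne'
  rw [Upsilon]
  generalize iteratedDeriv 2 Λ₀ u = a at *
  generalize iteratedDeriv 3 Λ₀ u = b at *
  generalize iteratedDeriv 4 Λ₀ u = c at *
  rw [sub_zero]
  field_simp
  ring

end LineData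

end FwdStart

/-- Comparison of `1 / (w (w - ε))` with `1 / w²`. -/
theorem norm_amplitude_sub_le {g G w : ℂ} {ε m K B : ℝ} (hm : 0 < m) (hε : 0 ≤ ε)
    (hw : m ≤ ‖w‖) (hw' : m ≤ ‖w - ε‖) (hg : ‖g - G‖ ≤ K * ε) (hG : ‖G‖ ≤ B) :
    ‖g * (w * (w - ε))⁻¹ - G * (w * w)⁻¹‖ ≤ (K * (m * m)⁻¹ + B * (m * m * m)⁻¹) * ε := by
  have h0 : w ≠ 0 := norm_pos_iff.1 (hm.trans_le hw)
  have h0' : w - ε ≠ 0 := norm_pos_iff.1 (hm.trans_le hw')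
  have e : g * (w * (w - ε))⁻¹ - G * (w * w)⁻¹ =
      (g - G) * (w * (w - ε))⁻¹ + G * (ε * (w * w * (w - ε))⁻¹) := by
    field_simp
    ring
  rw [e]
  have hKε : 0 ≤ K * ε := (norm_nonneg _).trans hg
  have hB : 0 ≤ B := (norm_nonneg _).trans hG
  calc _ ≤ ‖(g - G) * (w * (w - ε))⁻¹‖ + ‖G * (ε * (w * w * (w - ε))⁻¹)‖ := norm_add_le _ _
    _ = ‖g - G‖ * (‖w‖ * ‖w - ε‖)⁻¹ + ‖G‖ * (ε * (‖w‖ * ‖w‖ * ‖w - ε‖)⁻¹) := by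
      simp only [norm_mul, norm_inv, Complex.norm_real, Real.norm_of_nonneg hε]
    _ ≤ K * ε * (m * m)⁻¹ + B * (ε * (m * m * m)⁻¹) := by gcongr
    _ = _ := by ring

/-- Expansion of `g / (u (u - ε))` at a real point. -/
theorem isBigO_mul_inv_mul {g : ℝ → ℂ} {P Q u : ℝ} (hu : u ≠ 0)
    (hg : (fun ε : ℝ => g ε - ((P : ℂ) + ((P * Q : ℝ) : ℂ) * ε)) =O[𝓝[>] 0] fun ε : ℝ => ε ^ 2) :
    (fun ε : ℝ => g ε * ((u : ℂ) * ((u - ε : ℝ) : ℂ))⁻¹ - (((P * (u * u)⁻¹ : ℝ) : ℂ) +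
      ((P * (u * u)⁻¹ : ℝ) : ℂ) * ((Q + 1 / u : ℝ) : ℂ) * ε)) =O[𝓝[>] 0] fun ε : ℝ => ε ^ 2 := by
  have htend : Tendsto (fun ε : ℝ => u - ε) (𝓝[>] 0) (𝓝 u) := by
    have : Tendsto (fun ε : ℝ => u - ε) (𝓝 0) (𝓝 (u - 0)) :=
      (continuous_const.sub continuous_id).tendsto 0
    rw [sub_zero] at this
    exact this.mono_left nhdsWithin_le_nhds
  have hinv : (fun ε : ℝ => ((u - ε : ℝ) : ℂ)⁻¹) =O[𝓝[>] 0] fun _ => (1 : ℝ) :=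
    ((Complex.continuous_ofReal.tendsto u).comp htend).inv₀
      (Complex.ofReal_ne_zero.2 hu) |>.isBigO_one ℝ
  have h1 := (hg.mul (hinv.const_mul_left (u : ℂ)⁻¹)).congr_right fun ε => mul_one _
  have hsq : (fun ε : ℝ => (ε : ℂ) ^ 2) =O[𝓝[>] 0] fun ε : ℝ => ε ^ 2 :=
    IsBigO.of_norm_left (by
      simpa using (isBigO_refl (fun ε : ℝ => ε ^ 2) (𝓝[>] 0)).norm_left)
  have h2 := ((hsq.mul hinv).const_mul_left
    ((P : ℂ) * (Q + 1 / u) * ((u : ℂ) * u)⁻¹)).congr_right fun ε => mul_one _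
  refine (h1.add h2).congr' ?_ EventuallyEq.rfl
  filter_upwards [htend.eventually_ne hu] with ε hε
  have hu' : (u : ℂ) ≠ 0 := Complex.ofReal_ne_zero.2 hu
  have hε' : (u : ℂ) - ε ≠ 0 := by
    rw [← Complex.ofReal_sub]
    exact Complex.ofReal_ne_zero.2 hε
  push_cast
  field_simp
  ring

namespace FwdStart

variable {Ω : Type*} [MeasurableSpace Ω] {μ : Measure Ω} {Y : ℝ → Ω → ℝ} {Λ₀ Λ₁ Λ₂ : ℝ → ℝ}
  {S : Set ℝ} {u : ℝ} {F G : ℂ → ℂ} {r C K ε₀ : ℝ}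

namespace LineData

/-- Saddlepoint expansion of the inversion integral. -/
theorem isBigO_integral_saddleIntegrand [IsProbabilityMeasure μ]
    (L : LineData μ Y Λ₀ Λ₁ Λ₂ S u F G r C K ε₀) (hf : StrictConvexOn ℝ S Λ₀) :
    (fun ε : ℝ => (∫ v, saddleIntegrand μ Y F (deriv Λ₀ u) u ε v) /
      ((Real.sqrt (2 * Real.pi * ε / iteratedDeriv 2 Λ₀ u) : ℂ) *
        ((Real.exp (Λ₁ u) * (u * u)⁻¹ : ℝ) : ℂ)) -
      (1 + ((Upsilon Λ₀ Λ₁ Λ₂ 0 u + 1 / u : ℝ) : ℂ) * ε)) =O[𝓝[>] 0] fun ε : ℝ => ε ^ 2 := by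
  have hu := L.mem
  have hu0 : 0 < |u| := abs_pos.2 hu.2
  have hapos := L.iteratedDeriv_two_pos hf
  obtain ⟨hC, hK⟩ := L.bound_nonneg
  set φ : ℂ → ℂ := fun z => F (u + Complex.I * z) - F u - (deriv Λ₀ u : ℝ) * (Complex.I * z)
    with hφ
  set p : ℝ → ℂ → ℂ := fun ε z => mgfRatio μ Y F ε (u + Complex.I * z) *
    (((u : ℂ) + Complex.I * z) * ((u + Complex.I * z) - ε))⁻¹ with hp
  set q : ℂ → ℂ := fun z => G (u + Complex.I * z) *
    (((u : ℂ) + Complex.I * z) * (u + Complex.I * z))⁻¹ with hq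
  -- Together with `ε < |u|/4` this keeps both factors of the kernel at least `m = |u|/2` in modulus
  -- on the disc.
  set δ := min (|u| / 4) r with hδdef
  set ε₁ := min ε₀ (|u| / 4) with hε₁def
  set m := |u| / 2 with hm
  have hδ : 0 < δ := lt_min (by positivity) L.r_pos
  have hε₁ : 0 < ε₁ := lt_min L.ε₀_pos (by positivity)
  have hmpos : 0 < m := by positivity
  have hmem : ∀ ε ∈ Ioo 0 ε₁, ε ∈ Ioo 0 ε₀ := fun ε hε => ⟨hε.1, hε.2.trans_le (min_le_left _ _)⟩
  have hball : MapsTo (fun z : ℂ => (u : ℂ) + Complex.I * z) (Metric.ball 0 δ)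
      (Metric.ball (u : ℂ) r) := by
    intro z hz
    rw [mem_ball_zero_iff] at hz
    rw [Metric.mem_ball, dist_eq_norm, add_sub_cancel_left, norm_mul, Complex.norm_I, one_mul]
    exact hz.trans_le (min_le_right _ _)
  have hnorm : ∀ z ∈ Metric.ball (0 : ℂ) δ, 3 / 4 * |u| ≤ ‖(u : ℂ) + Complex.I * z‖ := by
    intro z hz
    rw [mem_ball_zero_iff] at hz
    have h1 := norm_sub_le_norm_add (u : ℂ) (Complex.I * z)
    rw [norm_mul, Complex.norm_I, one_mul, Complex.norm_real, Real.norm_eq_abs] at h1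
    linarith [min_le_left (|u| / 4) r]
  have hw : ∀ z ∈ Metric.ball (0 : ℂ) δ, m ≤ ‖(u : ℂ) + Complex.I * z‖ := fun z hz =>
    le_trans (by rw [hm]; linarith) (hnorm z hz)
  have hw' : ∀ ε ∈ Ioo 0 ε₁, ∀ z ∈ Metric.ball (0 : ℂ) δ,
      m ≤ ‖(u : ℂ) + Complex.I * z - ε‖ := by
    intro ε hε z hz
    have h1 := norm_sub_norm_le ((u : ℂ) + Complex.I * z) ε
    rw [Complex.norm_real, Real.norm_of_nonneg hε.1.le] at h1
    have h2 : ε < |u| / 4 := hε.2.trans_le (min_le_right _ _)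
    have := hnorm z hz
    rw [hm]
    linarith
  have haff : Differentiable ℂ fun z : ℂ => (u : ℂ) + Complex.I * z := by fun_prop
  have hφd : DifferentiableOn ℂ φ (Metric.ball 0 δ) := by
    refine (((L.F_diff.mono L.ball_subset).comp haff.differentiableOn hball).sub_const _).sub ?_
    exact Differentiable.differentiableOn (by fun_prop)
  have hpd : ∀ ε ∈ Ioo 0 ε₁, DifferentiableOn ℂ (p ε) (Metric.ball 0 δ) := by
    intro ε hε
    have h1 : DifferentiableOn ℂ (mgfRatio μ Y F ε) (Metric.ball (u : ℂ) r) :=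
      ((differentiableOn_scaled_complexMGF L.isOpen hε.1 (L.domain ε (hmem ε hε))).mono
        fun z hz => (L.ball_subset hz).1).mul
          (((L.F_diff.mono L.ball_subset).neg.div_const _).cexp)
    refine (h1.comp haff.differentiableOn hball).mul (DifferentiableOn.inv
      (Differentiable.differentiableOn (by fun_prop)) fun z hz => ?_)
    exact mul_ne_zero (norm_pos_iff.1 (hmpos.trans_le (hw z hz)))
      (norm_pos_iff.1 (hmpos.trans_le (hw' ε hε z hz)))
  have hqd : DifferentiableOn ℂ q (Metric.ball 0 δ) := by
    refine (L.G_diff.comp haff.differentiableOn hball).mul (DifferentiableOn.inv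
      (Differentiable.differentiableOn (by fun_prop)) fun z hz => ?_)
    exact mul_ne_zero (norm_pos_iff.1 (hmpos.trans_le (hw z hz)))
      (norm_pos_iff.1 (hmpos.trans_le (hw z hz)))
  have hgC : ∀ ε ∈ Ioo 0 ε₁, ∀ z ∈ Metric.ball (0 : ℂ) δ,
      ‖mgfRatio μ Y F ε (u + Complex.I * z)‖ ≤ C := fun ε hε z hz =>
    L.ratio_bound ε (hmem ε hε) _ (abs_re_sub_lt_of_mem_ball (hball hz)).le
  have hpC : ∀ ε ∈ Ioo 0 ε₁, ∀ z ∈ Metric.ball (0 : ℂ) δ, ‖p ε z‖ ≤ C * (m * m)⁻¹ := by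
    intro ε hε z hz
    rw [hp, norm_mul, norm_inv, norm_mul]
    have h1 := hw z hz
    have h2 := hw' ε hε z hz
    have h3 := hgC ε hε z hz
    gcongr
  have hpq : ∀ ε ∈ Ioo 0 ε₁, ∀ z ∈ Metric.ball (0 : ℂ) δ,
      ‖p ε z - q z‖ ≤ (K * (m * m)⁻¹ + (C + K * ε₁) * (m * m * m)⁻¹) * ε := by
    intro ε hε z hz
    have h3 := hgC ε hε z hz
    have h4 := L.ratio_sub ε (hmem ε hε) _ (hball hz)
    -- `G` is bounded by `C + K ε₁`, from the bound on the ratio and its distance to `G`.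
    refine norm_amplitude_sub_le hmpos hε.1.le (hw z hz) (hw' ε hε z hz) h4 ?_
    have h5 := norm_sub_norm_le (G (u + Complex.I * z)) (mgfRatio μ Y F ε (u + Complex.I * z))
    rw [norm_sub_rev] at h5
    have h6 : K * ε ≤ K * ε₁ := mul_le_mul_of_nonneg_left hε.2.le hK
    linarith
  obtain ⟨hφ1, hφn⟩ := L.iteratedDeriv_phase
  obtain ⟨hq1, hq2⟩ := L.deriv_amplitude
  have hφ2 : iteratedDeriv 2 φ 0 = -((iteratedDeriv 2 Λ₀ u : ℝ) : ℂ) := by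
    have := hφn 0
    rw [zero_add, Complex.I_sq, neg_one_mul] at this
    exact this
  have hφ3 : iteratedDeriv 3 φ 0 = -Complex.I * ((iteratedDeriv 3 Λ₀ u : ℝ) : ℂ) := by
    have := hφn 1
    rw [show 1 + 2 = 3 from rfl, Complex.I_pow_three] at this
    exact this
  have hφ4 : iteratedDeriv 4 φ 0 = ((iteratedDeriv 4 Λ₀ u : ℝ) : ℂ) := by
    have := hφn 2
    rw [show 2 + 2 = 4 from rfl, Complex.I_pow_four, one_mul] at this
    exact this
  have hJ : ∀ ε ∈ Ioo 0 ε₁, ∀ v : ℝ, |v| < δ → saddleIntegrand μ Y F (deriv Λ₀ u) u ε v =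
      Complex.exp (φ v / ε) * p ε v := by
    intro ε _ v _
    rw [saddleIntegrand, hφ, hp]
    simp only [mul_comm Complex.I]
    congr 4
    push_cast
    ring
  have htail : ∀ δ' > 0, ∃ η > 0, ∃ B : ℝ, ∀ ε ∈ Ioo 0 ε₁, ∀ v : ℝ, δ' ≤ |v| →
      ‖saddleIntegrand μ Y F (deriv Λ₀ u) u ε v‖ ≤ B * Real.exp (-η / ε) * (1 + v ^ 2)⁻¹ := by
    intro δ' hδ'
    obtain ⟨η, hη, hgap⟩ := L.F_re_gap δ' hδ'
    exact ⟨η, hη, _, fun ε hε v hv => L.norm_saddleIntegrand_le _ hε (hgap v hv)⟩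
  have hI := laplace_expansion hapos hδ hε₁ hφd (by simp [hφ]) hφ1 hφ2 hpd hpC hJ
    (fun ε hε => L.integrable_saddleIntegrand _ hε) htail
  refine isBigO_laplace_quotient hapos ?_ ?_
    (isBigO_iteratedDeriv_sub hδ hε₁ hpd hqd hpq 1)
    (isBigO_iteratedDeriv_sub hδ hε₁ hpd hqd hpq 2)
    (κ := ((Λ₂ u + 1 / u : ℝ) : ℂ)) (p₀ := fun ε => p ε 0) ?_
    (by simpa only [iteratedDeriv_one] using hI)
  · exact Complex.ofReal_ne_zero.2 (mul_ne_zero (Real.exp_pos _).ne'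
      (inv_ne_zero (mul_ne_zero hu.2 hu.2)))
  · have := isBigO_mul_inv_mul hu.2 L.ratio_exp
    simpa only [hp, mul_zero, add_zero, Complex.ofReal_sub] using this
  · have h := congrArg (fun x : ℝ => (x : ℂ)) (mul_Upsilon_add (Λ₁ := Λ₁) (Λ₂ := Λ₂) hu.2 hapos
      (Real.exp (Λ₁ u) * (u * u)⁻¹))
    rw [hq1, hq2, hφ3, hφ4]
    have hI2 := Complex.I_sq
    simp only [Complex.ofReal_add, Complex.ofReal_mul, Complex.ofReal_sub, Complex.ofReal_div,
      Complex.ofReal_pow, Complex.ofReal_ofNat, Complex.ofReal_one, Complex.ofReal_inv] at h ⊢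
    rw [h]
    have e : (-Complex.I * ((iteratedDeriv 3 Λ₀ u : ℝ) : ℂ)) ^ 2 =
        -((iteratedDeriv 3 Λ₀ u : ℝ) : ℂ) ^ 2 := by
      rw [mul_pow, neg_sq, hI2, neg_one_mul]
    have e2 : ∀ x y : ℂ, Complex.I * x * (-Complex.I * y) = x * y := fun x y => by
      linear_combination (-x * y) * hI2
    rw [e, e2]
    ring

end LineData

end FwdStart

/-! ### From the integral to option prices. -/

theorem mul_sqrt_two_pi_div {ε a : ℝ} (hε : 0 < ε) (ha : 0 < a) :
    ε * (2 * Real.pi)⁻¹ * Real.sqrt (2 * Real.pi * ε / a) =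
      ε ^ (3 / 2 : ℝ) / Real.sqrt (2 * Real.pi * a) := by
  have hpi := Real.pi_pos
  have h1 : Real.sqrt (2 * Real.pi * ε / a) * Real.sqrt (2 * Real.pi * a) =
      2 * Real.pi * Real.sqrt ε := by
    rw [← Real.sqrt_mul (by positivity), show 2 * Real.pi * ε / a * (2 * Real.pi * a) =
      (2 * Real.pi) ^ 2 * ε by field_simp, Real.sqrt_mul (by positivity),
      Real.sqrt_sq (by positivity)]
  have h2 : ε ^ (3 / 2 : ℝ) = ε * Real.sqrt ε := by
    rw [Real.sqrt_eq_rpow, ← Real.rpow_one_add' hε.le (by norm_num)]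
    norm_num
  have h3 : 0 < Real.sqrt (2 * Real.pi * a) := Real.sqrt_pos.2 (by positivity)
  rw [eq_div_iff h3.ne', mul_assoc, h1, h2]
  field_simp

namespace FwdStart

variable {Ω : Type*} [MeasurableSpace Ω] {μ : Measure Ω} {Y : ℝ → Ω → ℝ} {Λ₀ Λ₁ Λ₂ : ℝ → ℝ}
  {S : Set ℝ} {u : ℝ} {F G : ℂ → ℂ} {r C K ε₀ : ℝ}

/-- The factor taken out becomes `e^{-Λ*(k)/ε}` at the saddlepoint, by `legendre_eq`. -/
theorem complexMGF_mul_exp_eq_saddleIntegrand (k u ε v : ℝ) :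
    complexMGF (Y ε) μ ((u + v * Complex.I) / ε) *
        Complex.exp (-((u + v * Complex.I) / ε) * k) *
        (((u : ℂ) + v * Complex.I) * ((u - ε : ℝ) + v * Complex.I))⁻¹ =
      Complex.exp ((F u - u * k) / ε) * saddleIntegrand μ Y F k u ε v := by
  rw [saddleIntegrand, mgfRatio]
  have e : Complex.exp (-((u + v * Complex.I) / ε) * k) = Complex.exp ((F u - u * k) / ε) *
      (Complex.exp ((F (u + v * Complex.I) - F u - k * (v * Complex.I)) / ε) *
        Complex.exp (-F (u + v * Complex.I) / ε)) := by
    rw [← Complex.exp_add, ← Complex.exp_add]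
    congr 1
    ring
  rw [e]
  ring

/-- Call and put enter only through the normalized payoff `h` and its transform, so this covers
both. -/
theorem LineData.priceExpansion [IsProbabilityMeasure μ]
    (L : LineData μ Y Λ₀ Λ₁ Λ₂ S u F G r C K ε₀) (hf : StrictConvexOn ℝ S Λ₀) {k : ℝ}
    (hk : deriv Λ₀ u = k) (hY : ∀ ε > 0, Measurable (Y ε)) {g h : ℝ → ℝ} (hc : Continuous h)
    (hg : ∀ y, g y = Real.exp k * h (y - k))
    (hgi : ∀ᶠ ε in 𝓝[>] (0 : ℝ), Integrable (fun w => g (Y ε w)) μ)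
    (hF : ∀ᶠ ε in 𝓝[>] (0 : ℝ), (Integrable fun x => h x * Real.exp (-(u / ε) * x)) ∧
      ∀ v : ℝ, ∫ x : ℝ, Complex.exp (-((u / ε : ℝ) + v * Complex.I) * x) * (h x : ℂ) =
        (((u / ε : ℝ) + v * Complex.I) * ((u / ε - 1 : ℝ) + v * Complex.I))⁻¹) :
    PriceExpansion μ Y Λ₀ Λ₁ Λ₂ S k u g := by
  have hu := L.mem
  have ha := L.iteratedDeriv_two_pos hf
  have hleg : legendre Λ₀ S k = u * k - Λ₀ u :=
    legendre_eq hf (L.contDiffAt_limit.differentiableAt (by simp)) ⟨hu.1, hk⟩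
  have hlead : ∀ ε > 0, leading Λ₀ Λ₁ S k u ε = Real.exp k * (ε * (2 * Real.pi)⁻¹ *
      (Real.exp ((Λ₀ u - u * k) / ε) * (Real.sqrt (2 * Real.pi * ε / iteratedDeriv 2 Λ₀ u) *
        (Real.exp (Λ₁ u) * (u * u)⁻¹)))) := by
    intro ε hε
    have h1 := mul_sqrt_two_pi_div hε ha
    have h2 : 0 < Real.sqrt (2 * Real.pi * iteratedDeriv 2 Λ₀ u) :=
      Real.sqrt_pos.2 (by have := Real.pi_pos; positivity)
    rw [leading, hleg, Real.exp_add, Real.exp_add, neg_sub]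
    calc _ = Real.exp k * Real.exp ((Λ₀ u - u * k) / ε) * Real.exp (Λ₁ u) * (u * u)⁻¹ *
        (ε ^ (3 / 2 : ℝ) / Real.sqrt (2 * Real.pi * iteratedDeriv 2 Λ₀ u)) := by
          field_simp [hu.2]
      _ = _ := by rw [← h1]; ring
  have hleadpos : ∀ ε > 0, leading Λ₀ Λ₁ S k u ε ≠ 0 := by
    intro ε hε
    have := hu.2
    have := mul_self_pos.2 hu.2
    rw [leading]
    have hpi := Real.pi_pos
    positivity
  -- The remainder is defined as the exact relative error. The identity is then immediate since the
  -- leading term is nonzero, and the content lies in the bound.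
  refine ⟨hgi, fun ε => (∫ w, g (Y ε w) ∂μ) / leading Λ₀ Λ₁ S k u ε -
    (1 + (Upsilon Λ₀ Λ₁ Λ₂ 0 u + 1 / u) * ε), ?_, ?_⟩
  · have hmain := L.isBigO_integral_saddleIntegrand hf
    refine IsBigO.of_norm_left ?_
    refine (hmain.norm_left).congr' ?_ EventuallyEq.rfl
    filter_upwards [hF, Ioo_mem_nhdsGT L.ε₀_pos, Ioo_mem_nhdsGT (abs_pos.2 hu.2)]
      with ε hε hεL hεu
    have hε0 : 0 < ε := hεL.1
    have huε : u - ε ≠ 0 := by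
      intro h0
      rw [sub_eq_zero] at h0
      rw [h0, abs_of_pos hε0] at hεu
      exact lt_irrefl _ hεu.2
    have hexp : Integrable (fun w => Real.exp (u / ε * Y ε w)) μ := L.domain ε hεL hu.1
    have hprice := integral_payoff_eq_rescaled (hY ε hε0) hc hε0 hu.2 huε hε.1 hε.2 hexp k
    simp_rw [complexMGF_mul_exp_eq_saddleIntegrand (F := F)] at hprice
    rw [integral_const_mul, L.F_real u hu.1 hu.2] at hprice
    have hgint : ∫ w, g (Y ε w) ∂μ = Real.exp k * ∫ w, h (Y ε w - k) ∂μ := by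
      rw [← integral_const_mul]
      exact integral_congr_ae (ae_of_all _ fun w => hg _)
    have hE : ((Real.exp ((Λ₀ u - u * k) / ε) : ℝ) : ℂ) =
        Complex.exp (((Λ₀ u : ℝ) - (u : ℂ) * k) / ε) := by push_cast; rfl
    rw [← hE] at hprice
    have hcast : (((∫ w, g (Y ε w) ∂μ) / leading Λ₀ Λ₁ S k u ε -
        (1 + (Upsilon Λ₀ Λ₁ Λ₂ 0 u + 1 / u) * ε) : ℝ) : ℂ) =
        (∫ v, saddleIntegrand μ Y F (deriv Λ₀ u) u ε v) /
      ((Real.sqrt (2 * Real.pi * ε / iteratedDeriv 2 Λ₀ u) : ℂ) *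
        ((Real.exp (Λ₁ u) * (u * u)⁻¹ : ℝ) : ℂ)) -
      (1 + ((Upsilon Λ₀ Λ₁ Λ₂ 0 u + 1 / u : ℝ) : ℂ) * ε) := by
      have h1 : (((∫ w, g (Y ε w) ∂μ) / leading Λ₀ Λ₁ S k u ε : ℝ) : ℂ) =
          (∫ v, saddleIntegrand μ Y F (deriv Λ₀ u) u ε v) /
      ((Real.sqrt (2 * Real.pi * ε / iteratedDeriv 2 Λ₀ u) : ℂ) *
        ((Real.exp (Λ₁ u) * (u * u)⁻¹ : ℝ) : ℂ)) := by
        rw [hlead ε hε0, hgint, hk, Complex.ofReal_div, Complex.ofReal_mul, hprice,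
          Complex.ofReal_mul (Real.exp k),
          mul_div_mul_left _ _ (Complex.ofReal_ne_zero.2 (Real.exp_pos k).ne'),
          Complex.ofReal_mul (ε * (2 * Real.pi)⁻¹), Complex.ofReal_mul ε,
          mul_div_mul_left _ _ (mul_ne_zero (Complex.ofReal_ne_zero.2 hε0.ne')
            (Complex.ofReal_ne_zero.2 (by have := Real.pi_pos; positivity))),
          Complex.ofReal_mul (Real.exp ((Λ₀ u - u * k) / ε)),
          mul_div_mul_left _ _ (Complex.ofReal_ne_zero.2 (Real.exp_pos _).ne'),
          Complex.ofReal_mul (Real.sqrt _)]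
      rw [Complex.ofReal_sub, h1]
      push_cast
      rfl
    rw [← hcast, Complex.norm_real]
  · filter_upwards [self_mem_nhdsWithin] with ε hε
    have h0 := hleadpos ε hε
    rw [add_sub_cancel, mul_div_cancel₀ _ h0]

theorem callPayoff_eq (k y : ℝ) :
    callPayoff k y = Real.exp k * max (Real.exp (y - k) - 1) 0 := by
  rw [mul_max_of_nonneg _ _ (Real.exp_pos k).le, mul_sub, ← Real.exp_add, mul_zero, mul_one,
    add_sub_cancel, callPayoff]

theorem putPayoff_eq (k y : ℝ) :
    putPayoff k y = Real.exp k * max (1 - Real.exp (y - k)) 0 := by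
  rw [mul_max_of_nonneg _ _ (Real.exp_pos k).le, mul_sub, ← Real.exp_add, mul_zero, mul_one,
    add_sub_cancel, putPayoff]

/-- For `β ≥ 1`, `e^y ≤ 1 + e^{βy}`. -/
theorem integrable_callPayoff [IsFiniteMeasure μ] {Z : Ω → ℝ} (hZ : Measurable Z) {β : ℝ}
    (hβ : 1 ≤ β) (hexp : Integrable (fun w => Real.exp (β * Z w)) μ) (k : ℝ) :
    Integrable (fun w => callPayoff k (Z w)) μ := by
  refine Integrable.mono' ((integrable_const (1 : ℝ)).add hexp) ?_ (ae_of_all _ fun w => ?_)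
  · exact ((hZ.exp.sub_const _).max measurable_const).aestronglyMeasurable
  · have h0 : 0 ≤ callPayoff k (Z w) := le_max_right _ _
    rw [Real.norm_of_nonneg h0, Pi.add_apply]
    have hk := Real.exp_pos k
    have hb := Real.exp_pos (β * Z w)
    refine max_le ?_ (by positivity)
    rcases le_total (Z w) 0 with h | h
    · have := Real.exp_le_one_iff.2 h
      linarith
    · have : Real.exp (Z w) ≤ Real.exp (β * Z w) := Real.exp_le_exp.2 (by nlinarith)
      linarith

theorem integrable_putPayoff [IsFiniteMeasure μ] {Z : Ω → ℝ} (hZ : Measurable Z) (k : ℝ) :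
    Integrable (fun w => putPayoff k (Z w)) μ := by
  refine Integrable.mono' (integrable_const (Real.exp k)) ?_ (ae_of_all _ fun w => ?_)
  · exact ((measurable_const.sub hZ.exp).max measurable_const).aestronglyMeasurable
  · have h0 : 0 ≤ putPayoff k (Z w) := le_max_right _ _
    rw [Real.norm_of_nonneg h0]
    exact max_le (by linarith [Real.exp_pos (Z w)]) (Real.exp_pos k).le

theorem LineData.priceExpansion_call [IsProbabilityMeasure μ]
    (L : LineData μ Y Λ₀ Λ₁ Λ₂ S u F G r C K ε₀) (hf : StrictConvexOn ℝ S Λ₀) {k : ℝ}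
    (hk : deriv Λ₀ u = k) (hY : ∀ ε > 0, Measurable (Y ε)) (hu : 0 < u) :
    PriceExpansion μ Y Λ₀ Λ₁ Λ₂ S k u (callPayoff k) := by
  -- Once `ε < u`, the rescaled line lies to the right of the pole at `1`, as the call transform
  -- requires.
  have hev : ∀ᶠ ε in 𝓝[>] (0 : ℝ), 1 < u / ε := by
    filter_upwards [Ioo_mem_nhdsGT hu] with ε hε
    rw [one_lt_div hε.1]
    exact hε.2
  refine L.priceExpansion hf hk hY (h := fun x => max (Real.exp x - 1) 0) (by fun_prop)
    (callPayoff_eq k) ?_ (hev.mono fun ε hε => call_fourier_transform hε)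
  filter_upwards [hev, Ioo_mem_nhdsGT L.ε₀_pos] with ε hε hε₀
  exact integrable_callPayoff (hY ε hε₀.1) hε.le (L.domain ε hε₀ L.mem.1) k

theorem LineData.priceExpansion_put [IsProbabilityMeasure μ]
    (L : LineData μ Y Λ₀ Λ₁ Λ₂ S u F G r C K ε₀) (hf : StrictConvexOn ℝ S Λ₀) {k : ℝ}
    (hk : deriv Λ₀ u = k) (hY : ∀ ε > 0, Measurable (Y ε)) (hu : u < 0) :
    PriceExpansion μ Y Λ₀ Λ₁ Λ₂ S k u (putPayoff k) := by
  have hpos : ∀ᶠ ε in 𝓝[>] (0 : ℝ), 0 < ε := self_mem_nhdsWithin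
  exact L.priceExpansion hf hk hY (h := fun x => max (1 - Real.exp x) 0) (by fun_prop)
    (putPayoff_eq k) (hpos.mono fun ε hε => integrable_putPayoff (hY ε hε) k)
    (hpos.mono fun ε hε => put_fourier_transform (div_neg_of_neg_of_pos hu hε))

end FwdStart

theorem corollary2p7 {Ω : Type*} [MeasurableSpace Ω] (μ : MeasureTheory.Measure Ω)
    [MeasureTheory.IsProbabilityMeasure μ]
    (X : ℝ → Ω → ℝ) (hX : ∀ s, 0 ≤ s → Measurable (X s))
    (t τ : ℝ) (ht : 0 ≤ t) (hτ : 0 < τ)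
    (Λ₀ Λ₁ Λ₂ : ℝ → ℝ)
    (h : FwdStart.StandingAssumptions μ (FwdStart.diagFwd X t τ) Λ₀ Λ₁ Λ₂) :
    let S : Set ℝ := interior (FwdStart.limDomain μ (FwdStart.diagFwd X t τ))
    (BddAbove S → ∀ k : ℝ, deriv Λ₀ 0 < k → ∃ u, FwdStart.IsSaddlepoint Λ₀ S k u) ∧
    (BddBelow S → ∀ k : ℝ, k < deriv Λ₀ 0 → ∃ u, FwdStart.IsSaddlepoint Λ₀ S k u) ∧
    ∀ k u : ℝ, k ≠ deriv Λ₀ 0 → FwdStart.IsSaddlepoint Λ₀ S k u →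
      (∀ v, FwdStart.IsSaddlepoint Λ₀ S k v → v = u) ∧
      ContDiffAt ℝ (⊤ : ℕ∞) Λ₀ u ∧ ContDiffAt ℝ (⊤ : ℕ∞) Λ₁ u ∧
      u ≠ 0 ∧ 0 < iteratedDeriv 2 Λ₀ u ∧
      (deriv Λ₀ 0 < k →
        FwdStart.PriceExpansion μ (FwdStart.diagFwd X t τ) Λ₀ Λ₁ Λ₂ S k u
          (FwdStart.callPayoff k)) ∧
      (k < deriv Λ₀ 0 →
        FwdStart.PriceExpansion μ (FwdStart.diagFwd X t τ) Λ₀ Λ₁ Λ₂ S k u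
          (FwdStart.putPayoff k)) := by
  intro S
  have hS : IsOpen S := isOpen_interior
  have hmono : StrictMonoOn (deriv Λ₀) S := h.strictConvex.strictMonoOn_deriv
    fun x hx => (h.essSmooth.differentiable x hx).differentiableAt (hS.mem_nhds hx)
  have hY : ∀ ε > 0, Measurable (FwdStart.diagFwd X t τ ε) := fun ε hε =>
    (hX _ (by positivity)).sub (hX _ (by positivity))
  refine ⟨fun hb k hk => exists_saddlepoint_of_bddAbove hS h.strictConvex h.essSmooth h.zero_mem
      hb hk,
    fun hb k hk => exists_saddlepoint_of_bddBelow hS h.strictConvex h.essSmooth h.zero_mem hb hk,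
    fun k u hk hu => ?_⟩
  have hu0 : u ≠ 0 := by
    rintro rfl
    exact hk hu.2.symm
  obtain ⟨F, G, r, C, K, ε₀, L⟩ := h.exists_lineData hu.1 hu0
  refine ⟨fun v hv => hmono.injOn hv.1 hu.1 (hv.2.trans hu.2.symm), L.contDiffAt_limit,
    L.contDiffAt_correction, hu0, L.iteratedDeriv_two_pos h.strictConvex, fun hlt => ?_,
    fun hlt => ?_⟩
  · refine L.priceExpansion_call h.strictConvex hu.2 hY ?_
    rw [← hu.2] at hlt
    -- Strict monotonicity of `Λ₀'` converts the position of `k` relative to `Λ₀'(0)` into the sign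
    -- of `u`.
    exact (hmono.lt_iff_lt h.zero_mem hu.1).1 hlt
  · refine L.priceExpansion_put h.strictConvex hu.2 hY ?_
    rw [← hu.2] at hlt
    exact (hmono.lt_iff_lt hu.1 h.zero_mem).1 hlt
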